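/- Let $\rho=e^{2\pi i/3}$, $\tau=\frac{1+\sqrt5}{2}$, and let $\mathcal V_0\subset \mathrm{PGL}(3,\mathbb C)$ be the Valentiner group, generated by the classes of $$\begin{pmatrix}-1&0&0\\0&1&0\\0&0&-1\end{pmatrix},\quad \begin{pmatrix}0&0&1\\1&0&0\\0&1&0\end{pmatrix},\quad \begin{pmatrix}1&0&0\\0&0&\rho^2\\0&-\rho&0\end{pmatrix},\quad \frac12\begin{pmatrix}1&\tau^{-1}&-\tau\\ \tau^{-1}&\tau&1\\ \tau&-1&\tau^{-1}\end{pmatrix}.$$ Let $$F=10x^3y^3+9x^5z+9y^5z-45x^2y^2z^2-135xyz^4+27z^6\in\mathbb C[x,y,z],$$ let $\Phi$ be the determinant of the Hessian matrix of $F$, and for $P\in\mathbb C$ let $C_P\subset\mathbb P^2$ be the projective plane curve of degree $12$ defined by $P F^2+\Phi=0$. There is a conjugate $\mathcal V$ of $\mathcal V_0$ in $\mathrm{PGL}(3,\mathbb C)$ such that $F$ is invariant under the preimage $\widetilde{\mathcal V}$ of $\mathcal V$ in $\mathrm{SL}(3,\mathbb C)$. For every such $\mathcal V$: 1. the singular locus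 of $C_{20250}$ is a single $\mathcal V$-orbit, consisting of $36$ points; 2. the singular locus of $C_{-10125}$ is a single $\mathcal V$-orbit, consisting of $45$ points; 3. $C_{20250}$ and $C_{-10125}$ are nodal, i.e. all their singular points are nodes (ordinary double points); 4. $C_{20250}$ and $C_{-10125}$ are irreducible, i.e. their defining forms are irreducible in $\mathbb C[x,y,z]$. -/

import Mathlib

open scoped LinearAlgebra.Projectivization MatrixGroups

noncomputable section

namespace Valentiner

open MvPolynomial

/-! ### The Valentiner group -/

/-- The primitive cube root of unity `ρ = exp (2πi/3)`. -/
def rho : ℂ := Complex.exp (2 / 3 * Real.pi * Complex.I)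

/-- The golden ratio `τ = (1 + √5) / 2`, as a complex number. -/
def tau : ℂ := (((1 + √5) / 2 : ℝ) : ℂ)

lemma rho_pow_three : rho ^ 3 = 1 := by
  rw [rho, ← Complex.exp_nat_mul]
  convert Complex.exp_two_pi_mul_I using 2
  push_cast
  ring

lemma tau_sq : tau ^ 2 = tau + 1 := by
  have h : (((1 + √5) / 2 : ℝ)) ^ 2 = (1 + √5) / 2 + 1 := by
    nlinarith [Real.sq_sqrt (show (0 : ℝ) ≤ 5 by norm_num)]
  unfold tau
  exact_mod_cast h

lemma tau_ne_zero : tau ≠ 0 := by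
  intro h
  have := tau_sq
  simp [h] at this

lemma tau_inv : tau⁻¹ = tau - 1 := by
  have h := tau_sq
  field_simp [tau_ne_zero]
  linear_combination -h

/-- The first generator. -/
def gen₁ : SL(3, ℂ) :=
  ⟨!![-1, 0, 0; 0, 1, 0; 0, 0, -1], by simp [Matrix.det_fin_three]⟩

/-- The second generator. -/
def gen₂ : SL(3, ℂ) :=
  ⟨!![0, 0, 1; 1, 0, 0; 0, 1, 0], by simp [Matrix.det_fin_three]⟩

/-- The third generator. -/
def gen₃ : SL(3, ℂ) :=
  ⟨!![1, 0, 0; 0, 0, rho ^ 2; 0, -rho, 0], by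
    simp [Matrix.det_fin_three]
    linear_combination rho_pow_three⟩

/-- The fourth generator. -/
def gen₄ : SL(3, ℂ) :=
  ⟨(1 / 2 : ℂ) • !![1, tau⁻¹, -tau; tau⁻¹, tau, 1; tau, -1, tau⁻¹], by
    rw [tau_inv]
    have h := tau_sq
    simp [Matrix.det_fin_three]
    linear_combination (3 / 4 : ℂ) * h⟩

/-- The Valentiner group `𝒱 ⊆ PGL(3, ℂ)`, in its standard coordinates. -/
def valentinerGroup : Subgroup PGL(3, ℂ) :=
  Subgroup.closure (Matrix.SpecialLinearGroup.toPGL '' {gen₁, gen₂, gen₃, gen₄})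

/-- The preimage in `SL(3, ℂ)` of a subgroup of `PGL(3, ℂ)`. -/
def lift (W : Subgroup PGL(3, ℂ)) : Subgroup SL(3, ℂ) :=
  W.comap Matrix.SpecialLinearGroup.toPGL

/-- The polynomial `G ∘ A`, i.e. `G` with the `i`-th variable replaced by `∑ j, A i j * X j`. -/
def substMatrix (A : Matrix (Fin 3) (Fin 3) ℂ) (G : MvPolynomial (Fin 3) ℂ) :
    MvPolynomial (Fin 3) ℂ :=
  bind₁ (fun i => ∑ j, C (A i j) * X j) G

/-! ### The invariant curves of degree 12 -/

/-- Wiman's sextic form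
`F = 10x³y³ + 9x⁵z + 9y⁵z - 45x²y²z² - 135xyz⁴ + 27z⁶`, with `x, y, z = X 0, X 1, X 2`. -/
def F : MvPolynomial (Fin 3) ℂ :=
  10 * X 0 ^ 3 * X 1 ^ 3 + 9 * X 0 ^ 5 * X 2 + 9 * X 1 ^ 5 * X 2
    - 45 * X 0 ^ 2 * X 1 ^ 2 * X 2 ^ 2 - 135 * X 0 * X 1 * X 2 ^ 4 + 27 * X 2 ^ 6

/-- The Hessian determinant `Φ` of `F`. -/
def Phi : MvPolynomial (Fin 3) ℂ :=
  (Matrix.of fun i j => pderiv i (pderiv j F)).det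

/-- The form `P F² + Φ` of degree 12, defining the plane curve `C_P`. -/
def curve (P : ℂ) : MvPolynomial (Fin 3) ℂ :=
  C P * F ^ 2 + Phi

/-- `W` is the Valentiner group written in a coordinate system in which `F` is invariant: `W` is
obtained from the Valentiner group by a projective change of coordinates, and `F` is invariant
under the preimage of `W` in `SL(3, ℂ)`. -/
def IsValentinerGroupOfF (W : Subgroup PGL(3, ℂ)) : Prop :=
  (∃ g : PGL(3, ℂ), W = valentinerGroup.map (MulAut.conj g).toMonoidHom) ∧
    ∀ A ∈ lift W, substMatrix A F = F

/-! ### Singularities of projective plane curves -/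

/-- The singular locus of the projective plane curve `G = 0`, for a form `G`. -/
def singularLocus (G : MvPolynomial (Fin 3) ℂ) : Set (ℙ ℂ (Fin 3 → ℂ)) :=
  {p | eval p.rep G = 0 ∧ ∀ i, eval p.rep (pderiv i G) = 0}

/-- The equation of the curve `G = 0` in the affine chart `xᵢ = 1`, in affine coordinates
centred at the point `p` (meaningful when the `i`-th coordinate of `p` does not vanish). -/
def localEquation (G : MvPolynomial (Fin 3) ℂ) (p : ℙ ℂ (Fin 3 → ℂ)) (i : Fin 3) :
    MvPolynomial (Fin 2) ℂ :=
  bind₁ (Fin.insertNth (α := fun _ => MvPolynomial (Fin 2) ℂ) i 1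
    fun k => C (p.rep (i.succAbove k) / p.rep i) + X k) G

/-- `p` is a node (ordinary double point) of the curve `G = 0`: in an affine chart centred at `p`,
the equation of the curve has no terms of degree less than 2, and its part of degree 2 is a
product of two linearly independent linear forms (two distinct tangent lines). -/
def IsNode (G : MvPolynomial (Fin 3) ℂ) (p : ℙ ℂ (Fin 3 → ℂ)) : Prop :=
  ∃ i : Fin 3, p.rep i ≠ 0 ∧
    homogeneousComponent 0 (localEquation G p i) = 0 ∧
    homogeneousComponent 1 (localEquation G p i) = 0 ∧
    ∃ l m : Fin 2 → ℂ, LinearIndependent ℂ ![l, m] ∧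
      homogeneousComponent 2 (localEquation G p i) =
        (∑ k, C (l k) * X k) * (∑ k, C (m k) * X k)

/-- The curve `G = 0` is nodal: all its singular points are nodes. -/
def IsNodal (G : MvPolynomial (Fin 3) ℂ) : Prop :=
  ∀ p ∈ singularLocus G, IsNode G p

end Valentiner

end

namespace Valentiner

open MvPolynomial

/-! The singular locus is found by counting. The form `F`, its Hessian determinant and hence every
`curve P` are invariant under the lift of `W`, so `W` acts on the singular locus `S` of `C_P`.
Explicit elimination bounds `S` from above by `n` points, one visible singular point `p` has a
stabilizer in `W` of order at most `k`, and `360 = k * n` divides the order of `W`. Orbit-stabilizer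
then leaves no room: `S` is the orbit of `p` and has exactly `n` elements (`eq_orbit_of_encard_le`).
The pairs `(n, k)` are `(36, 10)` with `p = (0 : 0 : 1)`, and `(45, 8)` with `p = (1 : -1 : 0)`.
Only the divisibility by 360 is needed, not the identification of the group.

The upper bound rests on the dihedral symmetry generated by `diag(ζ, ζ⁴, 1)`, `ζ⁵ = 1`, and the
exchange of `x` and `y`: the equation is a polynomial `curveFun` in `u = x y`, `v = x⁵ + y⁵` and
`z`. The two parameters are visible here: at `P = 20250` the coefficient of `z¹²` vanishes, and at
`P = -10125` that of `u⁶` vanishes, so that the curve meets `z = 0` in `xy (x⁵ + y⁵)² = 0`. A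
singular point with `z = 1` either comes from a singularity in the `(u, v)`-plane, or lies on one of
the five lines of `x⁵ = y⁵`, where `(x, y) ↦ (u, v)` is ramified. In each case the coordinates
satisfy an explicit polynomial (`quadratic_of_curve36`, `diagonal_of_curve36` and their analogues).

For nodality it is enough that the Hessian of `curve P` has rank 2 at the one point `p`: the
property is carried along the orbit, and by Euler's relation it says that the Hessian in an affine
chart is nondegenerate (`isNode_of_hasNondegenerateHessian`).

A suitable conjugate exists because an explicit linear change of variables turns `F` into
`standardSextic`, which is invariant under the four generators.

Irreducibility again uses the dihedral symmetry. The curve is smooth at `(1 : 0 : 0)` and `(0 : 1 :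
0)`, so only one component passes through each, and these components are preserved by the rotation.
Let `A'` be the product of these components and `B` the cofactor (`exists_factorization`). Comparing
the rotation weights of `B` at the two points forces its degree to be 0, 5 or 10. Degree 10 would
make `A'` a conic `k xy + n z²`; degree 5 would make `B` express `v` as a polynomial of degree 2 in
`u`; degree 0 with two components exchanged by the reflection would make the equation a square on
the line `x = y`. All three are refuted by the coefficients. -/

/-! ### Linear substitutions, gradients and Hessians -/

lemma eval_substMatrix (A : Matrix (Fin 3) (Fin 3) ℂ) (G : MvPolynomial (Fin 3) ℂ)
    (v : Fin 3 → ℂ) : eval v (substMatrix A G) = eval (A.mulVec v) G := by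
  rw [substMatrix, ← coe_aeval_eq_eval, RingHom.coe_coe, aeval_bind₁, ← coe_aeval_eq_eval,
    RingHom.coe_coe]
  congr 2
  funext i
  simp [Matrix.mulVec, dotProduct]

lemma substMatrix_mul (A B : Matrix (Fin 3) (Fin 3) ℂ) (G : MvPolynomial (Fin 3) ℂ) :
    substMatrix (A * B) G = substMatrix B (substMatrix A G) := by
  apply MvPolynomial.funext
  intro v
  simp [eval_substMatrix, Matrix.mulVec_mulVec]

lemma substMatrix_one (G : MvPolynomial (Fin 3) ℂ) : substMatrix 1 G = G := by
  apply MvPolynomial.funext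
  intro v
  simp [eval_substMatrix]

lemma pderiv_bind₁ {τ : Type*} (φ : Fin 3 → MvPolynomial τ ℂ) (G : MvPolynomial (Fin 3) ℂ) (k : τ) :
    pderiv k (bind₁ φ G) = ∑ j, pderiv k (φ j) * bind₁ φ (pderiv j G) := by
  induction G using MvPolynomial.induction_on with
  | C a => simp
  | add p q hp hq => simp [hp, hq, mul_add, Finset.sum_add_distrib]
  | mul_X p n hp =>
    have hj : ∀ j, bind₁ φ (pderiv j (p * X n)) =
        φ n * bind₁ φ (pderiv j p) + bind₁ φ p * (if j = n then 1 else 0) := by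
      intro j
      rw [Derivation.leibniz, pderiv_X, Pi.single_apply, smul_eq_mul, smul_eq_mul, map_add,
        map_mul, map_mul, bind₁_X_right, add_comm]
      simp only [eq_comm (a := n)]
      congr 2
      split_ifs <;> simp
    rw [map_mul, bind₁_X_right, Derivation.leibniz, hp, smul_eq_mul, smul_eq_mul]
    simp_rw [hj, mul_add, Finset.sum_add_distrib]
    have hsum : ∑ x, pderiv k (φ x) * (bind₁ φ p * if x = n then 1 else 0) =
        bind₁ φ p * pderiv k (φ n) := by
      simp [mul_comm]
    have hsum' : ∑ x, pderiv k (φ x) * (φ n * bind₁ φ (pderiv x p)) =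
        φ n * ∑ x, pderiv k (φ x) * bind₁ φ (pderiv x p) := by
      rw [Finset.mul_sum]
      exact Finset.sum_congr rfl fun j _ => mul_left_comm _ _ _
    rw [hsum, hsum', add_comm]

lemma pderiv_substMatrix (A : Matrix (Fin 3) (Fin 3) ℂ) (G : MvPolynomial (Fin 3) ℂ)
    (i : Fin 3) :
    pderiv i (substMatrix A G) = ∑ j, C (A j i) * substMatrix A (pderiv j G) := by
  have hX : ∀ n, pderiv i (∑ j, C (A n j) * X j : MvPolynomial (Fin 3) ℂ) = C (A n i) := by
    intro n
    simp [Derivation.leibniz, pderiv_X, Pi.single_apply]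
  rw [substMatrix, pderiv_bind₁]
  simp only [hX, substMatrix]

/-- The Hessian matrix of a form at a point. -/
noncomputable def hessianAt (G : MvPolynomial (Fin 3) ℂ) (v : Fin 3 → ℂ) :
    Matrix (Fin 3) (Fin 3) ℂ :=
  Matrix.of fun i j => eval v (pderiv i (pderiv j G))

/-- The gradient of a form at a point. -/
noncomputable def gradAt (G : MvPolynomial (Fin 3) ℂ) (v : Fin 3 → ℂ) : Fin 3 → ℂ :=
  fun i => eval v (pderiv i G)

lemma gradAt_substMatrix (A : Matrix (Fin 3) (Fin 3) ℂ) (G : MvPolynomial (Fin 3) ℂ)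
    (v : Fin 3 → ℂ) : gradAt (substMatrix A G) v = A.transpose.mulVec (gradAt G (A.mulVec v)) := by
  funext i
  simp [gradAt, pderiv_substMatrix, eval_substMatrix, Matrix.mulVec, dotProduct]

lemma hessianAt_substMatrix (A : Matrix (Fin 3) (Fin 3) ℂ) (G : MvPolynomial (Fin 3) ℂ)
    (v : Fin 3 → ℂ) :
    hessianAt (substMatrix A G) v = A.transpose * hessianAt G (A.mulVec v) * A := by
  ext i j
  simp only [hessianAt, pderiv_substMatrix, map_sum, Derivation.leibniz, pderiv_C, eval_substMatrix,
    Matrix.of_apply, Matrix.mul_apply, Matrix.transpose_apply, map_mul, smul_eq_mul,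
    mul_zero, add_zero, eval_C, Finset.sum_mul, Finset.mul_sum]
  exact Finset.sum_congr rfl fun k _ => Finset.sum_congr rfl fun l _ => by ring

lemma eval_Phi (v : Fin 3 → ℂ) : eval v Phi = (hessianAt F v).det := by
  rw [Phi, RingHom.map_det]
  rfl

/-- The Hessian matrix changes by congruence with `A`, so its determinant is multiplied by `det A ^
2 = 1`. -/
lemma substMatrix_Phi {A : Matrix (Fin 3) (Fin 3) ℂ} (hA : A.det = 1)
    (hF : substMatrix A F = F) : substMatrix A Phi = Phi := by
  apply MvPolynomial.funext
  intro v
  have h := congrArg Matrix.det (hessianAt_substMatrix A F v)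
  rw [hF, Matrix.det_mul, Matrix.det_mul, Matrix.det_transpose, hA] at h
  rw [eval_substMatrix, eval_Phi, eval_Phi, h]
  ring

lemma substMatrix_curve (P : ℂ) {A : Matrix (Fin 3) (Fin 3) ℂ} (hA : A.det = 1)
    (hF : substMatrix A F = F) : substMatrix A (curve P) = curve P := by
  have h1 := substMatrix_Phi hA hF
  rw [substMatrix] at h1 hF ⊢
  simp [curve, h1, hF]

/-! ### Forms on the projective plane and the action of PGL(3) -/

lemma eval_smul_of_isHomogeneous {G : MvPolynomial (Fin 3) ℂ} {n : ℕ} (hG : G.IsHomogeneous n)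
    (c : ℂ) (v : Fin 3 → ℂ) : eval (c • v) G = c ^ n * eval v G := by
  rw [eval_eq, eval_eq, Finset.mul_sum]
  refine Finset.sum_congr rfl fun d hd => ?_
  have hd' : ∑ i ∈ d.support, d i = n := by
    rw [← hG (mem_support_iff.mp hd)]
    simp [Finsupp.weight_apply, Finsupp.sum]
  simp only [Pi.smul_apply, smul_eq_mul, mul_pow, Finset.prod_mul_distrib,
    Finset.prod_pow_eq_pow_sum,
    hd']
  ring

lemma isHomogeneous_pderiv {G : MvPolynomial (Fin 3) ℂ} {n : ℕ} (hG : G.IsHomogeneous (n + 1))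
    (i : Fin 3) : (pderiv i G).IsHomogeneous n := by
  simpa using hG.pderiv (i := i)

/-- The condition on a vector which defines the singular locus. -/
lemma mem_singularLocus_iff {G : MvPolynomial (Fin 3) ℂ} {n : ℕ} (hG : G.IsHomogeneous (n + 1))
    {v : Fin 3 → ℂ} (hv : v ≠ 0) :
    Projectivization.mk ℂ v hv ∈ singularLocus G ↔ eval v G = 0 ∧ gradAt G v = 0 := by
  obtain ⟨a, ha⟩ := Projectivization.exists_smul_eq_mk_rep ℂ v hv
  have ha' : (Projectivization.mk ℂ v hv).rep = (a : ℂ) • v := ha.symm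
  rw [singularLocus, Set.mem_ofPred_eq, ha', eval_smul_of_isHomogeneous hG, funext_iff]
  refine and_congr ?_ (forall_congr' fun i => ?_)
  · simp
  · rw [eval_smul_of_isHomogeneous (isHomogeneous_pderiv hG i)]
    simp [gradAt]

/-- Dividing a matrix by a cube root of its determinant puts it in `SL`, so every element of `PGL`
can be treated through a representative of determinant one. -/
lemma toPGL_surjective :
    Function.Surjective (Matrix.SpecialLinearGroup.toPGL : SL(3, ℂ) →* PGL(3, ℂ)) := by
  intro g
  obtain ⟨x, hx⟩ := Matrix.ProjectiveSpecialLinearGroup.toPGL_surj_of_roots (n := Fin 3) (R := ℂ)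
    (fun r => by
      obtain ⟨z, hz⟩ := IsAlgClosed.exists_pow_nat_eq (r : ℂ) (n := 3) (by norm_num)
      have hz0 : z ≠ 0 := by
        rintro rfl
        exact r.ne_zero (by simpa using hz.symm)
      exact ⟨Units.mk0 z hz0, by ext; simpa using hz⟩) g
  obtain ⟨y, rfl⟩ := QuotientGroup.mk_surjective x
  exact ⟨y, hx⟩

lemma mulVec_ne_zero (A : SL(3, ℂ)) {v : Fin 3 → ℂ} (hv : v ≠ 0) : A.1.mulVec v ≠ 0 := by
  intro h
  apply hv
  have := congrArg (fun w => (A⁻¹).1.mulVec w) h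
  simpa [Matrix.mulVec_mulVec, -Matrix.SpecialLinearGroup.coe_inv,
    ← Matrix.SpecialLinearGroup.coe_mul] using this

lemma toPGL_smul_mk (A : SL(3, ℂ)) {v : Fin 3 → ℂ} (hv : v ≠ 0) :
    Matrix.SpecialLinearGroup.toPGL A • Projectivization.mk ℂ v hv =
      Projectivization.mk ℂ (A.1.mulVec v) (mulVec_ne_zero A hv) := rfl

lemma toPGL_eq_iff {A B : SL(3, ℂ)} :
    Matrix.SpecialLinearGroup.toPGL A = Matrix.SpecialLinearGroup.toPGL B ↔
      ∃ c : ℂ, A.1 = c • B.1 := by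
  constructor
  · intro h
    obtain ⟨u, hu⟩ := Matrix.ProjGenLinGroup.mk_eq_mk_iff.mp h.symm
    refine ⟨u, ?_⟩
    have := congrArg (fun g : GL (Fin 3) ℂ => (g : Matrix (Fin 3) (Fin 3) ℂ)) hu
    simp at this
    rw [← this]
    ext i j
    simp [Matrix.mul_apply, Matrix.diagonal_apply, mul_comm]
  · rintro ⟨c, hc⟩
    have hc0 : c ≠ 0 := by
      rintro rfl
      have := A.2
      rw [hc] at this
      simp at this
    apply Eq.symm
    refine Matrix.ProjGenLinGroup.mk_eq_mk_iff.mpr ⟨Units.mk0 c hc0, ?_⟩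
    ext i j
    simp [hc, Matrix.mul_apply, Matrix.scalar_apply, Matrix.diagonal_apply, mul_comm]

/-! ### The equation of `C_P` in the dihedral invariants -/

lemma F_eq : F = C 10 * X 0 ^ 3 * X 1 ^ 3 + C 9 * X 0 ^ 5 * X 2 + C 9 * X 1 ^ 5 * X 2
    - C 45 * X 0 ^ 2 * X 1 ^ 2 * X 2 ^ 2 - C 135 * X 0 * X 1 * X 2 ^ 4 + C 27 * X 2 ^ 6 := by
  simp only [map_ofNat]
  rfl

/-- The form `P F² + Φ` in terms of `u = x y`, `v = x⁵ + y⁵` and `z`. -/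
noncomputable def curveFun (P u v z : ℂ) : ℂ :=
  (729 * P - 14762250) * z ^ 12 + (486 * P - 59049000) * v * z ^ 7
    + (81 * P + 182250) * v ^ 2 * z ^ 2 + (-7290 * P - 88573500) * u * z ^ 10
    + (-2430 * P + 6561000) * u * v * z ^ 5 + (-121500) * u * v ^ 2
    + (15795 * P - 24603750) * u ^ 2 * z ^ 8 + (-810 * P - 21870000) * u ^ 2 * v * z ^ 3
    + (12690 * P + 21870000) * u ^ 3 * z ^ 6 + (180 * P - 1822500) * u ^ 3 * v * z
    + (-675 * P - 68343750) * u ^ 4 * z ^ 4 + (-900 * P + 9112500) * u ^ 5 * z ^ 2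
    + (100 * P + 1012500) * u ^ 6

/-- The derivative of `curveFun` with respect to `u`. -/
noncomputable def curveFunU (P u v z : ℂ) : ℂ :=
  (-7290 * P - 88573500) * z ^ 10 + (-2430 * P + 6561000) * v * z ^ 5 + (-121500) * v ^ 2
    + (31590 * P - 49207500) * u * z ^ 8 + (-1620 * P - 43740000) * u * v * z ^ 3
    + (38070 * P + 65610000) * u ^ 2 * z ^ 6 + (540 * P - 5467500) * u ^ 2 * v * z
    + (-2700 * P - 273375000) * u ^ 3 * z ^ 4 + (-4500 * P + 45562500) * u ^ 4 * z ^ 2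
    + (600 * P + 6075000) * u ^ 5

/-- The derivative of `curveFun` with respect to `v`. -/
noncomputable def curveFunV (P u v z : ℂ) : ℂ :=
  (486 * P - 59049000) * z ^ 7 + (162 * P + 364500) * v * z ^ 2
    + (-2430 * P + 6561000) * u * z ^ 5 + (-243000) * u * v
    + (-810 * P - 21870000) * u ^ 2 * z ^ 3 + (180 * P - 1822500) * u ^ 3 * z

/-- The derivative of `curveFun` with respect to `z`. -/
noncomputable def curveFunZ (P u v z : ℂ) : ℂ :=
  (8748 * P - 177147000) * z ^ 11 + (3402 * P - 413343000) * v * z ^ 6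
    + (162 * P + 364500) * v ^ 2 * z + (-72900 * P - 885735000) * u * z ^ 9
    + (-12150 * P + 32805000) * u * v * z ^ 4 + (126360 * P - 196830000) * u ^ 2 * z ^ 7
    + (-2430 * P - 65610000) * u ^ 2 * v * z ^ 2 + (76140 * P + 131220000) * u ^ 3 * z ^ 5
    + (180 * P - 1822500) * u ^ 3 * v + (-2700 * P - 273375000) * u ^ 4 * z ^ 3
    + (-1800 * P + 18225000) * u ^ 5 * z

lemma pderiv_F_0 : pderiv 0 F =
    C (-135) * X 1 * X 2 ^ 4 + C (-90) * X 0 * X 1 ^ 2 * X 2 ^ 2 + C 30 * X 0 ^ 2 * X 1 ^ 3 +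
      C 45 * X 0 ^ 4 * X 2 := by
  apply MvPolynomial.funext
  intro v
  rw [F_eq]
  simp [Derivation.leibniz, Derivation.leibniz_pow]
  ring

lemma pderiv_F_1 : pderiv 1 F =
    C 45 * X 1 ^ 4 * X 2 + C (-135) * X 0 * X 2 ^ 4 + C (-90) * X 0 ^ 2 * X 1 * X 2 ^ 2 + C 30 *
      X 0 ^ 3 * X 1 ^ 2 := by
  apply MvPolynomial.funext
  intro v
  rw [F_eq]
  simp [Derivation.leibniz, Derivation.leibniz_pow]
  ring

lemma pderiv_F_2 : pderiv 2 F =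
    C 162 * X 2 ^ 5 + C 9 * X 1 ^ 5 + C (-540) * X 0 * X 1 * X 2 ^ 3 + C (-90) * X 0 ^ 2 *
      X 1 ^ 2 * X 2 + C 9 * X 0 ^ 5 := by
  apply MvPolynomial.funext
  intro v
  rw [F_eq]
  simp [Derivation.leibniz, Derivation.leibniz_pow]
  ring

lemma pderiv_pderiv_F_0_0 : pderiv 0 (pderiv 0 F) =
    C (-90) * X 1 ^ 2 * X 2 ^ 2 + C 60 * X 0 * X 1 ^ 3 + C 180 * X 0 ^ 3 * X 2 := by
  apply MvPolynomial.funext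
  intro v
  rw [pderiv_F_0]
  simp [Derivation.leibniz, Derivation.leibniz_pow]
  ring

lemma pderiv_pderiv_F_0_1 : pderiv 0 (pderiv 1 F) =
    C (-135) * X 2 ^ 4 + C (-180) * X 0 * X 1 * X 2 ^ 2 + C 90 * X 0 ^ 2 * X 1 ^ 2 := by
  apply MvPolynomial.funext
  intro v
  rw [pderiv_F_1]
  simp [Derivation.leibniz, Derivation.leibniz_pow]
  ring

lemma pderiv_pderiv_F_0_2 : pderiv 0 (pderiv 2 F) =
    C (-540) * X 1 * X 2 ^ 3 + C (-180) * X 0 * X 1 ^ 2 * X 2 + C 45 * X 0 ^ 4 := by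
  apply MvPolynomial.funext
  intro v
  rw [pderiv_F_2]
  simp [Derivation.leibniz, Derivation.leibniz_pow]
  ring

lemma pderiv_pderiv_F_1_0 : pderiv 1 (pderiv 0 F) =
    C (-135) * X 2 ^ 4 + C (-180) * X 0 * X 1 * X 2 ^ 2 + C 90 * X 0 ^ 2 * X 1 ^ 2 := by
  apply MvPolynomial.funext
  intro v
  rw [pderiv_F_0]
  simp [Derivation.leibniz, Derivation.leibniz_pow]
  ring

lemma pderiv_pderiv_F_1_1 : pderiv 1 (pderiv 1 F) =
    C 180 * X 1 ^ 3 * X 2 + C (-90) * X 0 ^ 2 * X 2 ^ 2 + C 60 * X 0 ^ 3 * X 1 := by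
  apply MvPolynomial.funext
  intro v
  rw [pderiv_F_1]
  simp [Derivation.leibniz, Derivation.leibniz_pow]
  ring

lemma pderiv_pderiv_F_1_2 : pderiv 1 (pderiv 2 F) =
    C 45 * X 1 ^ 4 + C (-540) * X 0 * X 2 ^ 3 + C (-180) * X 0 ^ 2 * X 1 * X 2 := by
  apply MvPolynomial.funext
  intro v
  rw [pderiv_F_2]
  simp [Derivation.leibniz, Derivation.leibniz_pow]
  ring

lemma pderiv_pderiv_F_2_0 : pderiv 2 (pderiv 0 F) =
    C (-540) * X 1 * X 2 ^ 3 + C (-180) * X 0 * X 1 ^ 2 * X 2 + C 45 * X 0 ^ 4 := by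
  apply MvPolynomial.funext
  intro v
  rw [pderiv_F_0]
  simp [Derivation.leibniz, Derivation.leibniz_pow]
  ring

lemma pderiv_pderiv_F_2_1 : pderiv 2 (pderiv 1 F) =
    C 45 * X 1 ^ 4 + C (-540) * X 0 * X 2 ^ 3 + C (-180) * X 0 ^ 2 * X 1 * X 2 := by
  apply MvPolynomial.funext
  intro v
  rw [pderiv_F_1]
  simp [Derivation.leibniz, Derivation.leibniz_pow]
  ring

lemma pderiv_pderiv_F_2_2 : pderiv 2 (pderiv 2 F) =
    C 810 * X 2 ^ 4 + C (-1620) * X 0 * X 1 * X 2 ^ 2 + C (-90) * X 0 ^ 2 * X 1 ^ 2 := by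
  apply MvPolynomial.funext
  intro v
  rw [pderiv_F_2]
  simp [Derivation.leibniz, Derivation.leibniz_pow]
  ring

lemma curve_eq (P : ℂ) : curve P =
      C (729 * P - 14762250) * X 2 ^ 12
        + C (486 * P - 59049000) * (X 0 ^ 5 + X 1 ^ 5) * X 2 ^ 7
        + C (81 * P + 182250) * (X 0 ^ 5 + X 1 ^ 5) ^ 2 * X 2 ^ 2
        + C (-7290 * P - 88573500) * (X 0 * X 1) * X 2 ^ 10
        + C (-2430 * P + 6561000) * (X 0 * X 1) * (X 0 ^ 5 + X 1 ^ 5) * X 2 ^ 5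
        + C (-121500) * (X 0 * X 1) * (X 0 ^ 5 + X 1 ^ 5) ^ 2
        + C (15795 * P - 24603750) * (X 0 * X 1) ^ 2 * X 2 ^ 8
        + C (-810 * P - 21870000) * (X 0 * X 1) ^ 2 * (X 0 ^ 5 + X 1 ^ 5) * X 2 ^ 3
        + C (12690 * P + 21870000) * (X 0 * X 1) ^ 3 * X 2 ^ 6
        + C (180 * P - 1822500) * (X 0 * X 1) ^ 3 * (X 0 ^ 5 + X 1 ^ 5) * X 2
        + C (-675 * P - 68343750) * (X 0 * X 1) ^ 4 * X 2 ^ 4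
        + C (-900 * P + 9112500) * (X 0 * X 1) ^ 5 * X 2 ^ 2
        + C (100 * P + 1012500) * (X 0 * X 1) ^ 6 := by
  apply MvPolynomial.funext
  intro v
  rw [curve, Phi, Matrix.det_fin_three]
  simp only [Matrix.of_apply, pderiv_pderiv_F_0_0, pderiv_pderiv_F_0_1, pderiv_pderiv_F_0_2,
    pderiv_pderiv_F_1_0, pderiv_pderiv_F_1_1, pderiv_pderiv_F_1_2,
    pderiv_pderiv_F_2_0, pderiv_pderiv_F_2_1, pderiv_pderiv_F_2_2]
  rw [F]
  simp
  ring

lemma eval_curve (P : ℂ) (w : Fin 3 → ℂ) :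
    eval w (curve P) = curveFun P (w 0 * w 1) (w 0 ^ 5 + w 1 ^ 5) (w 2) := by
  rw [curve_eq, curveFun]
  simp

lemma gradAt_curve_zero (P : ℂ) (w : Fin 3 → ℂ) :
    gradAt (curve P) w 0 = w 1 * curveFunU P (w 0 * w 1) (w 0 ^ 5 + w 1 ^ 5) (w 2) +
      5 * w 0 ^ 4 * curveFunV P (w 0 * w 1) (w 0 ^ 5 + w 1 ^ 5) (w 2) := by
  rw [gradAt, curve_eq, curveFunU, curveFunV]
  simp [Derivation.leibniz, Derivation.leibniz_pow]
  ring

lemma gradAt_curve_one (P : ℂ) (w : Fin 3 → ℂ) :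
    gradAt (curve P) w 1 = w 0 * curveFunU P (w 0 * w 1) (w 0 ^ 5 + w 1 ^ 5) (w 2) +
      5 * w 1 ^ 4 * curveFunV P (w 0 * w 1) (w 0 ^ 5 + w 1 ^ 5) (w 2) := by
  rw [gradAt, curve_eq, curveFunU, curveFunV]
  simp [Derivation.leibniz, Derivation.leibniz_pow]
  ring

lemma gradAt_curve_two (P : ℂ) (w : Fin 3 → ℂ) :
    gradAt (curve P) w 2 = curveFunZ P (w 0 * w 1) (w 0 ^ 5 + w 1 ^ 5) (w 2) := by
  rw [gradAt, curve_eq, curveFunZ]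
  simp [Derivation.leibniz, Derivation.leibniz_pow]
  ring

/-! ### Elimination for the singular points -/

/-- At `z = 1` the equation `f` is quadratic in `v`, with discriminant `Δ(u) = f_v² - 2 f_vv f`.
Where `f`, `f_u` and `f_v` all vanish, so do `Δ` and `Δ' = 2 f_v f_uv - 2 f_uvv f - 2 f_vv f_u`. The
quadratic is the greatest common divisor of `Δ` and `Δ'`, and the certificate is a Bézout identity
`α Δ + β Δ'` sorted by `f_v`, `f` and `f_u`. -/
lemma quadratic_of_curve36 {u v : ℂ} (hu : curveFunU 20250 u v 1 = 0) (hv : curveFunV 20250 u v 1 = 0)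
    (hc : curveFun 20250 u v 1 = 0) : ((-9) + (-12) * u + 1 * u ^ 2) = 0 := by
  rw [curveFunU] at hu
  rw [curveFunV] at hv
  rw [curveFun] at hc
  linear_combination
    (1 / 121500) * (((-136009/2916000000) + 5941/243000000 * u + 3563/2916000000 * u ^ 2 +
      (-15421/39366000000) * u ^ 3) * ((30 + (-2) * u) * v + ((-405) + (-351) * u + (-315) *
      u ^ 2 + 15 * u ^ 3)) + 2 * ((-727/216000000) + 61151/5832000000 * u +
      (-105377/17496000000) * u ^ 2 + (-5257/17496000000) * u ^ 3 + 2203/39366000000 * u ^ 4) *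
      (((-2)) * v + ((-351) + (-630) * u + 45 * u ^ 2))) * hv
    + (1 / 121500) * ((1353547/486000000 + (-783209/486000000) * u + 341/874800000 * u ^ 2 +
      356783/13122000000 * u ^ 3 + (-2203/1640250000) * u ^ 4)) * hc
    + (1 / 121500) * ((727/3600000 + (-156149/243000000) * u + 49003/121500000 * u ^ 2 +
      (-13261/2187000000) * u ^ 3 + (-59831/13122000000) * u ^ 4 + 2203/9841500000 * u ^ 5)) * hu

lemma linear_of_curve36 {u v : ℂ} (hv : curveFunV 20250 u v 1 = 0)
    (hh : ((-9) + (-12) * u + 1 * u ^ 2) = 0) : v = (297 + 405 * u) := by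
  rw [curveFunV] at hv
  -- `f_v` is linear in `v`, with leading coefficient `121500 (30 - 2 u)`; the factor `1/24 + u/72`
  -- inverts `30 - 2 u` modulo the quadratic.
  linear_combination (1 / 121500) * (1/24 + 1/72 * u) * hv
    + ((1/36) * v + (249/8 + 5/4 * u + (-5/24) * u ^ 2)) * hh

/-- Put `g(t) = f(t², 2 t⁵)`, the equation restricted to `x = y = t`. The left side of `hd` is `t
g'(t) / 2`, so `t` is a multiple root of `g`; the certificate is a Bézout identity for `g` and `t
g'`, with an extra power of `t` to be cancelled. -/
lemma diagonal_of_curve36 {t : ℂ} (ht : t ≠ 0)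
    (hd : t ^ 2 * curveFunU 20250 (t ^ 2) (2 * t ^ 5) 1 +
      5 * t ^ 5 * curveFunV 20250 (t ^ 2) (2 * t ^ 5) 1 = 0)
    (hc : curveFun 20250 (t ^ 2) (2 * t ^ 5) 1 = 0) : ((-6) + 3 * t + 2 * t ^ 2 + 1 *
      t ^ 3) = 0 := by
  rw [curveFunU, curveFunV] at hd
  rw [curveFun] at hc
  have h : t ^ 2 * ((-6) + 3 * t + 2 * t ^ 2 + 1 * t ^ 3) = 0 := by
    linear_combination (1 / 121500) * t * ((-148727/30375000) + 158107/15187500 * t +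
      (-8111/2025000) * t ^ 2 + 168161/9112500 * t ^ 3 + 209201/54675000 * t ^ 4 +
      33539/22781250 * t ^ 5 + (-4697/2531250) * t ^ 6) * hc
      + (2 / 121500) * (1/648 + 25463/15187500 * t + (-113089/60750000) * t ^ 2 +
        15421/12150000 * t ^ 3 + (-24013/9112500) * t ^ 4 + (-41113/109350000) * t ^ 5 +
        (-57013/546750000) * t ^ 6 + 4697/30375000 * t ^ 7) * hd
  exact (mul_eq_zero.mp h).resolve_left (pow_ne_zero 2 ht)

lemma quadratic_of_curve45 {u v : ℂ} (hu : curveFunU (-10125) u v 1 = 0) (hv : curveFunV (-10125) u v 1 = 0)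
    (hc : curveFun (-10125) u v 1 = 0) : ((-9) + 3 * u + 1 * u ^ 2) = 0 := by
  rw [curveFunU] at hu
  rw [curveFunV] at hv
  rw [curveFun] at hc
  linear_combination
    (1 / 30375) * (((-113/40500000) + (-673/1093500000) * u + 13/136687500 * u ^ 2) * (((-42) +
      (-8) * u) * v + ((-2106) + 1026 * u + (-450) * u ^ 2 + (-120) * u ^ 3)) + 2 *
      ((-89/121500000) + 41/60750000 * u + 97/1093500000 * u ^ 2 + (-13/820125000) * u ^ 3) *
      (((-8)) * v + (1026 + (-900) * u + (-360) * u ^ 2))) * hv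
    + (1 / 30375) * (((-299/1215000) + (-1559/18225000) * u + (-1/2278125) * u ^ 2 +
      26/20503125 * u ^ 3)) * hc
    + (1 / 30375) * (((-623/10125000) + 683/15187500 * u + 1663/91125000 * u ^ 2 + 1/11390625 *
      u ^ 3 + (-26/102515625) * u ^ 4)) * hu

lemma linear_of_curve45 {u v : ℂ} (hv : curveFunV (-10125) u v 1 = 0)
    (hh : ((-9) + 3 * u + 1 * u ^ 2) = 0) : v = ((-378) + 180 * u) := by
  rw [curveFunV] at hv
  linear_combination (1 / 30375) * ((-1/10) + 2/45 * u) * hv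
    + ((16/45) * v + ((-93/5) + (-8) * u + 16/3 * u ^ 2)) * hh

lemma diagonal_of_curve45 {t : ℂ} (ht : t ≠ 0)
    (hd : t ^ 2 * curveFunU (-10125) (t ^ 2) (2 * t ^ 5) 1 +
      5 * t ^ 5 * curveFunV (-10125) (t ^ 2) (2 * t ^ 5) 1 = 0)
    (hc : curveFun (-10125) (t ^ 2) (2 * t ^ 5) 1 = 0) : (9/4 + 9/4 * t + 9/4 * t ^ 2 + (-3/2) *
      t ^ 3 + 1 * t ^ 4) = 0 := by
  rw [curveFunU, curveFunV] at hd
  rw [curveFun] at hc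
  have h : t * (9/4 + 9/4 * t + 9/4 * t ^ 2 + (-3/2) * t ^ 3 + 1 * t ^ 4) = 0 := by
    linear_combination (1 / 30375) * t * ((-1/324) + (-784757/243000000) * t + (-1747/900000) *
      t ^ 2 + (-20077/72900000) * t ^ 3 + (-113197/145800000) * t ^ 4 + (-53471/72900000) *
      t ^ 5 + (-1331/30375000) * t ^ 6) * hc
      + (2 / 30375) * (34757/324000000 + 22169/32400000 * t + 663509/972000000 * t ^ 2 +
        461/1200000 * t ^ 3 + 18421/583200000 * t ^ 4 + 42803/729000000 * t ^ 5 +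
        7183/109350000 * t ^ 6 + 1331/364500000 * t ^ 7) * hd
  exact (mul_eq_zero.mp h).resolve_left ht

/-! ### At most 36, respectively 45, singular points -/

/-- The projective point `(x : y : 1)`. -/
noncomputable def affinePoint (x y : ℂ) : ℙ ℂ (Fin 3 → ℂ) :=
  Projectivization.mk ℂ ![x, y, 1] (by intro h; simpa using congrFun h 2)

/-- The projective point `(1 : y : 0)`. -/
noncomputable def infinitePoint (y : ℂ) : ℙ ℂ (Fin 3 → ℂ) :=
  Projectivization.mk ℂ ![1, y, 0] (by intro h; simpa using congrFun h 0)

lemma homogeneity_curve (P : ℂ) : (curve P).IsHomogeneous 12 := by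
  rw [curve_eq]
  have hC := fun c : ℂ => isHomogeneous_C (Fin 3) c
  have hu : (X 0 * X 1 : MvPolynomial (Fin 3) ℂ).IsHomogeneous 2 :=
    (isHomogeneous_X ℂ 0).mul (isHomogeneous_X ℂ 1)
  have hv : (X 0 ^ 5 + X 1 ^ 5 : MvPolynomial (Fin 3) ℂ).IsHomogeneous 5 :=
    (isHomogeneous_X_pow 0 5).add (isHomogeneous_X_pow 1 5)
  have hz := isHomogeneous_X ℂ (2 : Fin 3)
  refine .add (.add (.add (.add (.add (.add (.add (.add (.add (.add (.add (.add ?_ ?_) ?_) ?_) ?_)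
    ?_) ?_) ?_) ?_) ?_) ?_) ?_) ?_
  · exact (hC _).mul (hz.pow 12)
  · exact ((hC _).mul hv).mul (hz.pow 7)
  · exact ((hC _).mul (hv.pow 2)).mul (hz.pow 2)
  · exact ((hC _).mul hu).mul (hz.pow 10)
  · exact (((hC _).mul hu).mul hv).mul (hz.pow 5)
  · exact ((hC _).mul hu).mul (hv.pow 2)
  · exact ((hC _).mul (hu.pow 2)).mul (hz.pow 8)
  · exact (((hC _).mul (hu.pow 2)).mul hv).mul (hz.pow 3)
  · exact ((hC _).mul (hu.pow 3)).mul (hz.pow 6)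
  · exact (((hC _).mul (hu.pow 3)).mul hv).mul hz
  · exact ((hC _).mul (hu.pow 4)).mul (hz.pow 4)
  · exact ((hC _).mul (hu.pow 5)).mul (hz.pow 2)
  · exact (hC _).mul (hu.pow 6)

/-- A vector representing a singular point, in terms of the functions `curveFun`. -/
lemma mem_singularLocus_curve_iff (P : ℂ) {v : Fin 3 → ℂ} (hv : v ≠ 0) :
    Projectivization.mk ℂ v hv ∈ singularLocus (curve P) ↔
      eval v (curve P) = 0 ∧ gradAt (curve P) v = 0 :=
  mem_singularLocus_iff (homogeneity_curve P) hv

lemma eq_affinePoint_or_eq_infinitePoint (p : ℙ ℂ (Fin 3 → ℂ)) :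
    (∃ x y, p = affinePoint x y) ∨ (∃ y, p = infinitePoint y) ∨
      p = Projectivization.mk ℂ ![0, 1, 0] (by intro h; simpa using congrFun h 1) := by
  induction p using Projectivization.ind with
  | h w hw =>
    by_cases h2 : w 2 = 0
    · right
      by_cases h0 : w 0 = 0
      · right
        have h1 : w 1 ≠ 0 := fun h1 => hw (by ext i; fin_cases i <;> simp [h0, h1, h2])
        rw [Projectivization.mk_eq_mk_iff']
        exact ⟨w 1, by ext i; fin_cases i <;> simp [h0, h2]⟩
      · left
        refine ⟨w 1 / w 0, ?_⟩
        rw [infinitePoint, Projectivization.mk_eq_mk_iff']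
        exact ⟨w 0, by ext i; fin_cases i <;> simp [h2]; field_simp⟩
    · left
      refine ⟨w 0 / w 2, w 1 / w 2, ?_⟩
      rw [affinePoint, Projectivization.mk_eq_mk_iff']
      exact ⟨w 2, by ext i; fin_cases i <;> simp <;> field_simp⟩

lemma affinePoint_mem_singularLocus_iff (P x y : ℂ) :
    affinePoint x y ∈ singularLocus (curve P) ↔
      curveFun P (x * y) (x ^ 5 + y ^ 5) 1 = 0 ∧
      y * curveFunU P (x * y) (x ^ 5 + y ^ 5) 1 +
        5 * x ^ 4 * curveFunV P (x * y) (x ^ 5 + y ^ 5) 1 = 0 ∧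
      x * curveFunU P (x * y) (x ^ 5 + y ^ 5) 1 +
        5 * y ^ 4 * curveFunV P (x * y) (x ^ 5 + y ^ 5) 1 = 0 ∧
      curveFunZ P (x * y) (x ^ 5 + y ^ 5) 1 = 0 := by
  rw [affinePoint, mem_singularLocus_curve_iff, eval_curve, funext_iff, Fin.forall_fin_succ,
    Fin.forall_fin_succ, Fin.forall_fin_succ]
  simp only [Fin.succ_zero_eq_one, Fin.succ_one_eq_two, gradAt_curve_zero, gradAt_curve_one,
    gradAt_curve_two]
  simp

lemma infinitePoint_mem_singularLocus_iff (P y : ℂ) :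
    infinitePoint y ∈ singularLocus (curve P) ↔
      curveFun P y (1 + y ^ 5) 0 = 0 ∧
      y * curveFunU P y (1 + y ^ 5) 0 + 5 * curveFunV P y (1 + y ^ 5) 0 = 0 ∧
      curveFunU P y (1 + y ^ 5) 0 + 5 * y ^ 4 * curveFunV P y (1 + y ^ 5) 0 = 0 ∧
      curveFunZ P y (1 + y ^ 5) 0 = 0 := by
  rw [infinitePoint, mem_singularLocus_curve_iff, eval_curve, funext_iff, Fin.forall_fin_succ,
    Fin.forall_fin_succ, Fin.forall_fin_succ]
  simp only [Fin.succ_zero_eq_one, Fin.succ_one_eq_two, gradAt_curve_zero, gradAt_curve_one,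
    gradAt_curve_two]
  simp

/-- A singular point of the affine part of `C_P` lies on one of the five lines `x⁵ = y⁵`, or
comes from a singular point in the coordinates `u = x y`, `v = x⁵ + y⁵`. -/
lemma affinePoint_singular_cases {P x y : ℂ} (h : affinePoint x y ∈ singularLocus (curve P)) :
    (x = 0 ∧ y = 0) ∨
    (∃ r t : ℂ, r ^ 5 = 1 ∧ t ≠ 0 ∧ x = r * t ∧ y = r⁻¹ * t ∧
      t ^ 2 * curveFunU P (t ^ 2) (2 * t ^ 5) 1 +
        5 * t ^ 5 * curveFunV P (t ^ 2) (2 * t ^ 5) 1 = 0 ∧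
      curveFun P (t ^ 2) (2 * t ^ 5) 1 = 0) ∨
    (curveFunU P (x * y) (x ^ 5 + y ^ 5) 1 = 0 ∧ curveFunV P (x * y) (x ^ 5 + y ^ 5) 1 = 0 ∧
      curveFun P (x * y) (x ^ 5 + y ^ 5) 1 = 0) := by
  obtain ⟨hc, h0, h1, -⟩ := (affinePoint_mem_singularLocus_iff P x y).mp h
  by_cases hxy : x ^ 5 = y ^ 5
  · by_cases hx : x = 0
    · left
      subst hx
      exact ⟨rfl, by simpa using hxy.symm⟩
    · right; left
      have hy : y ≠ 0 := by
        rintro rfl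
        exact hx (by simpa using hxy)
      have ht2 : (x ^ 3 / y ^ 2) ^ 2 = x * y := by
        field_simp
        linear_combination hxy
      have ht5 : (x ^ 3 / y ^ 2) ^ 5 = x ^ 5 := by
        field_simp
        linear_combination (x ^ 5 + y ^ 5) * hxy
      have hv : 2 * (x ^ 3 / y ^ 2) ^ 5 = x ^ 5 + y ^ 5 := by
        rw [ht5]
        linear_combination hxy
      -- Since `x⁵ = y⁵`, the choice `t = x³ / y²` satisfies `t² = x y` and `t⁵ = x⁵`, and `r = y² /
      -- x²` is a fifth root of unity with `r t = x`.
      refine ⟨y ^ 2 / x ^ 2, x ^ 3 / y ^ 2, ?_, by positivity, by field_simp, ?_, ?_, ?_⟩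
      · field_simp
        linear_combination (-x ^ 5 - y ^ 5) * hxy
      · field_simp
        linear_combination -hxy
      · rw [hv, ht2, ht5]
        linear_combination x * h0
      · rw [hv, ht2, hc]
  · right; right
    -- Up to sign, the Jacobian determinant of `(x, y) ↦ (x y, x⁵ + y⁵)` is `5 (x⁵ - y⁵)`. Where it
    -- is nonzero, a vanishing gradient in `(x, y)` forces `f_u = f_v = 0`; this is Cramer's rule.
    have hxy' : x ^ 5 - y ^ 5 ≠ 0 := sub_ne_zero.mpr hxy
    refine ⟨?_, ?_, hc⟩
    · refine (mul_eq_zero.mp ?_).resolve_left hxy'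
      linear_combination x ^ 4 * h1 - y ^ 4 * h0
    · refine (mul_eq_zero.mp ?_).resolve_left (mul_ne_zero (by norm_num : (5 : ℂ) ≠ 0) hxy')
      linear_combination x * h0 - y * h1

/-- The points of the affine part with given `u = x y ≠ 0` and `v = x⁵ + y⁵`. -/
noncomputable def fibrePoints (u v : ℂ) : Set (ℙ ℂ (Fin 3 → ℂ)) :=
  (fun x => affinePoint x (u / x)) ''
    {x : ℂ | (Polynomial.X ^ 10 - Polynomial.C v * Polynomial.X ^ 5 +
      Polynomial.C (u ^ 5)).IsRoot x}

/-- The points `(r t : r⁻¹ t : 1)` for a fifth root of unity `r` and a root `t` of `q`. -/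
noncomputable def diagonalPoints (q : Polynomial ℂ) : Set (ℙ ℂ (Fin 3 → ℂ)) :=
  (fun a : ℂ × ℂ => affinePoint (a.1 * a.2) (a.1⁻¹ * a.2)) ''
    ({r : ℂ | (Polynomial.X ^ 5 - 1 : Polynomial ℂ).IsRoot r} ×ˢ {t : ℂ | q.IsRoot t})

/-- The five points `(1 : -r : 0)` for a fifth root of unity `r`. -/
noncomputable def infinitePoints : Set (ℙ ℂ (Fin 3 → ℂ)) :=
  infinitePoint '' {r : ℂ | (Polynomial.X ^ 5 + 1 : Polynomial ℂ).IsRoot r}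

lemma encard_isRoot_le {q : Polynomial ℂ} (n : ℕ) (hq : q ≠ 0) (hn : q.natDegree ≤ n) :
    {x : ℂ | q.IsRoot x}.encard ≤ n := by
  have h : {x : ℂ | q.IsRoot x} = (q.roots.toFinset : Set ℂ) := by
    ext x
    simp [hq]
  rw [h, Set.encard_coe_eq_coe_finsetCard]
  exact_mod_cast (Multiset.toFinset_card_le _).trans ((Polynomial.card_roots' q).trans hn)

lemma encard_fibrePoints_le (u v : ℂ) : (fibrePoints u v).encard ≤ 10 := by
  have hd : (Polynomial.X ^ 10 - Polynomial.C v * Polynomial.X ^ 5 +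
      Polynomial.C (u ^ 5)).natDegree = 10 := by compute_degree!
  refine (Set.encard_image_le _ _).trans (encard_isRoot_le 10 ?_ hd.le)
  intro h
  rw [h] at hd
  simp at hd

lemma encard_prod_le {α β : Type*} (s : Set α) (t : Set β) {m n : ℕ} (hs : s.encard ≤ m)
    (ht : t.encard ≤ n) : (s ×ˢ t).encard ≤ (m * n : ℕ) := by
  rw [Set.encard_prod]
  push_cast
  gcongr

lemma encard_diagonalPoints_le {q : Polynomial ℂ} (n : ℕ) (hq : q ≠ 0) (hn : q.natDegree ≤ n) :
    (diagonalPoints q).encard ≤ (5 * n : ℕ) := by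
  have hd : (Polynomial.X ^ 5 - 1 : Polynomial ℂ).natDegree = 5 := by compute_degree!
  refine (Set.encard_image_le _ _).trans (encard_prod_le _ _ (encard_isRoot_le 5 ?_ hd.le)
    (encard_isRoot_le n hq hn))
  intro h
  rw [h] at hd
  simp at hd

lemma encard_infinitePoints_le : infinitePoints.encard ≤ 5 := by
  have hd : (Polynomial.X ^ 5 + 1 : Polynomial ℂ).natDegree = 5 := by compute_degree!
  refine (Set.encard_image_le _ _).trans (encard_isRoot_le 5 ?_ hd.le)
  intro h
  rw [h] at hd
  simp at hd

lemma affinePoint_mem_fibrePoints {x y u v : ℂ} (hu : x * y = u) (hv : x ^ 5 + y ^ 5 = v)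
    (h0 : u ≠ 0) : affinePoint x y ∈ fibrePoints u v := by
  subst hu hv
  have hx : x ≠ 0 := left_ne_zero_of_mul h0
  refine ⟨x, ?_, ?_⟩
  · simp
    ring
  · simp [mul_div_cancel_left₀ _ hx]

lemma affinePoint_mem_diagonalPoints {r t : ℂ} {q : Polynomial ℂ} (hr : r ^ 5 = 1)
    (ht : q.IsRoot t) : affinePoint (r * t) (r⁻¹ * t) ∈ diagonalPoints q :=
  ⟨(r, t), ⟨by simp [hr], ht⟩, rfl⟩

/-- On `z = 0` the derivative in `z` reduces to the single term `(180 P - 1822500) u³ v`. The case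
`u = 0` is excluded by the term `-121500 u v²`. -/
lemma singular_at_infinity {P y : ℂ} (hP : 180 * P - 1822500 ≠ 0)
    (h : infinitePoint y ∈ singularLocus (curve P)) : y ≠ 0 ∧ 1 + y ^ 5 = 0 := by
  obtain ⟨hc, h0, h1, h2⟩ := (infinitePoint_mem_singularLocus_iff P y).mp h
  have hy : y ≠ 0 := by
    rintro rfl
    rw [curveFunU, curveFunV] at h1
    norm_num at h1
  refine ⟨hy, ?_⟩
  rw [curveFunZ] at h2
  refine (mul_eq_zero.mp ?_).resolve_left (mul_ne_zero hP (pow_ne_zero 3 hy))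
  linear_combination h2

lemma vertical_not_mem_singularLocus (P : ℂ) :
    Projectivization.mk ℂ ![0, 1, 0] (by intro h; simpa using congrFun h 1) ∉
      singularLocus (curve P) := by
  rw [mem_singularLocus_curve_iff]
  rintro ⟨-, h⟩
  have h0 := congrFun h 0
  rw [gradAt_curve_zero, curveFunU, curveFunV] at h0
  simp at h0

lemma singularLocus_curve36_subset : singularLocus (curve 20250) ⊆
    {affinePoint 0 0} ∪ diagonalPoints (Polynomial.X ^ 3 + 2 * Polynomial.X ^ 2 +
      3 * Polynomial.X - 6) ∪ fibrePoints (6 * tau + 3) (405 * (6 * tau + 3) + 297) ∪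
      fibrePoints (9 - 6 * tau) (405 * (9 - 6 * tau) + 297) := by
  intro p hp
  rcases eq_affinePoint_or_eq_infinitePoint p with ⟨x, y, rfl⟩ | ⟨y, rfl⟩ | rfl
  · rcases affinePoint_singular_cases hp with ⟨rfl, rfl⟩ | ⟨r, t, hr, ht, rfl, rfl, hd, hc⟩ |
      ⟨hu, hv, hc⟩
    · simp
    · left; left; right
      apply affinePoint_mem_diagonalPoints hr
      have := diagonal_of_curve36 ht hd hc
      simp
      linear_combination this
    · have hh := quadratic_of_curve36 hu hv hc
      have hl := linear_of_curve36 hv hh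
      have hu0 : x * y ≠ 0 := by
        intro h0
        rw [h0] at hh
        norm_num at hh
      -- The roots of `u² - 12 u - 9` are `6 ± 3√5`, which are `6τ + 3` and `9 - 6τ`.
      have hprod : (x * y - (6 * tau + 3)) * (x * y - (9 - 6 * tau)) = 0 := by
        linear_combination hh - 36 * tau_sq
      rcases mul_eq_zero.mp hprod with h | h
      · left; right
        have h' := sub_eq_zero.mp h
        rw [← h']
        exact affinePoint_mem_fibrePoints rfl (by linear_combination hl) hu0
      · right
        have h' := sub_eq_zero.mp h
        rw [← h']
        exact affinePoint_mem_fibrePoints rfl (by linear_combination hl) hu0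
  · obtain ⟨hy, hv⟩ := singular_at_infinity (by norm_num) hp
    have hc := ((infinitePoint_mem_singularLocus_iff 20250 y).mp hp).1
    rw [hv, curveFun] at hc
    -- With `v = z = 0` only the term `(100 P + 1012500) u⁶ = 3037500 u⁶` of the equation remains.
    refine absurd ?_ (pow_ne_zero 6 hy)
    linear_combination hc / 3037500
  · exact absurd hp (vertical_not_mem_singularLocus _)

lemma singularLocus_curve45_subset : singularLocus (curve (-10125)) ⊆
    infinitePoints ∪ diagonalPoints (4 * Polynomial.X ^ 4 - 6 * Polynomial.X ^ 3 +
      9 * Polynomial.X ^ 2 + 9 * Polynomial.X + 9) ∪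
      fibrePoints (3 * tau - 3) (180 * (3 * tau - 3) - 378) ∪
      fibrePoints (-3 * tau) (180 * (-3 * tau) - 378) := by
  intro p hp
  rcases eq_affinePoint_or_eq_infinitePoint p with ⟨x, y, rfl⟩ | ⟨y, rfl⟩ | rfl
  · rcases affinePoint_singular_cases hp with ⟨rfl, rfl⟩ | ⟨r, t, hr, ht, rfl, rfl, hd, hc⟩ |
      ⟨hu, hv, hc⟩
    · have hc := ((affinePoint_mem_singularLocus_iff (-10125) 0 0).mp hp).1
      rw [curveFun] at hc
      norm_num at hc
    · left; left; right
      apply affinePoint_mem_diagonalPoints hr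
      have := diagonal_of_curve45 ht hd hc
      simp
      linear_combination 4 * this
    · have hh := quadratic_of_curve45 hu hv hc
      have hl := linear_of_curve45 hv hh
      have hu0 : x * y ≠ 0 := by
        intro h0
        rw [h0] at hh
        norm_num at hh
      -- The roots of `u² + 3 u - 9` are `(-3 ± 3√5) / 2`, which are `3τ - 3` and `-3τ`.
      have hprod : (x * y - (3 * tau - 3)) * (x * y - (-3 * tau)) = 0 := by
        linear_combination hh - 9 * tau_sq
      rcases mul_eq_zero.mp hprod with h | h
      · left; right
        have h' := sub_eq_zero.mp h
        rw [← h']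
        exact affinePoint_mem_fibrePoints rfl (by linear_combination hl) hu0
      · right
        have h' := sub_eq_zero.mp h
        rw [← h']
        exact affinePoint_mem_fibrePoints rfl (by linear_combination hl) hu0
  · left; left; left
    obtain ⟨hy, hv⟩ := singular_at_infinity (by norm_num) hp
    exact ⟨y, by simp; linear_combination hv, rfl⟩
  · exact absurd hp (vertical_not_mem_singularLocus _)

lemma encard_union_le_of_le {α : Type*} {s t : Set α} {m n : ℕ} (hs : s.encard ≤ m)
    (ht : t.encard ≤ n) : (s ∪ t).encard ≤ (m + n : ℕ) := by
  refine (Set.encard_union_le s t).trans ?_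
  push_cast
  gcongr

lemma encard_singularLocus_curve36_le : (singularLocus (curve 20250)).encard ≤ 36 := by
  refine (Set.encard_le_encard singularLocus_curve36_subset).trans ?_
  have hd : (Polynomial.X ^ 3 + 2 * Polynomial.X ^ 2 +
      3 * Polynomial.X - 6 : Polynomial ℂ).natDegree = 3 := by compute_degree!
  -- The count is `1 + 5 * 3 + 10 + 10`.
  exact encard_union_le_of_le (m := 26) (n := 10) (encard_union_le_of_le (m := 16) (n := 10)
    (encard_union_le_of_le (m := 1) (n := 15) (by simp)
      (encard_diagonalPoints_le 3 (fun h => by simp [h] at hd) hd.le))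
    (encard_fibrePoints_le _ _)) (encard_fibrePoints_le _ _)

lemma encard_singularLocus_curve45_le : (singularLocus (curve (-10125))).encard ≤ 45 := by
  refine (Set.encard_le_encard singularLocus_curve45_subset).trans ?_
  have hd : (4 * Polynomial.X ^ 4 - 6 * Polynomial.X ^ 3 +
      9 * Polynomial.X ^ 2 + 9 * Polynomial.X + 9 : Polynomial ℂ).natDegree = 4 := by
    compute_degree!
  -- The count is `5 + 5 * 4 + 10 + 10`.
  exact encard_union_le_of_le (m := 35) (n := 10) (encard_union_le_of_le (m := 25) (n := 10)
    (encard_union_le_of_le (m := 5) (n := 20) encard_infinitePoints_le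
      (encard_diagonalPoints_le 4 (fun h => by simp [h] at hd) hd.le))
    (encard_fibrePoints_le _ _)) (encard_fibrePoints_le _ _)

lemma affinePoint_mem_singularLocus_curve36 : affinePoint 0 0 ∈ singularLocus (curve 20250) := by
  rw [affinePoint_mem_singularLocus_iff, curveFun, curveFunU, curveFunV, curveFunZ]
  norm_num

lemma infinitePoint_mem_singularLocus_curve45 :
    infinitePoint (-1) ∈ singularLocus (curve (-10125)) := by
  rw [infinitePoint_mem_singularLocus_iff, curveFun, curveFunU, curveFunV, curveFunZ]
  norm_num

/-! ### Stabilizers of the two base points -/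

/-- A sextic in coordinates adapted to a point `(0 : 0 : 1)` fixed by a dihedral group. -/
noncomputable def dihedralSextic (a b c₂ c₃ e₁ e₂ e₃ e₄ e₅ e₆ p q d : ℂ) : ℂ :=
  a * d ^ 6 + b * d ^ 4 * (p * q) + d ^ 2 * (c₂ * (p * q) ^ 2 + e₁ * p ^ 4 + e₂ * q ^ 4) +
    d * (e₃ * p ^ 5 + e₄ * q ^ 5) + c₃ * (p * q) ^ 3 + p * q * (e₅ * p ^ 4 + e₆ * q ^ 4)

section

variable {a b c₂ c₃ e₁ e₂ e₃ e₄ e₅ e₆ : ℂ}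

/-- Both sides are polynomials in `d` of degree at most 6. Here and in the next lemmas one
coefficient is extracted by Lagrange interpolation at `d = 0, ±1, ±2, ±3`; the weights are those of
the corresponding finite-difference formula. -/
lemma dihedralSextic_coeff_five {p q P Q L γ : ℂ}
    (h : ∀ d, dihedralSextic a b c₂ c₃ e₁ e₂ e₃ e₄ e₅ e₆ P Q (L + γ * d) =
      dihedralSextic a b c₂ c₃ e₁ e₂ e₃ e₄ e₅ e₆ p q d) : 6 * a * γ ^ 5 * L = 0 := by
  simp only [dihedralSextic] at h
  linear_combination (1/48) * h 1 + (-1/48) * h (-1) + (-1/60) * h 2 + (1/60) * h (-2) +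
    (1/240) * h 3 + (-1/240) * h (-3)

lemma dihedralSextic_coeff_six {p q P Q γ : ℂ}
    (h : ∀ d, dihedralSextic a b c₂ c₃ e₁ e₂ e₃ e₄ e₅ e₆ P Q (γ * d) =
      dihedralSextic a b c₂ c₃ e₁ e₂ e₃ e₄ e₅ e₆ p q d) : a * γ ^ 6 = a := by
  simp only [dihedralSextic] at h
  linear_combination (-1/36) * h 0 + (1/48) * h 1 + (1/48) * h (-1) + (-1/120) * h 2 +
    (-1/120) * h (-2) + (1/720) * h 3 + (1/720) * h (-3)

lemma dihedralSextic_coeff_four {p q P Q γ : ℂ}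
    (h : ∀ d, dihedralSextic a b c₂ c₃ e₁ e₂ e₃ e₄ e₅ e₆ P Q (γ * d) =
      dihedralSextic a b c₂ c₃ e₁ e₂ e₃ e₄ e₅ e₆ p q d) :
    b * (γ ^ 4 * (P * Q)) = b * (p * q) := by
  simp only [dihedralSextic] at h
  linear_combination (7/18) * h 0 + (-13/48) * h 1 + (-13/48) * h (-1) + (1/12) * h 2 + (1/12) *
    h (-2) + (-1/144) * h 3 + (-1/144) * h (-3)

lemma dihedralSextic_coeff_two {p q P Q γ : ℂ}
    (h : ∀ d, dihedralSextic a b c₂ c₃ e₁ e₂ e₃ e₄ e₅ e₆ P Q (γ * d) =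
      dihedralSextic a b c₂ c₃ e₁ e₂ e₃ e₄ e₅ e₆ p q d) :
    γ ^ 2 * (c₂ * (P * Q) ^ 2 + e₁ * P ^ 4 + e₂ * Q ^ 4) =
      c₂ * (p * q) ^ 2 + e₁ * p ^ 4 + e₂ * q ^ 4 := by
  simp only [dihedralSextic] at h
  linear_combination (-49/36) * h 0 + (3/4) * h 1 + (3/4) * h (-1) + (-3/40) * h 2 + (-3/40) *
    h (-2) + (1/180) * h 3 + (1/180) * h (-3)

lemma dihedralSextic_coeff_one {p q P Q γ : ℂ}
    (h : ∀ d, dihedralSextic a b c₂ c₃ e₁ e₂ e₃ e₄ e₅ e₆ P Q (γ * d) =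
      dihedralSextic a b c₂ c₃ e₁ e₂ e₃ e₄ e₅ e₆ p q d) :
    γ * (e₃ * P ^ 5 + e₄ * Q ^ 5) = e₃ * p ^ 5 + e₄ * q ^ 5 := by
  simp only [dihedralSextic] at h
  linear_combination (3/4) * h 1 + (-3/4) * h (-1) + (-3/20) * h 2 + (3/20) * h (-2) + (1/60) *
    h 3 + (-1/60) * h (-3)

/-- The linear automorphisms of the sextic which fix the point `(0 : 0 : 1)` are multiples of
`diag(r, r⁻¹, 1)` or exchange the first two coordinate lines. -/
lemma dihedralSextic_automorphism (ha : a ≠ 0) (hb : b ≠ 0)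
    {B : Matrix (Fin 3) (Fin 3) ℂ} (hB : B.det ≠ 0) (h02 : B 0 2 = 0) (h12 : B 1 2 = 0)
    (h : ∀ p q d, dihedralSextic a b c₂ c₃ e₁ e₂ e₃ e₄ e₅ e₆ (B 0 0 * p + B 0 1 * q)
      (B 1 0 * p + B 1 1 * q) (B 2 0 * p + B 2 1 * q + B 2 2 * d) =
        dihedralSextic a b c₂ c₃ e₁ e₂ e₃ e₄ e₅ e₆ p q d) :
    ∃ γ r : ℂ, γ ≠ 0 ∧ r ≠ 0 ∧ γ ^ 6 = 1 ∧
      ((B = γ • !![r, 0, 0; 0, r⁻¹, 0; 0, 0, 1] ∧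
        e₁ * r ^ 4 = e₁ ∧ e₃ * r ^ 5 = e₃) ∨
      (B = γ • !![0, r, 0; r⁻¹, 0, 0; 0, 0, 1] ∧ e₁ * r ^ 4 = e₂ ∧ e₃ * r ^ 5 = e₄)) := by
  have hdet : B.det = B 2 2 * (B 0 0 * B 1 1 - B 0 1 * B 1 0) := by
    rw [Matrix.det_fin_three, h02, h12]
    ring
  have hγ : B 2 2 ≠ 0 := fun h0 => hB (by rw [hdet, h0, zero_mul])
  have hk : 6 * a * B 2 2 ^ 5 ≠ 0 :=
    mul_ne_zero (mul_ne_zero (by norm_num) ha) (pow_ne_zero 5 hγ)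
  -- The sextic has no term in `d⁵`, while a substitution `d ↦ L + γ d` creates the term `6 a γ⁵ L
  -- d⁵`.
  have h20 : B 2 0 = 0 := by
    have := dihedralSextic_coeff_five (L := B 2 0) (γ := B 2 2) (p := 1) (q := 0)
      (P := B 0 0) (Q := B 1 0) (fun d => by simpa using h 1 0 d)
    exact (mul_eq_zero.mp this).resolve_left hk
  have h21 : B 2 1 = 0 := by
    have := dihedralSextic_coeff_five (L := B 2 1) (γ := B 2 2) (p := 0) (q := 1)
      (P := B 0 1) (Q := B 1 1) (fun d => by simpa using h 0 1 d)
    exact (mul_eq_zero.mp this).resolve_left hk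
  simp only [h20, h21, zero_mul, zero_add] at h
  have h6 : B 2 2 ^ 6 = 1 := by
    have := dihedralSextic_coeff_six (h 0 0)
    exact mul_left_cancel₀ ha (by rw [this, mul_one])
  -- The coefficient of `d⁴` shows that the pair of lines `p q = 0` is preserved, so the upper-left
  -- block is diagonal or antidiagonal.
  have h4 : ∀ p q, B 2 2 ^ 4 * ((B 0 0 * p + B 0 1 * q) * (B 1 0 * p + B 1 1 * q)) = p * q :=
    fun p q => mul_left_cancel₀ hb (dihedralSextic_coeff_four (h p q))
  have hγ4 : B 2 2 ^ 4 ≠ 0 := pow_ne_zero 4 hγ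
  have hp : B 0 0 * B 1 0 = 0 := (mul_eq_zero.mp (by
    linear_combination h4 1 0 : B 2 2 ^ 4 * (B 0 0 * B 1 0) = 0)).resolve_left hγ4
  have hq : B 0 1 * B 1 1 = 0 := (mul_eq_zero.mp (by
    linear_combination h4 0 1 : B 2 2 ^ 4 * (B 0 1 * B 1 1) = 0)).resolve_left hγ4
  have hpq : B 2 2 ^ 4 * (B 0 0 * B 1 1 + B 0 1 * B 1 0) = 1 := by
    linear_combination h4 1 1 - h4 1 0 - h4 0 1
  have hBe : B = !![B 0 0, B 0 1, 0; B 1 0, B 1 1, 0; 0, 0, B 2 2] := by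
    ext i j
    fin_cases i <;> fin_cases j <;> simp [h02, h12, h20, h21]
  rcases mul_eq_zero.mp hp with h00 | h10
  · have h01 : B 0 1 ≠ 0 := fun h01 => by simp [h00, h01] at hpq
    have h11 : B 1 1 = 0 := (mul_eq_zero.mp hq).resolve_left h01
    simp only [h00, h11, zero_mul, zero_add, add_zero] at h hpq
    refine ⟨B 2 2, B 0 1 / B 2 2, hγ, div_ne_zero h01 hγ, h6, Or.inr ⟨?_, ?_, ?_⟩⟩
    · have h10 : B 1 0 = B 2 2 * (B 0 1 / B 2 2)⁻¹ := by
        field_simp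
        refine mul_left_cancel₀ hγ4 ?_
        linear_combination hpq - h6
      conv_lhs => rw [hBe, h00, h11, h10]
      ext i j
      fin_cases i <;> fin_cases j <;> simp
      field_simp
    · have := dihedralSextic_coeff_two (h 0 1)
      field_simp
      refine mul_left_cancel₀ (pow_ne_zero 2 hγ) ?_
      linear_combination this - e₂ * h6
    · have := dihedralSextic_coeff_one (h 0 1)
      field_simp
      refine mul_left_cancel₀ hγ ?_
      linear_combination this - e₄ * h6
  · have h00 : B 0 0 ≠ 0 := fun h00 => by simp [h00, h10] at hpq
    have h11 : B 1 1 ≠ 0 := fun h11 => by simp [h10, h11] at hpq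
    have h01 : B 0 1 = 0 := (mul_eq_zero.mp hq).resolve_right h11
    simp only [h10, h01, zero_mul, zero_add, add_zero] at h hpq
    refine ⟨B 2 2, B 0 0 / B 2 2, hγ, div_ne_zero h00 hγ, h6, Or.inl ⟨?_, ?_, ?_⟩⟩
    · have h11' : B 1 1 = B 2 2 * (B 0 0 / B 2 2)⁻¹ := by
        field_simp
        refine mul_left_cancel₀ hγ4 ?_
        linear_combination hpq - h6
      conv_lhs => rw [hBe, h10, h01, h11']
      ext i j
      fin_cases i <;> fin_cases j <;> simp
      field_simp
    · have := dihedralSextic_coeff_two (h 1 0)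
      field_simp
      refine mul_left_cancel₀ (pow_ne_zero 2 hγ) ?_
      linear_combination this - e₁ * h6
    · have := dihedralSextic_coeff_one (h 1 0)
      field_simp
      refine mul_left_cancel₀ hγ ?_
      linear_combination this - e₃ * h6

end

/-- The class in `PGL(3, ℂ)` of a matrix, or `1` if the matrix is singular. -/
noncomputable def pglOfMatrix (B : Matrix (Fin 3) (Fin 3) ℂ) : PGL(3, ℂ) :=
  open Classical in
  if h : B.det ≠ 0 then .mk (Matrix.GeneralLinearGroup.mkOfDetNeZero B h) else 1

lemma toPGL_eq_pglOfMatrix {A : SL(3, ℂ)} {B : Matrix (Fin 3) (Fin 3) ℂ} {c : ℂ}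
    (h : A.1 = c • B) : Matrix.SpecialLinearGroup.toPGL A = pglOfMatrix B := by
  have hA : (c • B).det = 1 := h ▸ A.2
  rw [Matrix.det_smul] at hA
  have hc : c ≠ 0 := by
    rintro rfl
    simp at hA
  have hB : B.det ≠ 0 := fun hB => by simp [hB] at hA
  rw [pglOfMatrix, dif_pos hB]
  apply Eq.symm
  refine Matrix.ProjGenLinGroup.mk_eq_mk_iff.mpr ⟨Units.mk0 c hc, ?_⟩
  ext i j
  simp [h, Matrix.mul_apply, Matrix.scalar_apply, Matrix.diagonal_apply, mul_comm,
    Matrix.GeneralLinearGroup.mkOfDetNeZero]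

/-- If `F` is a dihedral sextic in the coordinates given by `M`, then the subgroup of `PGL(3, ℂ)`
which preserves `F` and fixes the point `M (0, 0, 1)` is small. -/
lemma stabilizer_subset {a b c₂ c₃ e₁ e₂ e₃ e₄ e₅ e₆ : ℂ} (ha : a ≠ 0) (hb : b ≠ 0)
    {M : Matrix (Fin 3) (Fin 3) ℂ} (hM : M.det ≠ 0)
    (hF : ∀ p q d, eval (M.mulVec ![p, q, d]) F =
      dihedralSextic a b c₂ c₃ e₁ e₂ e₃ e₄ e₅ e₆ p q d)
    {v : Fin 3 → ℂ} (hv : v ≠ 0) (hMv : M.mulVec ![0, 0, 1] = v) {A : SL(3, ℂ)}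
    (hA : substMatrix A.1 F = F)
    (hAv : Matrix.SpecialLinearGroup.toPGL A • Projectivization.mk ℂ v hv =
      Projectivization.mk ℂ v hv) :
    Matrix.SpecialLinearGroup.toPGL A ∈
      (fun r : ℂ => pglOfMatrix (M * !![r, 0, 0; 0, r⁻¹, 0; 0, 0, 1] * M⁻¹)) ''
        {r | e₁ * r ^ 4 = e₁ ∧ e₃ * r ^ 5 = e₃} ∪
      (fun r : ℂ => pglOfMatrix (M * !![0, r, 0; r⁻¹, 0, 0; 0, 0, 1] * M⁻¹)) ''
        {r | e₁ * r ^ 4 = e₂ ∧ e₃ * r ^ 5 = e₄} := by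
  have hMu : IsUnit M.det := isUnit_iff_ne_zero.mpr hM
  set B := M⁻¹ * A.1 * M with hB
  have hMB : M * B = A.1 * M := by
    rw [hB, ← mul_assoc, ← mul_assoc, Matrix.mul_nonsing_inv _ hMu, one_mul]
  have hAB : A.1 = M * B * M⁻¹ := by
    rw [hMB, mul_assoc, Matrix.mul_nonsing_inv _ hMu, mul_one]
  have hBdet : B.det ≠ 0 := by
    intro h0
    have := congrArg Matrix.det hMB
    rw [Matrix.det_mul, h0, Matrix.det_mul, Matrix.SpecialLinearGroup.det_coe, mul_zero,
      one_mul] at this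
    exact hM this.symm
  obtain ⟨c, hc⟩ := (Projectivization.mk_eq_mk_iff' ℂ _ _ _ _).mp ((toPGL_smul_mk A hv) ▸ hAv)
  have hBv : B.mulVec ![0, 0, 1] = c • ![0, 0, 1] := by
    have hinj := Matrix.mulVec_injective_iff_isUnit.mpr
      ((Matrix.isUnit_iff_isUnit_det M).mpr hMu)
    apply hinj
    rw [Matrix.mulVec_mulVec, hMB, ← Matrix.mulVec_mulVec, Matrix.mulVec_smul, hMv]
    exact hc.symm
  have h02 : B 0 2 = 0 := by
    simpa [Matrix.mulVec, dotProduct, Fin.sum_univ_three] using congrFun hBv 0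
  have h12 : B 1 2 = 0 := by
    simpa [Matrix.mulVec, dotProduct, Fin.sum_univ_three] using congrFun hBv 1
  have hinv : ∀ p q d, dihedralSextic a b c₂ c₃ e₁ e₂ e₃ e₄ e₅ e₆ (B 0 0 * p + B 0 1 * q)
      (B 1 0 * p + B 1 1 * q) (B 2 0 * p + B 2 1 * q + B 2 2 * d) =
        dihedralSextic a b c₂ c₃ e₁ e₂ e₃ e₄ e₅ e₆ p q d := by
    intro p q d
    have hvec : ![B 0 0 * p + B 0 1 * q, B 1 0 * p + B 1 1 * q,
        B 2 0 * p + B 2 1 * q + B 2 2 * d] = B.mulVec ![p, q, d] := by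
      ext i
      fin_cases i <;> simp [Matrix.mulVec, dotProduct, Fin.sum_univ_three, h02, h12]
    rw [← hF, ← hF, hvec, Matrix.mulVec_mulVec, hMB, ← Matrix.mulVec_mulVec, ← eval_substMatrix, hA]
  obtain ⟨γ, r, -, -, -, ⟨hBr, h4, h5⟩ | ⟨hBr, h4, h5⟩⟩ :=
    dihedralSextic_automorphism ha hb hBdet h02 h12 hinv
  · left
    refine ⟨r, ⟨h4, h5⟩, (toPGL_eq_pglOfMatrix (c := γ) ?_).symm⟩
    rw [hAB, hBr, Matrix.mul_smul, Matrix.smul_mul]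
  · right
    refine ⟨r, ⟨h4, h5⟩, (toPGL_eq_pglOfMatrix (c := γ) ?_).symm⟩
    rw [hAB, hBr, Matrix.mul_smul, Matrix.smul_mul]

lemma encard_pow_eq_le {e e' : ℂ} (n : ℕ) (hn : 0 < n) (he : e ≠ 0) :
    {r : ℂ | e * r ^ n = e'}.encard ≤ n := by
  have hd : (Polynomial.C e * Polynomial.X ^ n - Polynomial.C e').natDegree = n := by
    rw [Polynomial.natDegree_sub_C, Polynomial.natDegree_C_mul_X_pow n e he]
  have h := encard_isRoot_le (q := Polynomial.C e * Polynomial.X ^ n - Polynomial.C e') n ?_ hd.le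
  · simpa [sub_eq_zero] using h
  · intro h
    rw [h] at hd
    simp at hd
    omega

lemma encard_stabilizer_affinePoint_le {W : Subgroup PGL(3, ℂ)}
    (hW : ∀ A ∈ lift W, substMatrix A F = F) :
    {w ∈ W | w • affinePoint 0 0 = affinePoint 0 0}.encard ≤ 10 := by
  have hsub : {w ∈ W | w • affinePoint 0 0 = affinePoint 0 0} ⊆
      (fun r : ℂ => pglOfMatrix (1 * !![r, 0, 0; 0, r⁻¹, 0; 0, 0, 1] * 1⁻¹)) ''
        {r | (0 : ℂ) * r ^ 4 = 0 ∧ (9 : ℂ) * r ^ 5 = 9} ∪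
      (fun r : ℂ => pglOfMatrix (1 * !![0, r, 0; r⁻¹, 0, 0; 0, 0, 1] * 1⁻¹)) ''
        {r | (0 : ℂ) * r ^ 4 = 0 ∧ (9 : ℂ) * r ^ 5 = 9} := by
    rintro w ⟨hw, hp⟩
    obtain ⟨A, rfl⟩ := toPGL_surjective w
    -- `F` already has the required shape in the coordinates `x, y, z`; the condition `9 r⁵ = 9`
    -- leaves five values of `r` in each of the two families.
    refine stabilizer_subset (a := 27) (b := -135) (c₂ := -45) (c₃ := 10) (e₅ := 0) (e₆ := 0)
      (by norm_num) (by norm_num) (by simp) ?_ _ (by simp) (hW A hw) hp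
    intro p q d
    simp [F, dihedralSextic]
    ring
  refine (Set.encard_le_encard hsub).trans (encard_union_le_of_le (m := 5) (n := 5) ?_ ?_)
  all_goals
    refine (Set.encard_image_le _ _).trans ((Set.encard_le_encard ?_).trans
      (encard_pow_eq_le (e := 9) (e' := 9) 5 (by norm_num) (by norm_num)))
    exact fun r hr => hr.2

lemma exists_sq_eq_fifteen : ∃ k : ℂ, k ^ 2 = 15 := IsAlgClosed.exists_pow_nat_eq 15 (by norm_num)

lemma encard_stabilizer_infinitePoint_le {W : Subgroup PGL(3, ℂ)}
    (hW : ∀ A ∈ lift W, substMatrix A F = F) :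
    {w ∈ W | w • infinitePoint (-1) = infinitePoint (-1)}.encard ≤ 8 := by
  obtain ⟨k, hk⟩ := exists_sq_eq_fifteen
  have hk0 : k ≠ 0 := by
    rintro rfl
    norm_num at hk
  -- With `x = s + d` and `y = s - d` only even powers of `d` occur in `F`, and the coefficient of
  -- `d⁴` is `15 (2 s² + 6 s z - 3 z²)`. This form splits over `√15`, and `p, q` are multiples of
  -- its two linear factors.
  set M : Matrix (Fin 3) (Fin 3) ℂ := !![1 / 4 - k / 20, 1 / 4 + k / 20, 1;
    1 / 4 - k / 20, 1 / 4 + k / 20, -1; k / 30, -k / 30, 0] with hMdef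
  have hMdet : M.det ≠ 0 := by
    rw [hMdef, Matrix.det_fin_three]
    simp
    intro h
    apply hk0
    linear_combination (-30) * h
  -- The product with the conjugate `-15 - 4 k` is `225 - 240 = -15`.
  have he : (-15 + 4 * k) ≠ 0 := by
    intro h
    have : (-15 + 4 * k) * (-15 - 4 * k) = 0 := by rw [h, zero_mul]
    have h' : (-15 : ℂ) = 0 := by linear_combination this + 16 * hk
    norm_num at h'
  have hsub : {w ∈ W | w • infinitePoint (-1) = infinitePoint (-1)} ⊆
      (fun r : ℂ => pglOfMatrix (M * !![r, 0, 0; 0, r⁻¹, 0; 0, 0, 1] * M⁻¹)) ''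
        {r | (3 / 32 * (-15 + 4 * k)) * r ^ 4 = (3 / 32 * (-15 + 4 * k)) ∧ (0 : ℂ) * r ^ 5 = 0} ∪
      (fun r : ℂ => pglOfMatrix (M * !![0, r, 0; r⁻¹, 0, 0; 0, 0, 1] * M⁻¹)) ''
        {r | (3 / 32 * (-15 + 4 * k)) * r ^ 4 = (3 / 32 * (-15 - 4 * k)) ∧ (0 : ℂ) *
          r ^ 5 = 0} := by
    rintro w ⟨hw, hp⟩
    obtain ⟨A, rfl⟩ := toPGL_surjective w
    refine stabilizer_subset (a := -10) (b := 15 / 2) (c₂ := 15 / 16) (c₃ := 1 / 64)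
      (e₅ := 9 / 128 - 3 / 160 * k) (e₆ := 9 / 128 + 3 / 160 * k)
      (by norm_num) (by norm_num) hMdet ?_ _ ?_ (hW A hw) hp
    · intro p q d
      simp [F, dihedralSextic, hMdef]
      linear_combination (
      (-1/1382400) * p ^ 6 * k ^ 4 + 1/96000 * p ^ 6 * k ^ 3 + (-13/230400) * p ^ 6 * k ^ 2
      + 1/6400 * p ^ 6 * k + (-1/6144) * p ^ 6 + 1/230400 * p ^ 5 * q * k ^ 4
      + (-1/24000) * p ^ 5 * q * k ^ 3 + 1/6400 * p ^ 5 * q * k ^ 2 + (-1/1600) * p ^ 5 * q * k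
      + 19/5120 * p ^ 5 * q + (-1/92160) * p ^ 4 * q ^ 2 * k ^ 4
      + 1/19200 * p ^ 4 * q ^ 2 * k ^ 3 + (-3/25600) * p ^ 4 * q ^ 2 * k ^ 2
      + 1/1280 * p ^ 4 * q ^ 2 * k + (-5/2048) * p ^ 4 * q ^ 2
      + (-1/1920) * p ^ 4 * d ^ 2 * k ^ 2 + 1/80 * p ^ 4 * d ^ 2 * k + (-11/128) * p ^ 4 * d ^ 2
      + 1/69120 * p ^ 3 * q ^ 3 * k ^ 4 + 1/28800 * p ^ 3 * q ^ 3 * k ^ 2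
      + (-17/7680) * p ^ 3 * q ^ 3 + 1/480 * p ^ 3 * q * d ^ 2 * k ^ 2
      + (-1/40) * p ^ 3 * q * d ^ 2 * k + 1/32 * p ^ 3 * q * d ^ 2
      + (-1/92160) * p ^ 2 * q ^ 4 * k ^ 4 + (-1/19200) * p ^ 2 * q ^ 4 * k ^ 3
      + (-3/25600) * p ^ 2 * q ^ 4 * k ^ 2 + (-1/1280) * p ^ 2 * q ^ 4 * k
      + (-5/2048) * p ^ 2 * q ^ 4 + (-1/320) * p ^ 2 * q ^ 2 * d ^ 2 * k ^ 2
      + 7/64 * p ^ 2 * q ^ 2 * d ^ 2 + (-1/8) * p ^ 2 * d ^ 4 + 1/230400 * p * q ^ 5 * k ^ 4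
      + 1/24000 * p * q ^ 5 * k ^ 3 + 1/6400 * p * q ^ 5 * k ^ 2 + 1/1600 * p * q ^ 5 * k
      + 19/5120 * p * q ^ 5 + 1/480 * p * q ^ 3 * d ^ 2 * k ^ 2 + 1/40 * p * q ^ 3 * d ^ 2 * k
      + 1/32 * p * q ^ 3 * d ^ 2 + 1/4 * p * q * d ^ 4 + (-1/1382400) * q ^ 6 * k ^ 4
      + (-1/96000) * q ^ 6 * k ^ 3 + (-13/230400) * q ^ 6 * k ^ 2 + (-1/6400) * q ^ 6 * k
      + (-1/6144) * q ^ 6 + (-1/1920) * q ^ 4 * d ^ 2 * k ^ 2 + (-1/80) * q ^ 4 * d ^ 2 * k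
      + (-11/128) * q ^ 4 * d ^ 2 + (-1/8) * q ^ 2 * d ^ 4) * hk
    · ext i
      fin_cases i <;> simp [hMdef]
  have hle : ∀ e' : ℂ, {r : ℂ | (3 / 32 * (-15 + 4 * k)) * r ^ 4 = e' ∧
      (0 : ℂ) * r ^ 5 = 0}.encard ≤ 4 := fun e' =>
    (Set.encard_le_encard fun r hr => hr.1).trans
      (encard_pow_eq_le 4 (by norm_num) (mul_ne_zero (by norm_num) he))
  exact (Set.encard_le_encard hsub).trans (encard_union_le_of_le (m := 4) (n := 4)
    ((Set.encard_image_le _ _).trans (hle _)) ((Set.encard_image_le _ _).trans (hle _)))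

/-! ### The order of the Valentiner group is divisible by 360 -/

/-- If `b` normalizes the cyclic group generated by `a`, and `b ^ p` is its first power in it, then
the order of the group is divisible by `p` times the order of `a`. -/
lemma orderOf_mul_dvd_card {G : Type*} [Group G] {a b : G} {p : ℕ} [Fact p.Prime]
    (hab : b * a * b⁻¹ ∈ Subgroup.zpowers a) (hab' : b⁻¹ * a * b ∈ Subgroup.zpowers a)
    (hb : b ∉ Subgroup.zpowers a) (hbp : b ^ p ∈ Subgroup.zpowers a) :
    orderOf a * p ∣ Nat.card G := by
  set N := Subgroup.normalizer (Subgroup.zpowers a : Set G) with hN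
  have conj_mem : ∀ g : G, g * a * g⁻¹ ∈ Subgroup.zpowers a → ∀ h ∈ Subgroup.zpowers a,
      g * h * g⁻¹ ∈ Subgroup.zpowers a := by
    rintro g hg h ⟨n, rfl⟩
    have : g * a ^ n * g⁻¹ = (g * a * g⁻¹) ^ n := by rw [conj_zpow]
    simp only [this]
    exact Subgroup.zpow_mem _ hg n
  have hbN : b ∈ N := by
    rw [hN, Subgroup.mem_normalizer_iff]
    refine fun h => ⟨conj_mem b hab h, fun hh => ?_⟩
    have := conj_mem b⁻¹ (by simpa using hab') _ hh
    simpa [mul_assoc] using this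
  have hle : Subgroup.zpowers a ≤ N := Subgroup.le_normalizer
  set H := (Subgroup.zpowers a).subgroupOf N with hH
  have hHn : H.Normal := Subgroup.normal_in_normalizer
  have hcardH : Nat.card H = orderOf a := by
    rw [← Nat.card_zpowers]
    exact Nat.card_congr (Subgroup.subgroupOfEquivOfLe hle).toEquiv
  -- In the quotient of the normalizer by the cyclic group of `a`, the image of `b` has order
  -- exactly `p`; this supplies the extra factor.
  have horder : orderOf (QuotientGroup.mk (⟨b, hbN⟩ : N) : N ⧸ H) = p := by
    apply orderOf_eq_prime
    · rw [← QuotientGroup.mk_pow, QuotientGroup.eq_one_iff]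
      exact hbp
    · rw [Ne, QuotientGroup.eq_one_iff]
      exact hb
  have hp : p ∣ Nat.card (N ⧸ H) := horder ▸ orderOf_dvd_natCard _
  calc orderOf a * p ∣ Nat.card (N ⧸ H) * Nat.card H := by
        rw [hcardH, mul_comm]
        exact Nat.mul_dvd_mul_right hp _
    _ = Nat.card N := (Subgroup.card_eq_card_quotient_mul_card_subgroup H).symm
    _ ∣ Nat.card G := Subgroup.card_subgroup_dvd_card N

lemma toPGL_eq_one_iff {A : SL(3, ℂ)} :
    Matrix.SpecialLinearGroup.toPGL A = 1 ↔ ∃ c : ℂ, A.1 = c • (1 : Matrix (Fin 3) (Fin 3) ℂ) := by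
  rw [← map_one Matrix.SpecialLinearGroup.toPGL, toPGL_eq_iff]
  rfl

lemma rho_ne_one : rho ≠ 1 := by
  have : IsPrimitiveRoot rho 3 := by
    have h := Complex.isPrimitiveRoot_exp 3 (by norm_num)
    have he : rho = Complex.exp (2 * Real.pi * Complex.I / (3 : ℕ)) := by
      rw [rho]
      congr 1
      push_cast
      ring
    rwa [he]
  exact this.ne_one (by norm_num)

lemma rho_sq : rho ^ 2 = -rho - 1 := by
  refine sub_eq_zero.mp ((mul_eq_zero.mp ?_).resolve_left (sub_ne_zero.mpr rho_ne_one))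
  linear_combination rho_pow_three

lemma coe_gen₁ : gen₁.1 = !![-1, 0, 0; 0, 1, 0; 0, 0, -1] := rfl

lemma coe_gen₂ : gen₂.1 = !![0, 0, 1; 1, 0, 0; 0, 1, 0] := rfl

lemma coe_gen₃ : gen₃.1 = !![1, 0, 0; 0, 0, rho ^ 2; 0, -rho, 0] := rfl

lemma coe_gen₄ : gen₄.1 = (1 / 2 : ℂ) • !![1, tau - 1, -tau; tau - 1, tau, 1;
    tau, -1, tau - 1] := by
  rw [← tau_inv]
  rfl

lemma toPGL_gen₁_sq : Matrix.SpecialLinearGroup.toPGL gen₁ ^ 2 = 1 := by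
  rw [← map_pow, toPGL_eq_one_iff]
  refine ⟨1, ?_⟩
  rw [sq, Matrix.SpecialLinearGroup.coe_mul, coe_gen₁]
  ext i j
  fin_cases i <;> fin_cases j <;> simp [Matrix.mul_apply, Fin.sum_univ_three]

lemma gen₃_sq : (gen₃ ^ 2).1 = !![1, 0, 0; 0, -1, 0; 0, 0, -1] := by
  rw [sq, Matrix.SpecialLinearGroup.coe_mul, coe_gen₃]
  have h := rho_pow_three
  ext i j
  fin_cases i <;> fin_cases j <;> simp [Matrix.mul_apply, Fin.sum_univ_three] <;>
    linear_combination h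

lemma orderOf_toPGL_gen₃ : orderOf (Matrix.SpecialLinearGroup.toPGL gen₃) = 4 := by
  have : Fact (Nat.Prime 2) := ⟨Nat.prime_two⟩
  refine orderOf_eq_prime_pow (p := 2) (n := 1) ?_ ?_
  · rw [pow_one, ← map_pow, toPGL_eq_one_iff]
    rintro ⟨c, hc⟩
    rw [gen₃_sq] at hc
    have h0 := congrFun (congrFun hc 0) 0
    have h1 := congrFun (congrFun hc 1) 1
    simp at h0 h1
    rw [← h0] at h1
    norm_num at h1
  · rw [← map_pow, toPGL_eq_one_iff]
    refine ⟨1, ?_⟩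
    rw [show 2 ^ (1 + 1) = 2 * 2 by norm_num, pow_mul, sq (gen₃ ^ 2),
      Matrix.SpecialLinearGroup.coe_mul, gen₃_sq]
    ext i j
    fin_cases i <;> fin_cases j <;> simp [Matrix.mul_apply, Fin.sum_univ_three]

lemma gen₁_mul_gen₃ : gen₁ * gen₃ * (gen₁ * gen₃) = 1 := by
  have h := rho_pow_three
  apply Subtype.ext
  rw [Matrix.SpecialLinearGroup.coe_mul, Matrix.SpecialLinearGroup.coe_mul, coe_gen₁, coe_gen₃]
  ext i j
  fin_cases i <;> fin_cases j <;> simp [Matrix.mul_apply, Fin.sum_univ_three] <;>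
    linear_combination h

lemma orderOf_toPGL_gen₂ : orderOf (Matrix.SpecialLinearGroup.toPGL gen₂) = 3 := by
  have : Fact (Nat.Prime 3) := ⟨Nat.prime_three⟩
  apply orderOf_eq_prime
  · rw [← map_pow, toPGL_eq_one_iff]
    refine ⟨1, ?_⟩
    rw [pow_succ, sq, Matrix.SpecialLinearGroup.coe_mul, Matrix.SpecialLinearGroup.coe_mul,
      coe_gen₂]
    ext i j
    fin_cases i <;> fin_cases j <;> simp [Matrix.mul_apply, Fin.sum_univ_three]
  · rw [Ne, toPGL_eq_one_iff]
    rintro ⟨c, hc⟩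
    rw [coe_gen₂] at hc
    simpa using congrFun (congrFun hc 0) 2

lemma orderOf_toPGL_gen₄ : orderOf (Matrix.SpecialLinearGroup.toPGL gen₄) = 5 := by
  have : Fact (Nat.Prime 5) := ⟨Nat.prime_five⟩
  have h := tau_sq
  have h2 : (gen₄ ^ 2).1 = (1 / 2 : ℂ) • !![1 - tau, tau, -1; tau, 1, tau - 1; 1, 1 - tau,
    -tau] := by
    rw [sq, Matrix.SpecialLinearGroup.coe_mul, coe_gen₄]
    ext i j
    fin_cases i <;> fin_cases j <;> simp [Matrix.mul_apply, Fin.sum_univ_three] <;> grind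
  apply orderOf_eq_prime
  · rw [← map_pow, toPGL_eq_one_iff]
    refine ⟨1, ?_⟩
    rw [show 5 = 2 + 2 + 1 by norm_num, pow_add, pow_add, pow_one,
      Matrix.SpecialLinearGroup.coe_mul,
      Matrix.SpecialLinearGroup.coe_mul, h2, coe_gen₄]
    ext i j
    fin_cases i <;> fin_cases j <;> simp [Matrix.mul_apply, Fin.sum_univ_three] <;> grind
  · rw [Ne, toPGL_eq_one_iff]
    rintro ⟨c, hc⟩
    rw [coe_gen₄] at hc
    simpa using congrFun (congrFun hc 2) 1

/-- An element of order three of the Valentiner group which commutes with `gen₂`. -/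
noncomputable def heisenbergElement : SL(3, ℂ) := gen₄ * gen₄ * gen₃

lemma coe_heisenbergElement : heisenbergElement.1 = (1 / 2 : ℂ) •
    !![1 - tau, rho, tau * rho ^ 2; tau, (1 - tau) * rho, rho ^ 2;
      1, tau * rho, (1 - tau) * rho ^ 2] := by
  have h := tau_sq
  rw [heisenbergElement, Matrix.SpecialLinearGroup.coe_mul, Matrix.SpecialLinearGroup.coe_mul,
    coe_gen₄, coe_gen₃]
  ext i j
  fin_cases i <;> fin_cases j <;> simp [Matrix.mul_apply, Fin.sum_univ_three] <;> grind

lemma heisenbergElement_mul_gen₂ : Matrix.SpecialLinearGroup.toPGL heisenbergElement *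
    Matrix.SpecialLinearGroup.toPGL gen₂ =
      Matrix.SpecialLinearGroup.toPGL gen₂ *
        Matrix.SpecialLinearGroup.toPGL heisenbergElement := by
  have h := rho_pow_three
  rw [← map_mul, ← map_mul, toPGL_eq_iff]
  -- The matrices commute only up to the scalar `ρ`, which disappears in `PGL`.
  refine ⟨rho, ?_⟩
  rw [Matrix.SpecialLinearGroup.coe_mul, Matrix.SpecialLinearGroup.coe_mul,
    coe_heisenbergElement, coe_gen₂]
  ext i j
  fin_cases i <;> fin_cases j <;> simp [Matrix.mul_apply, Fin.sum_univ_three] <;> grind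

lemma heisenbergElement_pow_three : Matrix.SpecialLinearGroup.toPGL heisenbergElement ^ 3 = 1 := by
  have h := rho_pow_three
  have h' := rho_sq
  have ht := tau_sq
  have h2 : (heisenbergElement ^ 2).1 = (1 / 2 : ℂ) • !![1 - tau, tau, 1;
      rho ^ 2, (1 - tau) * rho ^ 2, tau * rho ^ 2; tau * rho, rho, (1 - tau) * rho] := by
    rw [sq, Matrix.SpecialLinearGroup.coe_mul, coe_heisenbergElement]
    ext i j
    fin_cases i <;> fin_cases j <;> simp [Matrix.mul_apply, Fin.sum_univ_three] <;> grind
  rw [← map_pow, toPGL_eq_one_iff]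
  refine ⟨1, ?_⟩
  rw [pow_succ, Matrix.SpecialLinearGroup.coe_mul, h2, coe_heisenbergElement]
  ext i j
  fin_cases i <;> fin_cases j <;> simp [Matrix.mul_apply, Fin.sum_univ_three] <;> grind

/-- The powers of `gen₂` are permutation matrices, and for each of them some zero entry sits where
the matrix of `heisenbergElement` is nonzero, so they are not proportional. -/
lemma heisenbergElement_not_mem_zpowers : Matrix.SpecialLinearGroup.toPGL heisenbergElement ∉
    Subgroup.zpowers (Matrix.SpecialLinearGroup.toPGL gen₂) := by
  classical
  intro hmem
  have hne := tau_ne_zero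
  have hfin : IsOfFinOrder (Matrix.SpecialLinearGroup.toPGL gen₂) := by
    rw [← orderOf_pos_iff, orderOf_toPGL_gen₂]
    norm_num
  obtain ⟨k, hk, hk'⟩ := (hfin.mem_zpowers_iff_mem_range_orderOf).mp hmem |> Finset.mem_image.mp
  rw [orderOf_toPGL_gen₂, Finset.mem_range] at hk
  rw [← map_pow] at hk'
  obtain ⟨c, hc⟩ := toPGL_eq_iff.mp hk'.symm
  rw [coe_heisenbergElement] at hc
  interval_cases k
  · have := congrFun (congrFun hc 1) 0
    rw [pow_zero, Matrix.SpecialLinearGroup.coe_one] at this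
    simp at this
    exact hne this
  · have := congrFun (congrFun hc 2) 0
    rw [pow_one, coe_gen₂] at this
    simp at this
  · have := congrFun (congrFun hc 1) 0
    rw [sq gen₂, Matrix.SpecialLinearGroup.coe_mul, coe_gen₂] at this
    simp at this
    exact hne this

lemma toPGL_gen_mem {g : SL(3, ℂ)} (hg : g ∈ ({gen₁, gen₂, gen₃, gen₄} : Set SL(3, ℂ))) :
    Matrix.SpecialLinearGroup.toPGL g ∈ valentinerGroup :=
  Subgroup.subset_closure ⟨g, hg, rfl⟩

/-- A version of `orderOf_mul_dvd_card` for a subgroup. -/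
lemma orderOf_mul_dvd_card_subgroup {G : Type*} [Group G] {K : Subgroup G} {a b : G} {p : ℕ}
    [Fact p.Prime] (ha : a ∈ K) (hbK : b ∈ K) (hab : b * a * b⁻¹ ∈ Subgroup.zpowers a)
    (hab' : b⁻¹ * a * b ∈ Subgroup.zpowers a)
    (hb : b ∉ Subgroup.zpowers a) (hbp : b ^ p ∈ Subgroup.zpowers a) :
    orderOf a * p ∣ Nat.card K := by
  have key : ∀ x : K, x ∈ Subgroup.zpowers (⟨a, ha⟩ : K) ↔ (x : G) ∈ Subgroup.zpowers a := by
    intro x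
    simp only [Subgroup.mem_zpowers_iff, Subtype.ext_iff, Subgroup.coe_zpow]
  have := orderOf_mul_dvd_card (a := (⟨a, ha⟩ : K)) (b := ⟨b, hbK⟩) (p := p)
    ((key _).mpr hab) ((key _).mpr hab') (fun h => hb ((key _).mp h)) ((key _).mpr hbp)
  rwa [Subgroup.orderOf_mk] at this

/-- The coprime factors come from subgroups: 5 from `gen₄`, 9 from the commuting elements `gen₂` and
`heisenbergElement` of order three, and 8 from the dihedral group generated by `gen₃` of order four
and the involution `gen₁`. -/
lemma dvd_card_valentinerGroup : 360 ∣ Nat.card valentinerGroup := by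
  have h1 := toPGL_gen_mem (g := gen₁) (by simp)
  have h2 := toPGL_gen_mem (g := gen₂) (by simp)
  have h3 := toPGL_gen_mem (g := gen₃) (by simp)
  have h4 := toPGL_gen_mem (g := gen₄) (by simp)
  have hH : Matrix.SpecialLinearGroup.toPGL heisenbergElement ∈ valentinerGroup := by
    rw [heisenbergElement, map_mul, map_mul]
    exact mul_mem (mul_mem h4 h4) h3
  have d5 : 5 ∣ Nat.card valentinerGroup := by
    rw [← orderOf_toPGL_gen₄, ← Subgroup.orderOf_mk _ h4]
    exact orderOf_dvd_natCard _
  have : Fact (Nat.Prime 3) := ⟨Nat.prime_three⟩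
  have : Fact (Nat.Prime 2) := ⟨Nat.prime_two⟩
  have d9 : 3 * 3 ∣ Nat.card valentinerGroup := by
    have hc := heisenbergElement_mul_gen₂
    have := orderOf_mul_dvd_card_subgroup (p := 3) h2 hH
      (by rw [hc, mul_inv_cancel_right]; exact Subgroup.mem_zpowers _)
      (by rw [mul_assoc, ← hc, inv_mul_cancel_left]; exact Subgroup.mem_zpowers _)
      heisenbergElement_not_mem_zpowers
      (by rw [heisenbergElement_pow_three]; exact one_mem _)
    rwa [orderOf_toPGL_gen₂] at this
  have d8 : 4 * 2 ∣ Nat.card valentinerGroup := by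
    set a := Matrix.SpecialLinearGroup.toPGL gen₃ with ha
    set b := Matrix.SpecialLinearGroup.toPGL gen₁ with hb
    have hsq : b * b = 1 := by rw [← sq]; exact toPGL_gen₁_sq
    have hbinv : b⁻¹ = b := inv_eq_of_mul_eq_one_left hsq
    have hba : b * a * (b * a) = 1 := by
      rw [ha, hb, ← map_mul, ← map_mul, gen₁_mul_gen₃, map_one]
    have hbab : b * a * b = a⁻¹ := by
      refine eq_inv_of_mul_eq_one_left ?_
      rw [← hba]
      group
    have ho := orderOf_toPGL_gen₃
    have hmem : b * a * b ∈ Subgroup.zpowers a := by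
      rw [hbab]
      exact inv_mem (Subgroup.mem_zpowers _)
    have := orderOf_mul_dvd_card_subgroup (p := 2) h3 h1 (by rwa [hbinv])
      (by rwa [hbinv]) ?_ (by rw [toPGL_gen₁_sq]; exact one_mem _)
    · rwa [ho] at this
    -- If `b` were a power of `a`, the two would commute, and `b a b = a⁻¹` would give `a² = 1`.
    · rintro ⟨k, hk⟩
      have hcomm : b * a = a * b := by
        rw [← hk]
        exact ((Commute.refl a).zpow_left k).eq
      have haa : a ^ 2 = 1 := by
        rw [hcomm, mul_assoc, hsq, mul_one] at hbab
        rw [sq]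
        nth_rewrite 2 [hbab]
        exact mul_inv_cancel a
      have := orderOf_dvd_of_pow_eq_one haa
      rw [ho] at this
      norm_num at this
  have h45 : 5 * (3 * 3) ∣ Nat.card valentinerGroup :=
    Nat.Coprime.mul_dvd_of_dvd_of_dvd (by norm_num) d5 d9
  exact Nat.Coprime.mul_dvd_of_dvd_of_dvd (m := 5 * (3 * 3)) (n := 4 * 2) (by norm_num) h45 d8

lemma dvd_card_conj (g : PGL(3, ℂ)) :
    360 ∣ Nat.card (valentinerGroup.map (MulAut.conj g).toMonoidHom) := by
  rw [Subgroup.card_map_of_injective (MulAut.conj g).injective]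
  exact dvd_card_valentinerGroup

/-! ### The singular loci as orbits -/

/-- An orbit inside a small invariant set is everything, when the stabilizer is small. -/
lemma eq_orbit_of_encard_le {G X : Type*} [Group G] [MulAction G X] {W : Subgroup G} {S : Set X}
    {p : X} {k n N : ℕ} (hN : k * n = N) (hN0 : 0 < N) (hW : N ∣ Nat.card W) (hp : p ∈ S)
    (hS : ∀ w ∈ W, ∀ x ∈ S, w • x ∈ S) (hSn : S.encard ≤ n)
    (hk : {w ∈ W | w • p = p}.encard ≤ k) :
    S = MulAction.orbit W p ∧ (MulAction.orbit W p).ncard = n := by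
  have hsub : MulAction.orbit W p ⊆ S := by
    rintro _ ⟨w, rfl⟩
    exact hS w w.2 p hp
  have hSfin : S.Finite := Set.finite_of_encard_le_coe hSn
  have hOfin : (MulAction.orbit W p).Finite := hSfin.subset hsub
  have hTfin := Set.finite_of_encard_le_coe hk
  have hTcard : Nat.card (MulAction.stabilizer W p) = {w ∈ W | w • p = p}.ncard := by
    rw [← Nat.card_coe_set_eq]
    exact Nat.card_congr
      { toFun := fun w => ⟨w.1.1, w.1.2, w.2⟩
        invFun := fun w => ⟨⟨w.1, w.2.1⟩, w.2.2⟩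
        left_inv := fun _ => rfl
        right_inv := fun _ => rfl }
  have hTle : {w ∈ W | w • p = p}.ncard ≤ k := by
    rw [← hTfin.cast_ncard_eq] at hk
    exact_mod_cast hk
  have hSle : S.ncard ≤ n := by
    rw [← hSfin.cast_ncard_eq] at hSn
    exact_mod_cast hSn
  have hcard : (MulAction.orbit W p).ncard * {w ∈ W | w • p = p}.ncard = Nat.card W := by
    rw [← hTcard, ← Nat.card_coe_set_eq, ← Nat.card_prod]
    exact Nat.card_congr (MulAction.orbitProdStabilizerEquivGroup W p)
  -- `Nat.card` is 0 for an infinite group and 0 is divisible by `N`; finiteness of orbit and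
  -- stabilizer excludes this.
  have hpos : 0 < Nat.card W := by
    rw [← hcard]
    refine Nat.mul_pos ((Set.ncard_pos hOfin).mpr ⟨p, MulAction.mem_orbit_self p⟩)
      ((Set.ncard_pos hTfin).mpr ⟨1, one_mem W, one_smul G p⟩)
  have hle : N ≤ Nat.card W := Nat.le_of_dvd hpos hW
  have hOle : (MulAction.orbit W p).ncard ≤ S.ncard := Set.ncard_le_ncard hsub hSfin
  have hnO : n ≤ (MulAction.orbit W p).ncard := by
    by_contra hlt
    push Not at hlt
    have hk0 : 0 < k := Nat.pos_of_ne_zero (by rintro rfl; omega)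
    have : (MulAction.orbit W p).ncard * {w ∈ W | w • p = p}.ncard < n * k :=
      lt_of_le_of_lt (Nat.mul_le_mul_left _ hTle) (Nat.mul_lt_mul_of_pos_right hlt hk0)
    rw [hcard, mul_comm n k, hN] at this
    omega
  refine ⟨(Set.eq_of_subset_of_ncard_le hsub (by omega) hSfin).symm, by omega⟩

lemma smul_mem_singularLocus_curve {W : Subgroup PGL(3, ℂ)}
    (hW : ∀ A ∈ lift W, substMatrix A F = F) (P : ℂ) :
    ∀ w ∈ W, ∀ x ∈ singularLocus (curve P), w • x ∈ singularLocus (curve P) := by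
  intro w hw x hx
  obtain ⟨A, rfl⟩ := toPGL_surjective w
  have hA := substMatrix_curve P A.2 (hW A hw)
  induction x using Projectivization.ind with
  | h v hv =>
    rw [mem_singularLocus_curve_iff] at hx
    rw [toPGL_smul_mk, mem_singularLocus_curve_iff, ← eval_substMatrix, hA]
    refine ⟨hx.1, ?_⟩
    have h := gradAt_substMatrix A.1 (curve P) v
    rw [hA, hx.2] at h
    have hinj := Matrix.mulVec_injective_iff_isUnit.mpr
      ((Matrix.isUnit_iff_isUnit_det A.1.transpose).mpr (by
        rw [Matrix.det_transpose, Matrix.SpecialLinearGroup.det_coe]; exact isUnit_one))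
    apply hinj
    rw [← h, Matrix.mulVec_zero]

lemma singularLocus_curve36_eq {W : Subgroup PGL(3, ℂ)} (hW : IsValentinerGroupOfF W) :
    singularLocus (curve 20250) = MulAction.orbit W (affinePoint 0 0) ∧
      (MulAction.orbit W (affinePoint 0 0)).ncard = 36 := by
  obtain ⟨⟨g, rfl⟩, hF⟩ := hW
  exact eq_orbit_of_encard_le (k := 10) (N := 360) (by norm_num) (by norm_num) (dvd_card_conj g)
    affinePoint_mem_singularLocus_curve36 (smul_mem_singularLocus_curve hF _)
    encard_singularLocus_curve36_le (encard_stabilizer_affinePoint_le hF)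

lemma singularLocus_curve45_eq {W : Subgroup PGL(3, ℂ)} (hW : IsValentinerGroupOfF W) :
    singularLocus (curve (-10125)) = MulAction.orbit W (infinitePoint (-1)) ∧
      (MulAction.orbit W (infinitePoint (-1))).ncard = 45 := by
  obtain ⟨⟨g, rfl⟩, hF⟩ := hW
  exact eq_orbit_of_encard_le (k := 8) (N := 360) (by norm_num) (by norm_num) (dvd_card_conj g)
    infinitePoint_mem_singularLocus_curve45 (smul_mem_singularLocus_curve hF _)
    encard_singularLocus_curve45_le (encard_stabilizer_infinitePoint_le hF)

/-! ### Nodes -/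

set_option maxHeartbeats 1000000 in
lemma hessianAt_curve36 : hessianAt (curve 20250) ![0, 0, 1] =
    !![0, -236196000, 0; -236196000, 0, 0; 0, 0, 0] := by
  have h : ∀ i j : Fin 3, eval ![0, 0, 1] (pderiv i (pderiv j (curve 20250))) =
      (![![0, -236196000, 0], ![-236196000, 0, 0], ![0, 0, 0]] : Fin 3 → Fin 3 → ℂ) i j := by
    rw [curve_eq]
    simp only [Fin.forall_fin_succ, Fin.forall_fin_zero, Fin.succ_zero_eq_one, Fin.succ_one_eq_two,
      and_true]
    refine ⟨⟨?_, ?_, ?_⟩, ⟨?_, ?_, ?_⟩, ?_, ?_, ?_⟩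
    all_goals
      simp only [Derivation.leibniz, Derivation.leibniz_pow, map_add, pderiv_C, pderiv_X_self,
        pderiv_X_of_ne, map_mul, map_pow, eval_X, eval_C, smul_eq_mul, ne_eq, Fin.reduceEq,
        not_false_eq_true, map_nsmul, mul_zero, zero_add, add_zero, mul_one, smul_zero]
      simp
    try all_goals norm_num
  ext i j
  exact (h i j).trans (by fin_cases i <;> fin_cases j <;> rfl)

set_option maxHeartbeats 1000000 in
lemma hessianAt_curve45 : hessianAt (curve (-10125)) ![1, -1, 0] =
    !![6075000, 6075000, 18225000; 6075000, 6075000, 18225000; 18225000, 18225000, -36450000] := by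
  have h : ∀ i j : Fin 3, eval ![1, -1, 0] (pderiv i (pderiv j (curve (-10125)))) =
      (![![6075000, 6075000, 18225000], ![6075000, 6075000, 18225000], ![18225000, 18225000,
        -36450000]] : Fin 3 → Fin 3 → ℂ) i j := by
    rw [curve_eq]
    simp only [Fin.forall_fin_succ, Fin.forall_fin_zero, Fin.succ_zero_eq_one, Fin.succ_one_eq_two,
      and_true]
    refine ⟨⟨?_, ?_, ?_⟩, ⟨?_, ?_, ?_⟩, ?_, ?_, ?_⟩
    all_goals
      simp only [Derivation.leibniz, Derivation.leibniz_pow, map_add, pderiv_C, pderiv_X_self,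
        pderiv_X_of_ne, map_mul, map_pow, eval_X, eval_C, smul_eq_mul, ne_eq, Fin.reduceEq,
        not_false_eq_true, map_nsmul, mul_zero, zero_add, add_zero, mul_one, smul_zero]
      simp
    try all_goals norm_num
  ext i j
  exact (h i j).trans (by fin_cases i <;> fin_cases j <;> rfl)

lemma finsupp_fin_two_eq (m : Fin 2 →₀ ℕ) :
    m = Finsupp.single 0 (m 0) + Finsupp.single 1 (m 1) := by
  ext i
  fin_cases i <;> simp

lemma degree_fin_two (m : Fin 2 →₀ ℕ) : m.degree = m 0 + m 1 := by
  rw [Finsupp.degree_eq_sum, Fin.sum_univ_two]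

lemma homogeneousComponent_zero_eq_zero {L : MvPolynomial (Fin 2) ℂ} (h : eval 0 L = 0) :
    homogeneousComponent 0 L = 0 := by
  rw [homogeneousComponent_zero, ← constantCoeff_eq, ← eval_zero, h, C_0]

lemma eval_zero_pderiv (L : MvPolynomial (Fin 2) ℂ) (k : Fin 2) :
    eval 0 (pderiv k L) = coeff (Finsupp.single k 1) L := by
  rw [eval_zero, constantCoeff_eq, coeff_pderiv]
  simp

lemma homogeneousComponent_one_eq_zero {L : MvPolynomial (Fin 2) ℂ}
    (h : ∀ k, eval 0 (pderiv k L) = 0) : homogeneousComponent 1 L = 0 := by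
  ext m
  rw [coeff_homogeneousComponent, coeff_zero]
  split_ifs with hm
  · rw [degree_fin_two] at hm
    rw [finsupp_fin_two_eq m]
    rcases (by omega : (m 0 = 1 ∧ m 1 = 0) ∨ (m 0 = 0 ∧ m 1 = 1)) with ⟨h0, h1⟩ | ⟨h0, h1⟩
    · rw [h0, h1, Finsupp.single_zero, add_zero, ← eval_zero_pderiv, h]
    · rw [h0, h1, Finsupp.single_zero, zero_add, ← eval_zero_pderiv, h]
  · rfl

lemma homogeneousComponent_two_eq (L : MvPolynomial (Fin 2) ℂ) :
    homogeneousComponent 2 L = C (eval 0 (pderiv 0 (pderiv 0 L)) / 2) * X 0 ^ 2 +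
      C (eval 0 (pderiv 0 (pderiv 1 L))) * (X 0 * X 1) +
      C (eval 0 (pderiv 1 (pderiv 1 L)) / 2) * X 1 ^ 2 := by
  have h00 : X 0 ^ 2 = (monomial (Finsupp.single 0 2) 1 : MvPolynomial (Fin 2) ℂ) :=
    X_pow_eq_monomial
  have h11 : X 1 ^ 2 = (monomial (Finsupp.single 1 2) 1 : MvPolynomial (Fin 2) ℂ) :=
    X_pow_eq_monomial
  have h01 : X 0 * X 1 = (monomial (Finsupp.single 0 1 + Finsupp.single 1 1) 1 :
      MvPolynomial (Fin 2) ℂ) := by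
    rw [X, X, monomial_mul, one_mul]
  have e00 : eval 0 (pderiv 0 (pderiv 0 L)) / 2 = coeff (Finsupp.single 0 2) L := by
    rw [eval_zero_pderiv, coeff_pderiv, ← Finsupp.single_add]
    norm_num
  have e11 : eval 0 (pderiv 1 (pderiv 1 L)) / 2 = coeff (Finsupp.single 1 2) L := by
    rw [eval_zero_pderiv, coeff_pderiv, ← Finsupp.single_add]
    norm_num
  have e01 : eval 0 (pderiv 0 (pderiv 1 L)) =
      coeff (Finsupp.single 0 1 + Finsupp.single 1 1) L := by
    rw [eval_zero_pderiv, coeff_pderiv]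
    simp
  rw [e00, e01, e11, h00, h01, h11]
  ext m
  rw [coeff_homogeneousComponent]
  simp only [coeff_add, coeff_C_mul, coeff_monomial, degree_fin_two]
  have hne : ∀ a b c d : ℕ, (Finsupp.single (0 : Fin 2) a + Finsupp.single 1 b =
      Finsupp.single 0 c + Finsupp.single 1 d) ↔ a = c ∧ b = d := by
    intro a b c d
    constructor
    · intro h
      exact ⟨by simpa using DFunLike.congr_fun h 0, by simpa using DFunLike.congr_fun h 1⟩
    · rintro ⟨rfl, rfl⟩
      rfl
  have z0 : Finsupp.single (0 : Fin 2) 2 = Finsupp.single 0 2 + Finsupp.single 1 0 := by simp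
  have z1 : Finsupp.single (1 : Fin 2) 2 = Finsupp.single 0 0 + Finsupp.single 1 2 := by simp
  rw [z0, z1]
  generalize hm0 : m 0 = a
  generalize hm1 : m 1 = b
  rw [finsupp_fin_two_eq m, hm0, hm1]
  simp only [hne]
  by_cases h : a + b = 2
  · rcases (by omega : (a = 2 ∧ b = 0) ∨ (a = 1 ∧ b = 1) ∨ (a = 0 ∧ b = 2)) with
      ⟨rfl, rfl⟩ | ⟨rfl, rfl⟩ | ⟨rfl, rfl⟩ <;> simp
  · rw [if_neg h, if_neg (by omega), if_neg (by omega), if_neg (by omega)]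
    simp

/-- A binary quadratic form with nonzero discriminant is a product of two independent linear
forms. -/
lemma exists_linear_factors {a b c : ℂ} (h : b ^ 2 - 4 * a * c ≠ 0) :
    ∃ l m : Fin 2 → ℂ, LinearIndependent ℂ ![l, m] ∧
      (C a * X 0 ^ 2 + C b * (X 0 * X 1) + C c * X 1 ^ 2 : MvPolynomial (Fin 2) ℂ) =
        (∑ k, C (l k) * X k) * (∑ k, C (m k) * X k) := by
  obtain ⟨δ, hδ⟩ := IsAlgClosed.exists_pow_nat_eq (b ^ 2 - 4 * a * c) (n := 2) (by norm_num)
  have hδ0 : δ ≠ 0 := by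
    rintro rfl
    exact h (by rw [← hδ]; norm_num)
  by_cases ha : a = 0
  · subst ha
    have hb : b ≠ 0 := by
      rintro rfl
      simp at h
    refine ⟨![0, 1], ![b, c], ?_, ?_⟩
    · rw [LinearIndependent.pair_iff]
      intro s t hst
      have h0 := congrFun hst 0
      have h1 := congrFun hst 1
      simp [hb] at h0 h1
      subst h0
      simpa using h1
    · simp [Fin.sum_univ_two]
      ring
  · refine ⟨![a, (b - δ) / 2], ![1, (b + δ) / (2 * a)], ?_, ?_⟩
    · rw [LinearIndependent.pair_iff]
      intro s t hst
      have h0 : s * a + t * 1 = 0 := by simpa using congrFun hst 0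
      have h1 : s * ((b - δ) / 2) + t * ((b + δ) / (2 * a)) = 0 := by
        simpa using congrFun hst 1
      have ht : t = -(s * a) := by linear_combination h0
      rw [ht] at h1
      field_simp at h1
      have hs : s * δ = 0 := by linear_combination -h1 / 2
      have hs0 := (mul_eq_zero.mp hs).resolve_right hδ0
      exact ⟨hs0, by rw [ht, hs0]; ring⟩
    · apply MvPolynomial.funext
      intro v
      simp [Fin.sum_univ_two]
      field_simp
      linear_combination (v 1 ^ 2) * hδ

/-- The kernel of the Hessian matrix of `G` at `v` is spanned by `v`. -/
def HasNondegenerateHessian (G : MvPolynomial (Fin 3) ℂ) (v : Fin 3 → ℂ) : Prop :=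
  ∀ w, (hessianAt G v).mulVec w = 0 → ∃ c : ℂ, w = c • v

lemma isHomogeneous_pderiv_pderiv {G : MvPolynomial (Fin 3) ℂ} {n : ℕ}
    (hG : G.IsHomogeneous (n + 2)) (i j : Fin 3) : (pderiv i (pderiv j G)).IsHomogeneous n :=
  isHomogeneous_pderiv (isHomogeneous_pderiv hG j) i

lemma hessianAt_smul {G : MvPolynomial (Fin 3) ℂ} {n : ℕ} (hG : G.IsHomogeneous (n + 2))
    (c : ℂ) (v : Fin 3 → ℂ) : hessianAt G (c • v) = c ^ n • hessianAt G v := by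
  ext i j
  simp [hessianAt, eval_smul_of_isHomogeneous (isHomogeneous_pderiv_pderiv hG i j)]

lemma HasNondegenerateHessian.smul {G : MvPolynomial (Fin 3) ℂ} {n : ℕ}
    (hG : G.IsHomogeneous (n + 2)) {c : ℂ} (hc : c ≠ 0) {v : Fin 3 → ℂ}
    (h : HasNondegenerateHessian G v) : HasNondegenerateHessian G (c • v) := by
  intro w hw
  rw [hessianAt_smul hG, Matrix.smul_mulVec] at hw
  obtain ⟨d, rfl⟩ := h w ((smul_eq_zero.mp hw).resolve_left (pow_ne_zero n hc))
  exact ⟨d / c, by rw [smul_smul, div_mul_cancel₀ d hc]⟩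

/-- Invariance gives `H(v) = Aᵀ H(A v) A`, so `A⁻¹` maps the kernel at `A v` into the kernel at `v`.
-/
lemma HasNondegenerateHessian.mulVec {G : MvPolynomial (Fin 3) ℂ} {A : SL(3, ℂ)}
    (hA : substMatrix A.1 G = G) {v : Fin 3 → ℂ} (h : HasNondegenerateHessian G v) :
    HasNondegenerateHessian G (A.1.mulVec v) := by
  intro w hw
  have hAA : A.1 * (A⁻¹).1 = 1 := by
    rw [← Matrix.SpecialLinearGroup.coe_mul, mul_inv_cancel, Matrix.SpecialLinearGroup.coe_one]
  have hw' : A.1.mulVec ((A⁻¹).1.mulVec w) = w := by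
    rw [Matrix.mulVec_mulVec, hAA, Matrix.one_mulVec]
  obtain ⟨c, hc⟩ := h ((A⁻¹).1.mulVec w) (by
    have hH := hessianAt_substMatrix A.1 G v
    rw [hA] at hH
    rw [hH, ← Matrix.mulVec_mulVec, hw', ← Matrix.mulVec_mulVec, hw, Matrix.mulVec_zero])
  exact ⟨c, by rw [← hw', hc, Matrix.mulVec_smul]⟩

lemma pderiv_comm_apply (G : MvPolynomial (Fin 3) ℂ) (i j : Fin 3) :
    pderiv i (pderiv j G) = pderiv j (pderiv i G) := by
  by_cases h : i = j
  · rw [h]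
  ext m
  simp only [coeff_pderiv, Finsupp.add_apply, Finsupp.single_eq_of_ne h,
    Finsupp.single_eq_of_ne (Ne.symm h)]
  rw [add_right_comm]
  push_cast
  ring

/-- Euler's relation for the Hessian matrix at a critical point. -/
lemma hessianAt_mulVec_self {G : MvPolynomial (Fin 3) ℂ} {n : ℕ} (hG : G.IsHomogeneous (n + 1))
    {v : Fin 3 → ℂ} (hv : gradAt G v = 0) : (hessianAt G v).mulVec v = 0 := by
  funext i
  have h := congrArg (eval v) (isHomogeneous_pderiv hG i).sum_X_mul_pderiv
  have hi : eval v (pderiv i G) = 0 := congrFun hv i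
  simp only [map_sum, map_mul, eval_X, map_nsmul, hi, smul_zero] at h
  simp only [Matrix.mulVec, dotProduct, hessianAt, Matrix.of_apply, Pi.zero_apply]
  rw [← h]
  exact Finset.sum_congr rfl fun j _ => by rw [pderiv_comm_apply, mul_comm]

lemma pderiv_localEquation (G : MvPolynomial (Fin 3) ℂ) (p : ℙ ℂ (Fin 3 → ℂ)) (i : Fin 3)
    (k : Fin 2) : pderiv k (localEquation G p i) = localEquation (pderiv (i.succAbove k) G) p i := by
  rw [localEquation, pderiv_bind₁, Finset.sum_eq_single (i.succAbove k)]
  · simp [localEquation]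
  · intro j _ hj
    rcases Fin.eq_self_or_eq_succAbove i j with rfl | ⟨l, rfl⟩
    · simp
    · have : k ≠ l := fun h => hj (by rw [h])
      simp [pderiv_X_of_ne this.symm]
  · simp

lemma eval_zero_localEquation (G : MvPolynomial (Fin 3) ℂ) (p : ℙ ℂ (Fin 3 → ℂ)) {i : Fin 3}
    (hi : p.rep i ≠ 0) : eval 0 (localEquation G p i) = eval ((p.rep i)⁻¹ • p.rep) G := by
  rw [localEquation, ← coe_aeval_eq_eval, RingHom.coe_coe, aeval_bind₁, ← coe_aeval_eq_eval,
    RingHom.coe_coe]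
  congr 2
  funext j
  rcases Fin.eq_self_or_eq_succAbove i j with rfl | ⟨l, rfl⟩
  · simp [hi]
  · simp [div_eq_inv_mul]

lemma isNode_of_hasNondegenerateHessian {G : MvPolynomial (Fin 3) ℂ} {n : ℕ}
    (hG : G.IsHomogeneous (n + 2)) {p : ℙ ℂ (Fin 3 → ℂ)} (hp : p ∈ singularLocus G)
    (h : HasNondegenerateHessian G p.rep) : IsNode G p := by
  obtain ⟨i, hi⟩ := Function.ne_iff.mp p.rep_nonzero
  set v : Fin 3 → ℂ := (p.rep i)⁻¹ • p.rep with hvdef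
  have hvi : v i = 1 := by
    simp only [hvdef, Pi.smul_apply, smul_eq_mul]
    exact inv_mul_cancel₀ hi
  have hgrad : gradAt G v = 0 := by
    funext j
    rw [gradAt, eval_smul_of_isHomogeneous (isHomogeneous_pderiv hG j), hp.2 j, mul_zero]
    rfl
  have hv : HasNondegenerateHessian G v := h.smul hG (inv_ne_zero hi)
  refine ⟨i, hi, ?_, ?_, ?_⟩
  · apply homogeneousComponent_zero_eq_zero
    rw [eval_zero_localEquation G p hi, eval_smul_of_isHomogeneous hG, hp.1, mul_zero]
  · apply homogeneousComponent_one_eq_zero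
    intro k
    rw [pderiv_localEquation, eval_zero_localEquation _ p hi]
    exact congrFun hgrad _
  · have hcoef : ∀ k l, eval 0 (pderiv k (pderiv l (localEquation G p i))) =
        hessianAt G v (i.succAbove k) (i.succAbove l) := by
      intro k l
      rw [pderiv_localEquation, pderiv_localEquation, eval_zero_localEquation _ p hi]
      rfl
    rw [homogeneousComponent_two_eq]
    simp only [hcoef]
    apply exists_linear_factors
    set H := hessianAt G v with hH
    have hsymm : ∀ a b, H a b = H b a := fun a b => by
      simp [hH, hessianAt, pderiv_comm_apply G a b]
    have hHv : H.mulVec v = 0 := hessianAt_mulVec_self (n := n + 1) hG hgrad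
    intro hdet
    -- The Hessian in the chart is the minor of `H` without row and column `i`. A kernel vector `w`
    -- of this minor, padded with 0 at `i`, will be shown to lie in the kernel of `H`.
    have hdet' : (!![H (i.succAbove 0) (i.succAbove 0), H (i.succAbove 0) (i.succAbove 1);
        H (i.succAbove 1) (i.succAbove 0), H (i.succAbove 1) (i.succAbove 1)]).det = 0 := by
      rw [Matrix.det_fin_two_of, hsymm (i.succAbove 1) (i.succAbove 0)]
      linear_combination -hdet
    obtain ⟨w, hw0, hw⟩ := Matrix.exists_mulVec_eq_zero_iff.mpr hdet'
    have hw1 : H (i.succAbove 0) (i.succAbove 0) * w 0 +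
        H (i.succAbove 0) (i.succAbove 1) * w 1 = 0 := by
      simpa [Matrix.mulVec, dotProduct] using congrFun hw 0
    have hw2 : H (i.succAbove 1) (i.succAbove 0) * w 0 +
        H (i.succAbove 1) (i.succAbove 1) * w 1 = 0 := by
      simpa [Matrix.mulVec, dotProduct] using congrFun hw 1
    set x : Fin 3 → ℂ := Fin.insertNth (α := fun _ => ℂ) i 0 w with hx
    have hHx : ∀ j, H.mulVec x j = H j (i.succAbove 0) * w 0 + H j (i.succAbove 1) * w 1 := by
      intro j
      simp [Matrix.mulVec, dotProduct, Fin.sum_univ_succAbove _ i, hx, Fin.sum_univ_two]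
    have hHv' : ∀ j, H j i + (H j (i.succAbove 0) * v (i.succAbove 0) +
        H j (i.succAbove 1) * v (i.succAbove 1)) = 0 := by
      intro j
      have := congrFun hHv j
      simpa [Matrix.mulVec, dotProduct, Fin.sum_univ_succAbove _ i, hvi,
        Fin.sum_univ_two] using this
    obtain ⟨c, hc⟩ := hv x (by
      funext j
      rw [hHx]
      rcases Fin.eq_self_or_eq_succAbove i j with rfl | ⟨l, rfl⟩
      -- Row `i` of `H` is a combination of the other two, because `H v = 0`, `v i = 1` and `H` is
      -- symmetric.
      · rw [hsymm j, hsymm j]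
        simp only [Pi.zero_apply]
        linear_combination w 0 * hHv' (j.succAbove 0) + w 1 * hHv' (j.succAbove 1) -
          v (j.succAbove 0) * hw1 - v (j.succAbove 1) * hw2 +
          (v (j.succAbove 0) * w 1 - v (j.succAbove 1) * w 0) *
            hsymm (j.succAbove 0) (j.succAbove 1)
      · fin_cases l
        · exact hw1
        · exact hw2)
    -- The padded vector has coordinate 0 at `i`, whereas `v i = 1`.
    have hc0 : c = 0 := by
      have := congrFun hc i
      simpa [hx, hvi] using this.symm
    apply hw0
    funext k
    have := congrFun hc (i.succAbove k)
    simpa [hx, hc0] using this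

lemma hasNondegenerateHessian_curve36 : HasNondegenerateHessian (curve 20250) ![0, 0, 1] := by
  intro w hw
  rw [hessianAt_curve36] at hw
  have h0 := congrFun hw 0
  have h1 := congrFun hw 1
  simp [Matrix.mulVec, dotProduct, Fin.sum_univ_three] at h0 h1
  refine ⟨w 2, ?_⟩
  ext i
  fin_cases i <;> simp [h0, h1]

lemma hasNondegenerateHessian_curve45 : HasNondegenerateHessian (curve (-10125)) ![1, -1, 0] := by
  intro w hw
  rw [hessianAt_curve45] at hw
  have h0 := congrFun hw 0
  have h2 := congrFun hw 2
  simp [Matrix.mulVec, dotProduct, Fin.sum_univ_three] at h0 h2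
  refine ⟨w 0, ?_⟩
  ext i
  fin_cases i
  · simp
  · simp
    linear_combination (2 * h0 + h2) / 30375000
  · simp
    linear_combination (3 * h0 - h2) / 91125000

/-- The Hessian needs to be computed at one point of the orbit only; invariance moves the rank
condition to the others, and homogeneity makes it independent of the representative. -/
lemma isNodal_of_orbit {P : ℂ} {W : Subgroup PGL(3, ℂ)} (hW : ∀ A ∈ lift W, substMatrix A F = F)
    {v : Fin 3 → ℂ} (hv : v ≠ 0)
    (hS : singularLocus (curve P) = MulAction.orbit W (Projectivization.mk ℂ v hv))
    (h : HasNondegenerateHessian (curve P) v) : IsNodal (curve P) := by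
  intro p hp
  refine isNode_of_hasNondegenerateHessian (n := 10) (homogeneity_curve P) hp ?_
  rw [hS] at hp
  obtain ⟨⟨w, hw⟩, rfl⟩ := hp
  obtain ⟨A, rfl⟩ := toPGL_surjective w
  obtain ⟨c, hc⟩ := Projectivization.exists_smul_eq_mk_rep ℂ (A.1.mulVec v) (mulVec_ne_zero A hv)
  have hrep : ((⟨Matrix.SpecialLinearGroup.toPGL A, hw⟩ : W) • Projectivization.mk ℂ v hv).rep =
      (c : ℂ) • A.1.mulVec v := hc.symm
  rw [hrep]
  exact (h.mulVec (substMatrix_curve P A.2 (hW A hw))).smul (n := 10) (homogeneity_curve P)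
    c.ne_zero

/-! ### A conjugate of the Valentiner group preserving `F` -/

/-- The sextic invariant of the Valentiner group in its standard coordinates, with
`t = τ` and `d = -(3 + √-15) / 4`. -/
noncomputable def standardSextic (t d X Y Z : ℂ) : ℂ :=
  135 / 16 * ((3 * d + 5) * (X ^ 6 + Y ^ 6 + Z ^ 6) +
    (15 * d * t - 6 * d + 9 * t + 6) * (X ^ 4 * Y ^ 2 + Y ^ 4 * Z ^ 2 + Z ^ 4 * X ^ 2) +
    (-15 * d * t + 9 * d - 9 * t + 15) * (X ^ 2 * Y ^ 4 + Y ^ 2 * Z ^ 4 + Z ^ 2 * X ^ 4) +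
    (78 * d + 66) * (X * Y * Z) ^ 2)

/-- The left side is `F` after the change of variables used in `exists_isValentinerGroupOfF`,
written with `xy = d² S`, `z² = Q` and `(x⁵ + y⁵) z = 2 d⁵ N (P² - 10 P Z² + 5 Z⁴)`. Powers of `d`
are first reduced to degree one. -/
lemma standardSextic_eq {t d : ℂ} (ht : t ^ 2 = t + 1) (hd : d ^ 2 = -(3 * d + 3) / 2)
    (X Y Z : ℂ) {S P Q N : ℂ} (hS : S = P + Z ^ 2)
    (hP : P = ((3 - t) * Y ^ 2 - 2 * (2 * t - 1) * X * Y + (t + 2) * X ^ 2) / 5)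
    (hQ : Q = ((3 - t) * X ^ 2 + 2 * (2 * t - 1) * X * Y + (t + 2) * Y ^ 2) / 5)
    (hN : N = (2 * t - 1) * (Y ^ 2 - X ^ 2 - X * Y) / 5) :
    10 * d ^ 6 * S ^ 3 + 18 * d ^ 5 * N * (P ^ 2 - 10 * P * Z ^ 2 + 5 * Z ^ 4) -
      45 * d ^ 4 * S ^ 2 * Q - 135 * d ^ 2 * S * Q ^ 2 + 27 * Q ^ 3 = standardSextic t d X Y Z := by
  have h4 : d ^ 4 = 9 / 8 * d - 9 / 8 := by
    rw [show d ^ 4 = d ^ 2 * d ^ 2 by ring, hd]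
    linear_combination 9 / 4 * hd
  have h5 : d ^ 5 = -45 / 16 * d - 27 / 16 := by
    rw [show d ^ 5 = d ^ 4 * d by ring, h4]
    linear_combination 9 / 8 * hd
  have h6 : d ^ 6 = 81 / 32 * d + 135 / 32 := by
    rw [show d ^ 6 = d ^ 4 * d ^ 2 by ring, h4, hd]
    linear_combination -27 / 16 * hd
  rw [h4, h5, h6, hd, hS, hP, hQ, hN, standardSextic]
  linear_combination (
    243/80 * X ^ 6 * d * t + 81/80 * X ^ 6 * d + 729/400 * X ^ 6 * t + 243/400 * X ^ 6
    + (-162/5) * X ^ 5 * Y * d * t + 81/5 * X ^ 5 * Y * d + (-486/25) * X ^ 5 * Y * t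
    + 243/25 * X ^ 5 * Y + 8343/80 * X ^ 4 * Y ^ 2 * d * t + (-3807/40) * X ^ 4 * Y ^ 2 * d
    + 25029/400 * X ^ 4 * Y ^ 2 * t + (-11421/200) * X ^ 4 * Y ^ 2
    + (-405/16) * X ^ 4 * Z ^ 2 * d + (-243/16) * X ^ 4 * Z ^ 2
    + (-324/5) * X ^ 3 * Y ^ 3 * d * t + 162/5 * X ^ 3 * Y ^ 3 * d
    + (-972/25) * X ^ 3 * Y ^ 3 * t + 486/25 * X ^ 3 * Y ^ 3
    + (-8343/80) * X ^ 2 * Y ^ 4 * d * t + 729/80 * X ^ 2 * Y ^ 4 * d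
    + (-25029/400) * X ^ 2 * Y ^ 4 * t + 2187/400 * X ^ 2 * Y ^ 4
    + 3645/8 * X ^ 2 * Y ^ 2 * Z ^ 2 * d + 2187/8 * X ^ 2 * Y ^ 2 * Z ^ 2
    + (-162/5) * X * Y ^ 5 * d * t + 81/5 * X * Y ^ 5 * d + (-486/25) * X * Y ^ 5 * t
    + 243/25 * X * Y ^ 5 + (-243/80) * Y ^ 6 * d * t + 81/20 * Y ^ 6 * d
    + (-729/400) * Y ^ 6 * t + 243/100 * Y ^ 6 + (-405/16) * Y ^ 4 * Z ^ 2 * d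
    + (-243/16) * Y ^ 4 * Z ^ 2) * ht

/-- This generator determines `d`: invariance under the other three holds for every `d`, while here
the relation between `d` and the cube root of unity `r` is used. -/
lemma standardSextic_gen₃ {t d r : ℂ} (ht : t ^ 2 = t + 1)
    (hd : d = -(3 + (2 * t - 1) * (2 * r + 1)) / 4) (hr : r ^ 2 = -r - 1) (X Y Z : ℂ) :
    standardSextic t d X (r ^ 2 * Z) (-r * Y) = standardSextic t d X Y Z := by
  rw [standardSextic, standardSextic]
  linear_combination (
    (-2025/16) * X ^ 4 * Y ^ 2 * t * r ^ 2 + (-2025/16) * X ^ 4 * Y ^ 2 * t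
    + 1215/16 * X ^ 4 * Y ^ 2 * r ^ 2 + 405/8 * X ^ 4 * Y ^ 2
    + 2025/16 * X ^ 4 * Z ^ 2 * t * r ^ 4 + 2025/16 * X ^ 4 * Z ^ 2 * t
    + (-405/8) * X ^ 4 * Z ^ 2 * r ^ 4 + (-1215/16) * X ^ 4 * Z ^ 2
    + 2025/16 * X ^ 2 * Y ^ 4 * t * r ^ 4 + 2025/16 * X ^ 2 * Y ^ 4 * t
    + (-405/8) * X ^ 2 * Y ^ 4 * r ^ 4 + (-1215/16) * X ^ 2 * Y ^ 4
    + 5265/8 * X ^ 2 * Y ^ 2 * Z ^ 2 * r ^ 6 + (-5265/8) * X ^ 2 * Y ^ 2 * Z ^ 2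
    + (-2025/16) * X ^ 2 * Z ^ 4 * t * r ^ 8 + (-2025/16) * X ^ 2 * Z ^ 4 * t
    + 1215/16 * X ^ 2 * Z ^ 4 * r ^ 8 + 405/8 * X ^ 2 * Z ^ 4 + 405/16 * Y ^ 6 * r ^ 6
    + (-405/16) * Y ^ 6 + (-2025/16) * Y ^ 4 * Z ^ 2 * t * r ^ 8
    + (-2025/16) * Y ^ 4 * Z ^ 2 * t + 1215/16 * Y ^ 4 * Z ^ 2 * r ^ 8 + 405/8 * Y ^ 4 * Z ^ 2
    + 2025/16 * Y ^ 2 * Z ^ 4 * t * r ^ 10 + 2025/16 * Y ^ 2 * Z ^ 4 * t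
    + (-405/8) * Y ^ 2 * Z ^ 4 * r ^ 10 + (-1215/16) * Y ^ 2 * Z ^ 4 + 405/16 * Z ^ 6 * r ^ 12
    + (-405/16) * Z ^ 6) * hd + (
    2025/16 * X ^ 4 * Y ^ 2 * t ^ 2 * r + 2025/32 * X ^ 4 * Y ^ 2 * t ^ 2
    + (-4455/32) * X ^ 4 * Y ^ 2 * t * r + (-1215/32) * X ^ 4 * Y ^ 2 * t
    + 1215/32 * X ^ 4 * Y ^ 2 * r + (-1215/16) * X ^ 4 * Y ^ 2
    + (-2025/16) * X ^ 4 * Z ^ 2 * t ^ 2 * r ^ 3 + (-2025/32) * X ^ 4 * Z ^ 2 * t ^ 2 * r ^ 2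
    + 3645/32 * X ^ 4 * Z ^ 2 * t * r ^ 3 + 405/8 * X ^ 4 * Z ^ 2 * t * r ^ 2
    + 405/16 * X ^ 4 * Z ^ 2 * t * r + (-405/32) * X ^ 4 * Z ^ 2 * t
    + (-405/16) * X ^ 4 * Z ^ 2 * r ^ 3 + 3645/16 * X ^ 4 * Z ^ 2 * r ^ 2
    + (-405/32) * X ^ 4 * Z ^ 2 * r + (-1215/8) * X ^ 4 * Z ^ 2
    + (-2025/16) * X ^ 2 * Y ^ 4 * t ^ 2 * r ^ 3 + (-2025/32) * X ^ 2 * Y ^ 4 * t ^ 2 * r ^ 2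
    + 3645/32 * X ^ 2 * Y ^ 4 * t * r ^ 3 + 405/8 * X ^ 2 * Y ^ 4 * t * r ^ 2
    + 405/16 * X ^ 2 * Y ^ 4 * t * r + (-405/32) * X ^ 2 * Y ^ 4 * t
    + (-405/16) * X ^ 2 * Y ^ 4 * r ^ 3 + 3645/16 * X ^ 2 * Y ^ 4 * r ^ 2
    + (-405/32) * X ^ 2 * Y ^ 4 * r + (-1215/8) * X ^ 2 * Y ^ 4
    + (-5265/8) * X ^ 2 * Y ^ 2 * Z ^ 2 * t * r ^ 5
    + 5265/16 * X ^ 2 * Y ^ 2 * Z ^ 2 * t * r ^ 4 + 5265/16 * X ^ 2 * Y ^ 2 * Z ^ 2 * t * r ^ 3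
    + (-5265/8) * X ^ 2 * Y ^ 2 * Z ^ 2 * t * r ^ 2 + 5265/16 * X ^ 2 * Y ^ 2 * Z ^ 2 * t * r
    + 5265/16 * X ^ 2 * Y ^ 2 * Z ^ 2 * t + 5265/16 * X ^ 2 * Y ^ 2 * Z ^ 2 * r ^ 5
    + (-405/4) * X ^ 2 * Y ^ 2 * Z ^ 2 * r ^ 4 + (-3645/16) * X ^ 2 * Y ^ 2 * Z ^ 2 * r ^ 3
    + 5265/16 * X ^ 2 * Y ^ 2 * Z ^ 2 * r ^ 2 + (-405/4) * X ^ 2 * Y ^ 2 * Z ^ 2 * r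
    + (-3645/16) * X ^ 2 * Y ^ 2 * Z ^ 2 + 2025/16 * X ^ 2 * Z ^ 4 * t ^ 2 * r ^ 7
    + 2025/32 * X ^ 2 * Z ^ 4 * t ^ 2 * r ^ 6 + (-4455/32) * X ^ 2 * Z ^ 4 * t * r ^ 7
    + (-1215/32) * X ^ 2 * Z ^ 4 * t * r ^ 6 + (-405/32) * X ^ 2 * Z ^ 4 * t * r ^ 5
    + (-405/32) * X ^ 2 * Z ^ 4 * t * r ^ 4 + 405/16 * X ^ 2 * Z ^ 4 * t * r ^ 3
    + (-405/32) * X ^ 2 * Z ^ 4 * t * r ^ 2 + (-405/32) * X ^ 2 * Z ^ 4 * t * r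
    + 405/16 * X ^ 2 * Z ^ 4 * t + 1215/32 * X ^ 2 * Z ^ 4 * r ^ 7
    + (-1215/16) * X ^ 2 * Z ^ 4 * r ^ 6 + (-1215/8) * X ^ 2 * Z ^ 4 * r ^ 5
    + 5265/32 * X ^ 2 * Z ^ 4 * r ^ 4 + (-405/32) * X ^ 2 * Z ^ 4 * r ^ 3
    + (-1215/8) * X ^ 2 * Z ^ 4 * r ^ 2 + 5265/32 * X ^ 2 * Z ^ 4 * r
    + (-405/32) * X ^ 2 * Z ^ 4 + (-405/16) * Y ^ 6 * t * r ^ 5 + 405/32 * Y ^ 6 * t * r ^ 4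
    + 405/32 * Y ^ 6 * t * r ^ 3 + (-405/16) * Y ^ 6 * t * r ^ 2 + 405/32 * Y ^ 6 * t * r
    + 405/32 * Y ^ 6 * t + 405/32 * Y ^ 6 * r ^ 5 + 135/8 * Y ^ 6 * r ^ 4
    + (-945/32) * Y ^ 6 * r ^ 3 + 405/32 * Y ^ 6 * r ^ 2 + 135/8 * Y ^ 6 * r + (-945/32) * Y ^ 6
    + 2025/16 * Y ^ 4 * Z ^ 2 * t ^ 2 * r ^ 7 + 2025/32 * Y ^ 4 * Z ^ 2 * t ^ 2 * r ^ 6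
    + (-4455/32) * Y ^ 4 * Z ^ 2 * t * r ^ 7 + (-1215/32) * Y ^ 4 * Z ^ 2 * t * r ^ 6
    + (-405/32) * Y ^ 4 * Z ^ 2 * t * r ^ 5 + (-405/32) * Y ^ 4 * Z ^ 2 * t * r ^ 4
    + 405/16 * Y ^ 4 * Z ^ 2 * t * r ^ 3 + (-405/32) * Y ^ 4 * Z ^ 2 * t * r ^ 2
    + (-405/32) * Y ^ 4 * Z ^ 2 * t * r + 405/16 * Y ^ 4 * Z ^ 2 * t
    + 1215/32 * Y ^ 4 * Z ^ 2 * r ^ 7 + (-1215/16) * Y ^ 4 * Z ^ 2 * r ^ 6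
    + (-1215/8) * Y ^ 4 * Z ^ 2 * r ^ 5 + 5265/32 * Y ^ 4 * Z ^ 2 * r ^ 4
    + (-405/32) * Y ^ 4 * Z ^ 2 * r ^ 3 + (-1215/8) * Y ^ 4 * Z ^ 2 * r ^ 2
    + 5265/32 * Y ^ 4 * Z ^ 2 * r + (-405/32) * Y ^ 4 * Z ^ 2
    + (-2025/16) * Y ^ 2 * Z ^ 4 * t ^ 2 * r ^ 9 + (-2025/32) * Y ^ 2 * Z ^ 4 * t ^ 2 * r ^ 8
    + 3645/32 * Y ^ 2 * Z ^ 4 * t * r ^ 9 + 405/8 * Y ^ 2 * Z ^ 4 * t * r ^ 8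
    + 405/16 * Y ^ 2 * Z ^ 4 * t * r ^ 7 + (-405/32) * Y ^ 2 * Z ^ 4 * t * r ^ 6
    + (-405/32) * Y ^ 2 * Z ^ 4 * t * r ^ 5 + 405/16 * Y ^ 2 * Z ^ 4 * t * r ^ 4
    + (-405/32) * Y ^ 2 * Z ^ 4 * t * r ^ 3 + (-405/32) * Y ^ 2 * Z ^ 4 * t * r ^ 2
    + 405/16 * Y ^ 2 * Z ^ 4 * t * r + (-405/32) * Y ^ 2 * Z ^ 4 * t
    + (-405/16) * Y ^ 2 * Z ^ 4 * r ^ 9 + 3645/16 * Y ^ 2 * Z ^ 4 * r ^ 8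
    + (-405/32) * Y ^ 2 * Z ^ 4 * r ^ 7 + (-1215/8) * Y ^ 2 * Z ^ 4 * r ^ 6
    + 5265/32 * Y ^ 2 * Z ^ 4 * r ^ 5 + (-405/32) * Y ^ 2 * Z ^ 4 * r ^ 4
    + (-1215/8) * Y ^ 2 * Z ^ 4 * r ^ 3 + 5265/32 * Y ^ 2 * Z ^ 4 * r ^ 2
    + (-405/32) * Y ^ 2 * Z ^ 4 * r + (-1215/8) * Y ^ 2 * Z ^ 4 + (-405/16) * Z ^ 6 * t * r ^ 11
    + 405/32 * Z ^ 6 * t * r ^ 10 + 405/32 * Z ^ 6 * t * r ^ 9 + (-405/16) * Z ^ 6 * t * r ^ 8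
    + 405/32 * Z ^ 6 * t * r ^ 7 + 405/32 * Z ^ 6 * t * r ^ 6 + (-405/16) * Z ^ 6 * t * r ^ 5
    + 405/32 * Z ^ 6 * t * r ^ 4 + 405/32 * Z ^ 6 * t * r ^ 3 + (-405/16) * Z ^ 6 * t * r ^ 2
    + 405/32 * Z ^ 6 * t * r + 405/32 * Z ^ 6 * t + 405/32 * Z ^ 6 * r ^ 11
    + 135/8 * Z ^ 6 * r ^ 10 + (-945/32) * Z ^ 6 * r ^ 9 + 405/32 * Z ^ 6 * r ^ 8
    + 135/8 * Z ^ 6 * r ^ 7 + (-945/32) * Z ^ 6 * r ^ 6 + 405/32 * Z ^ 6 * r ^ 5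
    + 135/8 * Z ^ 6 * r ^ 4 + (-945/32) * Z ^ 6 * r ^ 3 + 405/32 * Z ^ 6 * r ^ 2
    + 135/8 * Z ^ 6 * r + (-945/32) * Z ^ 6) * hr + (
    (-2025/16) * X ^ 4 * Y ^ 2 * r ^ 2 + (-2025/32) * X ^ 4 * Y ^ 2 * r
    + 2025/16 * X ^ 4 * Z ^ 2 * r ^ 4 + 6075/32 * X ^ 4 * Z ^ 2 * r ^ 3
    + 2025/32 * X ^ 4 * Z ^ 2 * r ^ 2 + (-2025/16) * X ^ 4 * Z ^ 2 * r
    + (-2025/32) * X ^ 4 * Z ^ 2 + 2025/16 * X ^ 2 * Y ^ 4 * r ^ 4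
    + 6075/32 * X ^ 2 * Y ^ 4 * r ^ 3 + 2025/32 * X ^ 2 * Y ^ 4 * r ^ 2
    + (-2025/16) * X ^ 2 * Y ^ 4 * r + (-2025/32) * X ^ 2 * Y ^ 4
    + (-2025/16) * X ^ 2 * Z ^ 4 * r ^ 8 + (-6075/32) * X ^ 2 * Z ^ 4 * r ^ 7
    + (-2025/32) * X ^ 2 * Z ^ 4 * r ^ 6 + 2025/16 * X ^ 2 * Z ^ 4 * r + 2025/32 * X ^ 2 * Z ^ 4
    + (-2025/16) * Y ^ 4 * Z ^ 2 * r ^ 8 + (-6075/32) * Y ^ 4 * Z ^ 2 * r ^ 7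
    + (-2025/32) * Y ^ 4 * Z ^ 2 * r ^ 6 + 2025/16 * Y ^ 4 * Z ^ 2 * r + 2025/32 * Y ^ 4 * Z ^ 2
    + 2025/16 * Y ^ 2 * Z ^ 4 * r ^ 10 + 6075/32 * Y ^ 2 * Z ^ 4 * r ^ 9
    + 2025/32 * Y ^ 2 * Z ^ 4 * r ^ 8 + (-2025/16) * Y ^ 2 * Z ^ 4 * r
    + (-2025/32) * Y ^ 2 * Z ^ 4) * ht

lemma standardSextic_gen₄ {t d : ℂ} (ht : t ^ 2 = t + 1) (X Y Z : ℂ) :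
    standardSextic t d ((X + (t - 1) * Y - t * Z) / 2) (((t - 1) * X + t * Y + Z) / 2)
      ((t * X - Y + (t - 1) * Z) / 2) = standardSextic t d X Y Z := by
  rw [standardSextic, standardSextic]
  linear_combination (
    (-2835/1024) * X ^ 6 * d * t ^ 4 + 2835/512 * X ^ 6 * d * t ^ 3
    + 2025/128 * X ^ 6 * d * t ^ 2 + (-19035/1024) * X ^ 6 * d * t + 24705/1024 * X ^ 6 * d
    + 1755/1024 * X ^ 6 * t ^ 4 + (-1755/512) * X ^ 6 * t ^ 3 + 3375/128 * X ^ 6 * t ^ 2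
    + (-25245/1024) * X ^ 6 * t + 39015/1024 * X ^ 6 + 2025/512 * X ^ 5 * Y * d * t ^ 5
    + (-5265/512) * X ^ 5 * Y * d * t ^ 4 + 9315/256 * X ^ 5 * Y * d * t ^ 3
    + (-405/8) * X ^ 5 * Y * d * t ^ 2 + 12555/512 * X ^ 5 * Y * d * t + 405/256 * X ^ 5 * Y * d
    + 1215/512 * X ^ 5 * Y * t ^ 5 + 2025/512 * X ^ 5 * Y * t ^ 4 + 405/256 * X ^ 5 * Y * t ^ 3
    + (-2835/512) * X ^ 5 * Y * t + 2835/256 * X ^ 5 * Y + (-2025/512) * X ^ 5 * Z * d * t ^ 5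
    + 1215/128 * X ^ 5 * Z * d * t ^ 4 + (-4455/128) * X ^ 5 * Z * d * t ^ 3
    + 9315/256 * X ^ 5 * Z * d * t ^ 2 + (-2835/256) * X ^ 5 * Z * d * t
    + 2835/512 * X ^ 5 * Z * d + (-1215/512) * X ^ 5 * Z * t ^ 5 + 2025/128 * X ^ 5 * Z * t ^ 4
    + (-5265/128) * X ^ 5 * Z * t ^ 3 + 13365/256 * X ^ 5 * Z * t ^ 2
    + (-6885/256) * X ^ 5 * Z * t + 6885/512 * X ^ 5 * Z
    + 10125/1024 * X ^ 4 * Y ^ 2 * d * t ^ 5 + (-4455/512) * X ^ 4 * Y ^ 2 * d * t ^ 4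
    + 14985/512 * X ^ 4 * Y ^ 2 * d * t ^ 3 + (-29565/512) * X ^ 4 * Y ^ 2 * d * t ^ 2
    + 36855/256 * X ^ 4 * Y ^ 2 * d * t + (-65205/1024) * X ^ 4 * Y ^ 2 * d
    + 6075/1024 * X ^ 4 * Y ^ 2 * t ^ 5 + 7695/512 * X ^ 4 * Y ^ 2 * t ^ 4
    + (-11745/512) * X ^ 4 * Y ^ 2 * t ^ 3 + 13365/512 * X ^ 4 * Y ^ 2 * t ^ 2
    + 11745/256 * X ^ 4 * Y ^ 2 * t + 23085/1024 * X ^ 4 * Y ^ 2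
    + 2835/512 * X ^ 4 * Y * Z * d * t ^ 4 + (-2835/256) * X ^ 4 * Y * Z * d * t ^ 3
    + 3645/256 * X ^ 4 * Y * Z * d * t ^ 2 + (-4455/512) * X ^ 4 * Y * Z * d * t
    + (-12555/512) * X ^ 4 * Y * Z * d + 6885/512 * X ^ 4 * Y * Z * t ^ 4
    + (-6885/256) * X ^ 4 * Y * Z * t ^ 3 + (-405/256) * X ^ 4 * Y * Z * t ^ 2
    + 7695/512 * X ^ 4 * Y * Z * t + (-23085/512) * X ^ 4 * Y * Z
    + (-10125/1024) * X ^ 4 * Z ^ 2 * d * t ^ 5 + 41715/1024 * X ^ 4 * Z ^ 2 * d * t ^ 4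
    + (-23895/256) * X ^ 4 * Z ^ 2 * d * t ^ 3 + 39285/512 * X ^ 4 * Z ^ 2 * d * t ^ 2
    + (-134055/1024) * X ^ 4 * Z ^ 2 * d * t + 27135/512 * X ^ 4 * Z ^ 2 * d
    + (-6075/1024) * X ^ 4 * Z ^ 2 * t ^ 5 + 45765/1024 * X ^ 4 * Z ^ 2 * t ^ 4
    + (-24705/256) * X ^ 4 * Z ^ 2 * t ^ 3 + 54675/512 * X ^ 4 * Z ^ 2 * t ^ 2
    + (-121905/1024) * X ^ 4 * Z ^ 2 * t + 47385/512 * X ^ 4 * Z ^ 2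
    + 3645/256 * X ^ 3 * Y ^ 3 * d * t ^ 4 + (-3645/128) * X ^ 3 * Y ^ 3 * d * t ^ 3
    + 4455/64 * X ^ 3 * Y ^ 3 * d * t ^ 2 + (-14175/256) * X ^ 3 * Y ^ 3 * d * t
    + 7695/256 * X ^ 3 * Y ^ 3 * d + 8235/256 * X ^ 3 * Y ^ 3 * t ^ 4
    + (-8235/128) * X ^ 3 * Y ^ 3 * t ^ 3 + 6345/64 * X ^ 3 * Y ^ 3 * t ^ 2
    + (-17145/256) * X ^ 3 * Y ^ 3 * t + 10665/256 * X ^ 3 * Y ^ 3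
    + 10125/256 * X ^ 3 * Y ^ 2 * Z * d * t ^ 5 + (-15795/256) * X ^ 3 * Y ^ 2 * Z * d * t ^ 4
    + 7695/128 * X ^ 3 * Y ^ 2 * Z * d * t ^ 3 + (-405/128) * X ^ 3 * Y ^ 2 * Z * d * t ^ 2
    + (-6885/256) * X ^ 3 * Y ^ 2 * Z * d * t + 2025/32 * X ^ 3 * Y ^ 2 * Z * d
    + 6075/256 * X ^ 3 * Y ^ 2 * Z * t ^ 5 + (-6885/256) * X ^ 3 * Y ^ 2 * Z * t ^ 4
    + 2025/128 * X ^ 3 * Y ^ 2 * Z * t ^ 3 + 3645/128 * X ^ 3 * Y ^ 2 * Z * t ^ 2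
    + (-9315/256) * X ^ 3 * Y ^ 2 * Z * t + 2835/32 * X ^ 3 * Y ^ 2 * Z
    + (-10125/256) * X ^ 3 * Y * Z ^ 2 * d * t ^ 5 + 17415/128 * X ^ 3 * Y * Z ^ 2 * d * t ^ 4
    + (-13365/64) * X ^ 3 * Y * Z ^ 2 * d * t ^ 3 + 405/2 * X ^ 3 * Y * Z ^ 2 * d * t ^ 2
    + (-12555/128) * X ^ 3 * Y * Z ^ 2 * d * t + 18225/256 * X ^ 3 * Y * Z ^ 2 * d
    + (-6075/256) * X ^ 3 * Y * Z ^ 2 * t ^ 5 + 11745/128 * X ^ 3 * Y * Z ^ 2 * t ^ 4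
    + (-9315/64) * X ^ 3 * Y * Z ^ 2 * t ^ 3 + 1215/8 * X ^ 3 * Y * Z ^ 2 * t ^ 2
    + (-10125/128) * X ^ 3 * Y * Z ^ 2 * t + 23895/256 * X ^ 3 * Y * Z ^ 2
    + 3645/256 * X ^ 3 * Z ^ 3 * d * t ^ 4 + (-3645/128) * X ^ 3 * Z ^ 3 * d * t ^ 3
    + 4455/64 * X ^ 3 * Z ^ 3 * d * t ^ 2 + (-14175/256) * X ^ 3 * Z ^ 3 * d * t
    + 7695/256 * X ^ 3 * Z ^ 3 * d + 8235/256 * X ^ 3 * Z ^ 3 * t ^ 4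
    + (-8235/128) * X ^ 3 * Z ^ 3 * t ^ 3 + 6345/64 * X ^ 3 * Z ^ 3 * t ^ 2
    + (-17145/256) * X ^ 3 * Z ^ 3 * t + 10665/256 * X ^ 3 * Z ^ 3
    + (-10125/1024) * X ^ 2 * Y ^ 4 * d * t ^ 5 + 41715/1024 * X ^ 2 * Y ^ 4 * d * t ^ 4
    + (-23895/256) * X ^ 2 * Y ^ 4 * d * t ^ 3 + 39285/512 * X ^ 2 * Y ^ 4 * d * t ^ 2
    + (-134055/1024) * X ^ 2 * Y ^ 4 * d * t + 27135/512 * X ^ 2 * Y ^ 4 * d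
    + (-6075/1024) * X ^ 2 * Y ^ 4 * t ^ 5 + 45765/1024 * X ^ 2 * Y ^ 4 * t ^ 4
    + (-24705/256) * X ^ 2 * Y ^ 4 * t ^ 3 + 54675/512 * X ^ 2 * Y ^ 4 * t ^ 2
    + (-121905/1024) * X ^ 2 * Y ^ 4 * t + 47385/512 * X ^ 2 * Y ^ 4
    + 10125/256 * X ^ 2 * Y ^ 3 * Z * d * t ^ 5 + (-17415/128) * X ^ 2 * Y ^ 3 * Z * d * t ^ 4
    + 13365/64 * X ^ 2 * Y ^ 3 * Z * d * t ^ 3 + (-405/2) * X ^ 2 * Y ^ 3 * Z * d * t ^ 2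
    + 12555/128 * X ^ 2 * Y ^ 3 * Z * d * t + (-18225/256) * X ^ 2 * Y ^ 3 * Z * d
    + 6075/256 * X ^ 2 * Y ^ 3 * Z * t ^ 5 + (-11745/128) * X ^ 2 * Y ^ 3 * Z * t ^ 4
    + 9315/64 * X ^ 2 * Y ^ 3 * Z * t ^ 3 + (-1215/8) * X ^ 2 * Y ^ 3 * Z * t ^ 2
    + 10125/128 * X ^ 2 * Y ^ 3 * Z * t + (-23895/256) * X ^ 2 * Y ^ 3 * Z
    + 81405/512 * X ^ 2 * Y ^ 2 * Z ^ 2 * d * t ^ 4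
    + (-81405/256) * X ^ 2 * Y ^ 2 * Z ^ 2 * d * t ^ 3
    + 78975/128 * X ^ 2 * Y ^ 2 * Z ^ 2 * d * t ^ 2
    + (-234495/512) * X ^ 2 * Y ^ 2 * Z ^ 2 * d * t + 280665/512 * X ^ 2 * Y ^ 2 * Z ^ 2 * d
    + 64395/512 * X ^ 2 * Y ^ 2 * Z ^ 2 * t ^ 4 + (-64395/256) * X ^ 2 * Y ^ 2 * Z ^ 2 * t ^ 3
    + 66825/128 * X ^ 2 * Y ^ 2 * Z ^ 2 * t ^ 2 + (-202905/512) * X ^ 2 * Y ^ 2 * Z ^ 2 * t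
    + 215055/512 * X ^ 2 * Y ^ 2 * Z ^ 2 + (-10125/256) * X ^ 2 * Y * Z ^ 3 * d * t ^ 5
    + 15795/256 * X ^ 2 * Y * Z ^ 3 * d * t ^ 4 + (-7695/128) * X ^ 2 * Y * Z ^ 3 * d * t ^ 3
    + 405/128 * X ^ 2 * Y * Z ^ 3 * d * t ^ 2 + 6885/256 * X ^ 2 * Y * Z ^ 3 * d * t
    + (-2025/32) * X ^ 2 * Y * Z ^ 3 * d + (-6075/256) * X ^ 2 * Y * Z ^ 3 * t ^ 5
    + 6885/256 * X ^ 2 * Y * Z ^ 3 * t ^ 4 + (-2025/128) * X ^ 2 * Y * Z ^ 3 * t ^ 3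
    + (-3645/128) * X ^ 2 * Y * Z ^ 3 * t ^ 2 + 9315/256 * X ^ 2 * Y * Z ^ 3 * t
    + (-2835/32) * X ^ 2 * Y * Z ^ 3 + 10125/1024 * X ^ 2 * Z ^ 4 * d * t ^ 5
    + (-4455/512) * X ^ 2 * Z ^ 4 * d * t ^ 4 + 14985/512 * X ^ 2 * Z ^ 4 * d * t ^ 3
    + (-29565/512) * X ^ 2 * Z ^ 4 * d * t ^ 2 + 36855/256 * X ^ 2 * Z ^ 4 * d * t
    + (-65205/1024) * X ^ 2 * Z ^ 4 * d + 6075/1024 * X ^ 2 * Z ^ 4 * t ^ 5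
    + 7695/512 * X ^ 2 * Z ^ 4 * t ^ 4 + (-11745/512) * X ^ 2 * Z ^ 4 * t ^ 3
    + 13365/512 * X ^ 2 * Z ^ 4 * t ^ 2 + 11745/256 * X ^ 2 * Z ^ 4 * t
    + 23085/1024 * X ^ 2 * Z ^ 4 + (-2025/512) * X * Y ^ 5 * d * t ^ 5
    + 1215/128 * X * Y ^ 5 * d * t ^ 4 + (-4455/128) * X * Y ^ 5 * d * t ^ 3
    + 9315/256 * X * Y ^ 5 * d * t ^ 2 + (-2835/256) * X * Y ^ 5 * d * t
    + 2835/512 * X * Y ^ 5 * d + (-1215/512) * X * Y ^ 5 * t ^ 5 + 2025/128 * X * Y ^ 5 * t ^ 4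
    + (-5265/128) * X * Y ^ 5 * t ^ 3 + 13365/256 * X * Y ^ 5 * t ^ 2
    + (-6885/256) * X * Y ^ 5 * t + 6885/512 * X * Y ^ 5
    + (-2835/512) * X * Y ^ 4 * Z * d * t ^ 4 + 2835/256 * X * Y ^ 4 * Z * d * t ^ 3
    + (-3645/256) * X * Y ^ 4 * Z * d * t ^ 2 + 4455/512 * X * Y ^ 4 * Z * d * t
    + 12555/512 * X * Y ^ 4 * Z * d + (-6885/512) * X * Y ^ 4 * Z * t ^ 4
    + 6885/256 * X * Y ^ 4 * Z * t ^ 3 + 405/256 * X * Y ^ 4 * Z * t ^ 2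
    + (-7695/512) * X * Y ^ 4 * Z * t + 23085/512 * X * Y ^ 4 * Z
    + 10125/256 * X * Y ^ 3 * Z ^ 2 * d * t ^ 5 + (-15795/256) * X * Y ^ 3 * Z ^ 2 * d * t ^ 4
    + 7695/128 * X * Y ^ 3 * Z ^ 2 * d * t ^ 3 + (-405/128) * X * Y ^ 3 * Z ^ 2 * d * t ^ 2
    + (-6885/256) * X * Y ^ 3 * Z ^ 2 * d * t + 2025/32 * X * Y ^ 3 * Z ^ 2 * d
    + 6075/256 * X * Y ^ 3 * Z ^ 2 * t ^ 5 + (-6885/256) * X * Y ^ 3 * Z ^ 2 * t ^ 4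
    + 2025/128 * X * Y ^ 3 * Z ^ 2 * t ^ 3 + 3645/128 * X * Y ^ 3 * Z ^ 2 * t ^ 2
    + (-9315/256) * X * Y ^ 3 * Z ^ 2 * t + 2835/32 * X * Y ^ 3 * Z ^ 2
    + (-10125/256) * X * Y ^ 2 * Z ^ 3 * d * t ^ 5 + 17415/128 * X * Y ^ 2 * Z ^ 3 * d * t ^ 4
    + (-13365/64) * X * Y ^ 2 * Z ^ 3 * d * t ^ 3 + 405/2 * X * Y ^ 2 * Z ^ 3 * d * t ^ 2
    + (-12555/128) * X * Y ^ 2 * Z ^ 3 * d * t + 18225/256 * X * Y ^ 2 * Z ^ 3 * d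
    + (-6075/256) * X * Y ^ 2 * Z ^ 3 * t ^ 5 + 11745/128 * X * Y ^ 2 * Z ^ 3 * t ^ 4
    + (-9315/64) * X * Y ^ 2 * Z ^ 3 * t ^ 3 + 1215/8 * X * Y ^ 2 * Z ^ 3 * t ^ 2
    + (-10125/128) * X * Y ^ 2 * Z ^ 3 * t + 23895/256 * X * Y ^ 2 * Z ^ 3
    + (-2835/512) * X * Y * Z ^ 4 * d * t ^ 4 + 2835/256 * X * Y * Z ^ 4 * d * t ^ 3
    + (-3645/256) * X * Y * Z ^ 4 * d * t ^ 2 + 4455/512 * X * Y * Z ^ 4 * d * t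
    + 12555/512 * X * Y * Z ^ 4 * d + (-6885/512) * X * Y * Z ^ 4 * t ^ 4
    + 6885/256 * X * Y * Z ^ 4 * t ^ 3 + 405/256 * X * Y * Z ^ 4 * t ^ 2
    + (-7695/512) * X * Y * Z ^ 4 * t + 23085/512 * X * Y * Z ^ 4
    + 2025/512 * X * Z ^ 5 * d * t ^ 5 + (-5265/512) * X * Z ^ 5 * d * t ^ 4
    + 9315/256 * X * Z ^ 5 * d * t ^ 3 + (-405/8) * X * Z ^ 5 * d * t ^ 2
    + 12555/512 * X * Z ^ 5 * d * t + 405/256 * X * Z ^ 5 * d + 1215/512 * X * Z ^ 5 * t ^ 5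
    + 2025/512 * X * Z ^ 5 * t ^ 4 + 405/256 * X * Z ^ 5 * t ^ 3 + (-2835/512) * X * Z ^ 5 * t
    + 2835/256 * X * Z ^ 5 + (-2835/1024) * Y ^ 6 * d * t ^ 4 + 2835/512 * Y ^ 6 * d * t ^ 3
    + 2025/128 * Y ^ 6 * d * t ^ 2 + (-19035/1024) * Y ^ 6 * d * t + 24705/1024 * Y ^ 6 * d
    + 1755/1024 * Y ^ 6 * t ^ 4 + (-1755/512) * Y ^ 6 * t ^ 3 + 3375/128 * Y ^ 6 * t ^ 2
    + (-25245/1024) * Y ^ 6 * t + 39015/1024 * Y ^ 6 + (-2025/512) * Y ^ 5 * Z * d * t ^ 5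
    + 5265/512 * Y ^ 5 * Z * d * t ^ 4 + (-9315/256) * Y ^ 5 * Z * d * t ^ 3
    + 405/8 * Y ^ 5 * Z * d * t ^ 2 + (-12555/512) * Y ^ 5 * Z * d * t
    + (-405/256) * Y ^ 5 * Z * d + (-1215/512) * Y ^ 5 * Z * t ^ 5
    + (-2025/512) * Y ^ 5 * Z * t ^ 4 + (-405/256) * Y ^ 5 * Z * t ^ 3
    + 2835/512 * Y ^ 5 * Z * t + (-2835/256) * Y ^ 5 * Z
    + 10125/1024 * Y ^ 4 * Z ^ 2 * d * t ^ 5 + (-4455/512) * Y ^ 4 * Z ^ 2 * d * t ^ 4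
    + 14985/512 * Y ^ 4 * Z ^ 2 * d * t ^ 3 + (-29565/512) * Y ^ 4 * Z ^ 2 * d * t ^ 2
    + 36855/256 * Y ^ 4 * Z ^ 2 * d * t + (-65205/1024) * Y ^ 4 * Z ^ 2 * d
    + 6075/1024 * Y ^ 4 * Z ^ 2 * t ^ 5 + 7695/512 * Y ^ 4 * Z ^ 2 * t ^ 4
    + (-11745/512) * Y ^ 4 * Z ^ 2 * t ^ 3 + 13365/512 * Y ^ 4 * Z ^ 2 * t ^ 2
    + 11745/256 * Y ^ 4 * Z ^ 2 * t + 23085/1024 * Y ^ 4 * Z ^ 2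
    + (-3645/256) * Y ^ 3 * Z ^ 3 * d * t ^ 4 + 3645/128 * Y ^ 3 * Z ^ 3 * d * t ^ 3
    + (-4455/64) * Y ^ 3 * Z ^ 3 * d * t ^ 2 + 14175/256 * Y ^ 3 * Z ^ 3 * d * t
    + (-7695/256) * Y ^ 3 * Z ^ 3 * d + (-8235/256) * Y ^ 3 * Z ^ 3 * t ^ 4
    + 8235/128 * Y ^ 3 * Z ^ 3 * t ^ 3 + (-6345/64) * Y ^ 3 * Z ^ 3 * t ^ 2
    + 17145/256 * Y ^ 3 * Z ^ 3 * t + (-10665/256) * Y ^ 3 * Z ^ 3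
    + (-10125/1024) * Y ^ 2 * Z ^ 4 * d * t ^ 5 + 41715/1024 * Y ^ 2 * Z ^ 4 * d * t ^ 4
    + (-23895/256) * Y ^ 2 * Z ^ 4 * d * t ^ 3 + 39285/512 * Y ^ 2 * Z ^ 4 * d * t ^ 2
    + (-134055/1024) * Y ^ 2 * Z ^ 4 * d * t + 27135/512 * Y ^ 2 * Z ^ 4 * d
    + (-6075/1024) * Y ^ 2 * Z ^ 4 * t ^ 5 + 45765/1024 * Y ^ 2 * Z ^ 4 * t ^ 4
    + (-24705/256) * Y ^ 2 * Z ^ 4 * t ^ 3 + 54675/512 * Y ^ 2 * Z ^ 4 * t ^ 2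
    + (-121905/1024) * Y ^ 2 * Z ^ 4 * t + 47385/512 * Y ^ 2 * Z ^ 4
    + 2025/512 * Y * Z ^ 5 * d * t ^ 5 + (-1215/128) * Y * Z ^ 5 * d * t ^ 4
    + 4455/128 * Y * Z ^ 5 * d * t ^ 3 + (-9315/256) * Y * Z ^ 5 * d * t ^ 2
    + 2835/256 * Y * Z ^ 5 * d * t + (-2835/512) * Y * Z ^ 5 * d + 1215/512 * Y * Z ^ 5 * t ^ 5
    + (-2025/128) * Y * Z ^ 5 * t ^ 4 + 5265/128 * Y * Z ^ 5 * t ^ 3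
    + (-13365/256) * Y * Z ^ 5 * t ^ 2 + 6885/256 * Y * Z ^ 5 * t + (-6885/512) * Y * Z ^ 5
    + (-2835/1024) * Z ^ 6 * d * t ^ 4 + 2835/512 * Z ^ 6 * d * t ^ 3
    + 2025/128 * Z ^ 6 * d * t ^ 2 + (-19035/1024) * Z ^ 6 * d * t + 24705/1024 * Z ^ 6 * d
    + 1755/1024 * Z ^ 6 * t ^ 4 + (-1755/512) * Z ^ 6 * t ^ 3 + 3375/128 * Z ^ 6 * t ^ 2
    + (-25245/1024) * Z ^ 6 * t + 39015/1024 * Z ^ 6) * ht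

lemma isHomogeneous_F : F.IsHomogeneous 6 := by
  rw [F_eq]
  have hC := fun c : ℂ => isHomogeneous_C (Fin 3) c
  have hX := fun (i : Fin 3) (n : ℕ) => isHomogeneous_X_pow (R := ℂ) i n
  have hX' := fun i : Fin 3 => isHomogeneous_X ℂ i
  refine .add (.sub (.sub (.add (.add ?_ ?_) ?_) ?_) ?_) ?_
  · exact ((hC 10).mul (hX 0 3)).mul (hX 1 3)
  · exact ((hC 9).mul (hX 0 5)).mul (hX' 2)
  · exact ((hC 9).mul (hX 1 5)).mul (hX' 2)
  · exact (((hC 45).mul (hX 0 2)).mul (hX 1 2)).mul (hX 2 2)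
  · exact (((hC 135).mul (hX' 0)).mul (hX' 1)).mul (hX 2 4)
  · exact (hC 27).mul (hX 2 6)

/-- The matrices of determinant one which preserve a form. -/
noncomputable def formStabilizer (G : MvPolynomial (Fin 3) ℂ) : Subgroup SL(3, ℂ) where
  carrier := {A | substMatrix A.1 G = G}
  one_mem' := substMatrix_one G
  mul_mem' {A B} hA hB := by
    have hA' : substMatrix A.1 G = G := hA
    have hB' : substMatrix B.1 G = G := hB
    change substMatrix (A * B).1 G = G
    rw [Matrix.SpecialLinearGroup.coe_mul, substMatrix_mul, hA', hB']
  inv_mem' {A} hA := by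
    have hA' : substMatrix A.1 G = G := hA
    change substMatrix (A⁻¹).1 G = G
    nth_rewrite 1 [← hA']
    rw [← substMatrix_mul, ← Matrix.SpecialLinearGroup.coe_mul, mul_inv_cancel,
      Matrix.SpecialLinearGroup.coe_one, substMatrix_one]

lemma valentinerGroup_le {G : MvPolynomial (Fin 3) ℂ} (h1 : substMatrix gen₁.1 G = G)
    (h2 : substMatrix gen₂.1 G = G) (h3 : substMatrix gen₃.1 G = G)
    (h4 : substMatrix gen₄.1 G = G) :
    valentinerGroup ≤ (formStabilizer G).map Matrix.SpecialLinearGroup.toPGL := by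
  rw [valentinerGroup, Subgroup.closure_le]
  rintro _ ⟨A, hA, rfl⟩
  refine ⟨A, ?_, rfl⟩
  rcases hA with rfl | rfl | rfl | rfl
  exacts [h1, h2, h3, h4]

/-- If the form `F ∘ M` is invariant under the generators of the Valentiner group, then the
conjugate of the Valentiner group by `M` preserves `F`. -/
lemma isValentinerGroupOfF_conj {M : Matrix (Fin 3) (Fin 3) ℂ} (hM : M.det ≠ 0)
    (h1 : substMatrix gen₁.1 (substMatrix M F) = substMatrix M F)
    (h2 : substMatrix gen₂.1 (substMatrix M F) = substMatrix M F)
    (h3 : substMatrix gen₃.1 (substMatrix M F) = substMatrix M F)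
    (h4 : substMatrix gen₄.1 (substMatrix M F) = substMatrix M F) :
    ∃ W, IsValentinerGroupOfF W := by
  set g : GL (Fin 3) ℂ := Matrix.GeneralLinearGroup.mkOfDetNeZero M hM with hg
  refine ⟨_, ⟨.mk g, rfl⟩, ?_⟩
  intro A hA
  obtain ⟨q, hq, hqA⟩ := hA
  obtain ⟨B, hB, rfl⟩ := valentinerGroup_le h1 h2 h3 h4 hq
  have hB' : substMatrix B.1 (substMatrix M F) = substMatrix M F := hB
  have hmk : Matrix.ProjGenLinGroup.mk (g * Matrix.SpecialLinearGroup.toGL B * g⁻¹) =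
      Matrix.ProjGenLinGroup.mk (Matrix.SpecialLinearGroup.toGL A) := by
    rw [map_mul, map_mul, map_inv]
    exact hqA
  obtain ⟨u, hu⟩ := Matrix.ProjGenLinGroup.mk_eq_mk_iff.mp hmk
  have hMu : IsUnit M.det := isUnit_iff_ne_zero.mpr hM
  have hgi : (g⁻¹ : GL (Fin 3) ℂ).1 = M⁻¹ := by
    rw [Matrix.coe_units_inv]
    rfl
  have hAu : A.1 = (u : ℂ) • (M * B.1 * M⁻¹) := by
    have hs : ∀ X : GL (Fin 3) ℂ, (X * .scalar (Fin 3) u).1 = (u : ℂ) • X.1 := by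
      intro X
      ext i j
      simp [Matrix.mul_apply, Matrix.diagonal_apply, mul_comm]
    have := congrArg (fun x : GL (Fin 3) ℂ => x.1) hu
    simp only [hs] at this
    rw [Units.val_mul, Units.val_mul, hgi] at this
    exact this.symm
  -- The representative `A` agrees with `M B M⁻¹` only up to a scalar `u`. Determinants give `u³ =
  -- 1`, and the scalar does not affect `F` because its degree is 6.
  have hu3 : (u : ℂ) ^ 3 = 1 := by
    have := congrArg Matrix.det hAu
    rw [Matrix.det_smul, Matrix.det_mul, Matrix.det_mul, Matrix.SpecialLinearGroup.det_coe,
      Matrix.det_nonsing_inv, Matrix.SpecialLinearGroup.det_coe, mul_one,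
      Ring.mul_inverse_cancel _ hMu, mul_one] at this
    simpa using this.symm
  apply MvPolynomial.funext
  intro v
  have hMM : M.mulVec (M⁻¹.mulVec v) = v := by
    rw [Matrix.mulVec_mulVec, Matrix.mul_nonsing_inv _ hMu, Matrix.one_mulVec]
  have key := congrArg (eval (M⁻¹.mulVec v)) hB'
  rw [eval_substMatrix, eval_substMatrix, eval_substMatrix, hMM] at key
  rw [eval_substMatrix, hAu, Matrix.smul_mulVec, eval_smul_of_isHomogeneous isHomogeneous_F,
    show (6 : ℕ) = 3 * 2 by norm_num, pow_mul, hu3, one_pow, one_mul, ← Matrix.mulVec_mulVec,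
    ← Matrix.mulVec_mulVec, key]

lemma exists_isValentinerGroupOfF : ∃ W, IsValentinerGroupOfF W := by
  have ht := tau_sq
  have hr := rho_sq
  set t := tau with htdef
  -- Here `2τ - 1 = √5` and `2ρ + 1 = √-3`, so `d = -(3 + √-15) / 4`.
  obtain ⟨d, hd⟩ : ∃ d : ℂ, d = -(3 + (2 * t - 1) * (2 * rho + 1)) / 4 := ⟨_, rfl⟩
  obtain ⟨l, hl⟩ : ∃ l : ℂ, l ^ 2 = (3 - t) / 5 := IsAlgClosed.exists_pow_nat_eq _ (by norm_num)
  obtain ⟨I, hI⟩ : ∃ I : ℂ, I ^ 2 = -1 := IsAlgClosed.exists_pow_nat_eq _ (by norm_num)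
  have hd2 : d ^ 2 = -(3 * d + 3) / 2 := by
    rw [hd]
    linear_combination (1 / 4 * (2 * rho + 1) ^ 2) * ht + 5 / 4 * hr
  have hd0 : d ≠ 0 := by
    rintro rfl
    norm_num at hd2
  have hI0 : I ≠ 0 := by
    rintro rfl
    norm_num at hI
  have ht5 : (t + 2) * (3 - t) = 5 := by linear_combination -ht
  have hl0 : l ≠ 0 := by
    rintro rfl
    have h3 : 3 - t = 0 := by linear_combination -5 * hl
    rw [h3] at ht5
    norm_num at ht5
  have ht2 : t + 2 ≠ 0 := by
    intro h
    rw [h] at ht5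
    norm_num at ht5
  -- The third row is the normalized axis `(1, τ, 0)` of the rotation `gen₄` of order five, as `l² =
  -- (3 - τ) / 5 = 1 / (τ + 2)`. The first two rows are isotropic coordinates on the orthogonal
  -- plane, scaled by `d`. This matches the axis `(0 : 0 : 1)` of the fivefold symmetry of `F`.
  set M : Matrix (Fin 3) (Fin 3) ℂ := !![-(d * l * t), d * l, d * I; -(d * l * t), d * l, -(d * I);
    l, l * t, 0] with hM
  have hdet : M.det ≠ 0 := by
    have : M.det = 2 * d ^ 2 * l ^ 2 * I * (-(t + 2)) := by
      rw [hM, Matrix.det_fin_three]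
      simp
      linear_combination (-2 * d ^ 2 * l ^ 2 * I) * ht
    rw [this]
    exact mul_ne_zero (mul_ne_zero (mul_ne_zero (mul_ne_zero two_ne_zero (pow_ne_zero 2 hd0))
      (pow_ne_zero 2 hl0)) hI0) (neg_ne_zero.mpr ht2)
  have hF : ∀ v, eval v (substMatrix M F) = standardSextic t d (v 0) (v 1) (v 2) := by
    intro v
    rw [eval_substMatrix]
    generalize hX : v 0 = X
    generalize hY : v 1 = Y
    generalize hZ : v 2 = Z
    have hP : l ^ 2 * (Y - t * X) ^ 2 =
        ((3 - t) * Y ^ 2 - 2 * (2 * t - 1) * X * Y + (t + 2) * X ^ 2) / 5 := by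
      rw [hl]
      linear_combination (2 / 5 * X * Y - (t - 2) / 5 * X ^ 2) * ht
    have hQ : l ^ 2 * (X + t * Y) ^ 2 =
        ((3 - t) * X ^ 2 + 2 * (2 * t - 1) * X * Y + (t + 2) * Y ^ 2) / 5 := by
      rw [hl]
      linear_combination (-2 / 5 * X * Y - (t - 2) / 5 * Y ^ 2) * ht
    have hN : l ^ 2 * ((Y - t * X) * (X + t * Y)) =
        (2 * t - 1) * (Y ^ 2 - X ^ 2 - X * Y) / 5 := by
      rw [hl]
      linear_combination ((t - 2) / 5 * X * Y + 1 / 5 * X ^ 2 - 1 / 5 * Y ^ 2) * ht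
    rw [← standardSextic_eq ht hd2 X Y Z rfl hP hQ hN]
    have h0 : M.mulVec v 0 = d * (l * (Y - t * X) + I * Z) := by
      simp [hM, Matrix.mulVec, dotProduct, Fin.sum_univ_three, hX, hY, hZ]
      ring
    have h1 : M.mulVec v 1 = d * (l * (Y - t * X) - I * Z) := by
      simp [hM, Matrix.mulVec, dotProduct, Fin.sum_univ_three, hX, hY, hZ]
      ring
    have h2 : M.mulVec v 2 = l * (X + t * Y) := by
      simp [hM, Matrix.mulVec, dotProduct, Fin.sum_univ_three, hX, hY]
      ring
    have hF' : eval (M.mulVec v) F = 10 * (M.mulVec v 0 * M.mulVec v 1) ^ 3 +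
        9 * ((M.mulVec v 0 ^ 5 + M.mulVec v 1 ^ 5) * M.mulVec v 2) -
        45 * (M.mulVec v 0 * M.mulVec v 1) ^ 2 * M.mulVec v 2 ^ 2 -
        135 * (M.mulVec v 0 * M.mulVec v 1) * (M.mulVec v 2 ^ 2) ^ 2 +
        27 * (M.mulVec v 2 ^ 2) ^ 3 := by
      simp [F]
      ring
    rw [hF', h0, h1, h2]
    generalize Y - t * X = p
    generalize X + t * Y = q
    have e1 : d * (l * p + I * Z) * (d * (l * p - I * Z)) = d ^ 2 * (l ^ 2 * p ^ 2 + Z ^ 2) := by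
      linear_combination (-d ^ 2 * Z ^ 2) * hI
    have e2 : ((d * (l * p + I * Z)) ^ 5 + (d * (l * p - I * Z)) ^ 5) * (l * q) =
        2 * d ^ 5 * (l ^ 2 * (p * q)) * ((l ^ 2 * p ^ 2) ^ 2 - 10 * (l ^ 2 * p ^ 2) * Z ^ 2 +
          5 * Z ^ 4) := by
      linear_combination (d ^ 5 * (l * q) * (20 * (l * p) ^ 3 * Z ^ 2 +
        10 * (l * p) * Z ^ 4 * (I ^ 2 - 1))) * hI
    rw [e1, e2]
    ring
  have hgen : ∀ A : Matrix (Fin 3) (Fin 3) ℂ, (∀ v, standardSextic t d (A.mulVec v 0)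
      (A.mulVec v 1) (A.mulVec v 2) = standardSextic t d (v 0) (v 1) (v 2)) →
      substMatrix A (substMatrix M F) = substMatrix M F := by
    intro A hA
    apply MvPolynomial.funext
    intro v
    rw [eval_substMatrix, hF, hF, hA]
  refine isValentinerGroupOfF_conj hdet (hgen _ ?_) (hgen _ ?_) (hgen _ ?_) (hgen _ ?_)
  · intro v
    rw [coe_gen₁, standardSextic, standardSextic]
    simp [Matrix.mulVec, dotProduct, Fin.sum_univ_three]
    ring
  · intro v
    rw [coe_gen₂, standardSextic, standardSextic]
    simp [Matrix.mulVec, dotProduct, Fin.sum_univ_three]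
    ring
  · intro v
    rw [coe_gen₃, ← standardSextic_gen₃ ht hd hr (v 0) (v 1) (v 2)]
    congr 1 <;> simp [Matrix.mulVec, dotProduct, Fin.sum_univ_three]
  · intro v
    rw [coe_gen₄, ← standardSextic_gen₄ (d := d) ht (v 0) (v 1) (v 2)]
    congr 1 <;> simp [Matrix.mulVec, dotProduct, Fin.sum_univ_three, ← htdef] <;> ring

/-! ### Factors of invariant forms -/

/-- The polynomial `G (T x)` in the variable `T`, whose coefficients are the homogeneous components
of `G`. -/
noncomputable def homogenization {σ : Type*} : MvPolynomial σ ℂ →+* Polynomial (MvPolynomial σ ℂ) :=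
  eval₂Hom (Polynomial.C.comp C) fun i => Polynomial.X * Polynomial.C (X i)

lemma homogenization_monomial {σ : Type*} (m : σ →₀ ℕ) (a : ℂ) :
    homogenization (monomial m a) = Polynomial.monomial m.degree (monomial m a) := by
  rw [homogenization, coe_eval₂Hom, eval₂_monomial, Finsupp.prod, monomial_eq, Finsupp.prod]
  simp only [mul_pow, Finset.prod_mul_distrib, Finset.prod_pow_eq_pow_sum, ← map_pow, ← map_prod,
    RingHom.comp_apply]
  rw [mul_left_comm, ← map_mul, mul_comm, Polynomial.C_mul_X_pow_eq_monomial]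
  rfl

lemma coeff_homogenization {σ : Type*} (G : MvPolynomial σ ℂ) (n : ℕ) (m : σ →₀ ℕ) :
    coeff m ((homogenization G).coeff n) = if m.degree = n then coeff m G else 0 := by
  induction G using MvPolynomial.induction_on' with
  | monomial k a =>
    classical
    rw [homogenization_monomial, Polynomial.coeff_monomial]
    by_cases h : k = m
    · subst h
      split_ifs <;> simp
    · split_ifs <;> simp [h]
  | add p q hp hq =>
    rw [map_add, Polynomial.coeff_add, coeff_add, hp, hq]
    split_ifs <;> simp

lemma isHomogeneous_of_homogenization {σ : Type*} {G H : MvPolynomial σ ℂ} {n : ℕ}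
    (h : homogenization G = Polynomial.monomial n H) : G.IsHomogeneous n := by
  intro m hm
  have key := coeff_homogenization G m.degree m
  rw [if_pos rfl, h, Polynomial.coeff_monomial] at key
  by_contra hn
  have hne : n ≠ m.degree := by
    rintro rfl
    exact hn (DFunLike.congr_fun Finsupp.degree_eq_weight_one m).symm
  rw [if_neg hne, coeff_zero] at key
  exact hm key.symm

lemma homogenization_of_isHomogeneous {σ : Type*} {G : MvPolynomial σ ℂ} {n : ℕ}
    (h : G.IsHomogeneous n) : homogenization G = Polynomial.monomial n G := by
  ext k m
  rw [coeff_homogenization, Polynomial.coeff_monomial]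
  by_cases hm : coeff m G = 0
  · split_ifs <;> simp [hm]
  · have : m.degree = n := (DFunLike.congr_fun Finsupp.degree_eq_weight_one m).trans (h hm)
    rw [this]
    split_ifs <;> simp

/-- Over a domain both the degree and the trailing degree are additive. They agree for the product,
so they agree for each factor. -/
lemma isMonomial_of_mul_eq {R : Type*} [CommRing R] [IsDomain R] {p q : Polynomial R} {n : ℕ}
    {r : R} (hr : r ≠ 0) (h : p * q = Polynomial.monomial n r) :
    ∃ a b c d, p = Polynomial.monomial a c ∧ q = Polynomial.monomial b d ∧ a + b = n := by
  have h0 : p * q ≠ 0 := by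
    rw [h]
    simpa using hr
  have hp : p ≠ 0 := left_ne_zero_of_mul h0
  have hq : q ≠ 0 := right_ne_zero_of_mul h0
  have h1 : p.natDegree + q.natDegree = n := by
    rw [← Polynomial.natDegree_mul hp hq, h, Polynomial.natDegree_monomial_eq _ hr]
  have h2 : p.natTrailingDegree + q.natTrailingDegree = n := by
    rw [← Polynomial.natTrailingDegree_mul hp hq, h, Polynomial.natTrailingDegree_monomial hr]
  have hmon : ∀ p : Polynomial R, p.natTrailingDegree = p.natDegree →
      p = Polynomial.monomial p.natDegree (p.coeff p.natDegree) := by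
    intro p hp
    ext k
    rw [Polynomial.coeff_monomial]
    split_ifs with hk
    · rw [hk]
    · rcases lt_or_gt_of_ne hk with hk | hk
      · exact Polynomial.coeff_eq_zero_of_natDegree_lt hk
      · exact Polynomial.coeff_eq_zero_of_lt_natTrailingDegree (hp ▸ hk)
  have h3 := p.natTrailingDegree_le_natDegree
  have h4 := q.natTrailingDegree_le_natDegree
  exact ⟨_, _, _, _, hmon p (by omega), hmon q (by omega), h1⟩

/-- Factors of a form are forms. -/
lemma isHomogeneous_of_mul {σ : Type*} {A B : MvPolynomial σ ℂ} {n : ℕ}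
    (h : (A * B).IsHomogeneous n) (h0 : A * B ≠ 0) :
    ∃ a b, A.IsHomogeneous a ∧ B.IsHomogeneous b ∧ a + b = n := by
  have key := homogenization_of_isHomogeneous h
  rw [map_mul] at key
  obtain ⟨a, b, c, d, ha, hb, hab⟩ := isMonomial_of_mul_eq h0 key
  exact ⟨a, b, isHomogeneous_of_homogenization ha, isHomogeneous_of_homogenization hb, hab⟩

lemma exists_irreducible_factor {σ : Type*} {G : MvPolynomial σ ℂ} (h0 : G ≠ 0) {v : σ → ℂ}
    (hv : eval v G = 0) : ∃ A, Irreducible A ∧ A ∣ G ∧ eval v A = 0 := by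
  induction G using WfDvdMonoid.induction_on_irreducible with
  | zero => exact absurd rfl h0
  | unit u hu => exact absurd hv ((hu.map (eval v)).ne_zero)
  | mul a i ha hi ih =>
    rw [map_mul, mul_eq_zero] at hv
    rcases hv with hv | hv
    · exact ⟨i, hi, dvd_mul_right i a, hv⟩
    · obtain ⟨A, hA, hd, hA0⟩ := ih ha hv
      exact ⟨A, hA, hd.mul_left i, hA0⟩

/-- A common zero of two factors is a singular point of the product; hence only one component passes
through a smooth point. -/
lemma eval_pderiv_mul_eq_zero {σ : Type*} {A B : MvPolynomial σ ℂ} {v : σ → ℂ}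
    (hA : eval v A = 0) (hB : eval v B = 0) (i : σ) : eval v (pderiv i (A * B)) = 0 := by
  simp [Derivation.leibniz, hA, hB]

lemma eq_C_mul_of_associated {σ : Type*} {A B : MvPolynomial σ ℂ} (h : Associated A B) :
    ∃ c : ℂ, c ≠ 0 ∧ B = C c * A := by
  obtain ⟨u, rfl⟩ := h
  obtain ⟨hc, hu⟩ := isUnit_iff_totalDegree_of_isReduced.mp u.isUnit
  refine ⟨coeff 0 (u : MvPolynomial σ ℂ), hc.ne_zero, ?_⟩
  rw [← totalDegree_eq_zero_iff_eq_C.mp hu, mul_comm]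

lemma substMatrix_mul_poly (M : Matrix (Fin 3) (Fin 3) ℂ) (A B : MvPolynomial (Fin 3) ℂ) :
    substMatrix M (A * B) = substMatrix M A * substMatrix M B :=
  map_mul _ _ _

lemma irreducible_substMatrix {M : Matrix (Fin 3) (Fin 3) ℂ} (hM : IsUnit M.det)
    {A : MvPolynomial (Fin 3) ℂ} (hA : Irreducible A) : Irreducible (substMatrix M A) := by
  let e : MvPolynomial (Fin 3) ℂ ≃* MvPolynomial (Fin 3) ℂ :=
    { toFun := substMatrix M
      invFun := substMatrix M⁻¹
      left_inv := fun G => by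
        rw [← substMatrix_mul, Matrix.mul_nonsing_inv _ hM, substMatrix_one]
      right_inv := fun G => by
        rw [← substMatrix_mul, Matrix.nonsing_inv_mul _ hM, substMatrix_one]
      map_mul' := substMatrix_mul_poly M }
  exact (MulEquiv.irreducible_iff e).mpr hA

/-- An irreducible factor through a smooth point is unique up to a constant. -/
lemma associated_of_smooth {G A A' : MvPolynomial (Fin 3) ℂ} (hA : Irreducible A)
    (hA' : Irreducible A') (hAG : A ∣ G) (hAG' : A' ∣ G) {v : Fin 3 → ℂ} {i : Fin 3}
    (hv : eval v A = 0) (hv' : eval v A' = 0) (hG : eval v (pderiv i G) ≠ 0) :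
    Associated A A' := by
  obtain ⟨B, rfl⟩ := hAG
  rcases hA'.prime.dvd_or_dvd hAG' with h | h
  · exact (hA'.associated_of_dvd hA h).symm
  · obtain ⟨D, rfl⟩ := h
    refine absurd (eval_pderiv_mul_eq_zero hv ?_ i) hG
    rw [map_mul, hv', zero_mul]

lemma coeff_substMatrix_diagonal (d : Fin 3 → ℂ) (B : MvPolynomial (Fin 3) ℂ) (m : Fin 3 →₀ ℕ) :
    coeff m (substMatrix (Matrix.diagonal d) B) = coeff m B * ∏ i, d i ^ m i := by
  have hX : ∀ i, (∑ j, C (Matrix.diagonal d i j) * X j : MvPolynomial (Fin 3) ℂ) = C (d i) *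
    X i := by
    intro i
    rw [Finset.sum_eq_single i]
    · rw [Matrix.diagonal_apply_eq]
    · intro j _ hj
      rw [Matrix.diagonal_apply_ne _ hj.symm, C_0, zero_mul]
    · simp
  simp only [substMatrix, hX]
  induction B using MvPolynomial.induction_on' with
  | monomial k a =>
    classical
    have : bind₁ (fun i => C (d i) * X i) (monomial k a) =
        monomial k (a * ∏ i, d i ^ k i) := by
      rw [bind₁_monomial, monomial_eq, Finsupp.prod]
      simp only [mul_pow, Finset.prod_mul_distrib, ← map_pow, ← map_prod, ← mul_assoc, ← map_mul]
      congr 3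
      exact Finset.prod_subset (Finset.subset_univ _) fun i _ hi => by
        rw [Finsupp.notMem_support_iff.mp hi, pow_zero]
    rw [this, coeff_monomial, coeff_monomial]
    split_ifs with h
    · rw [h]
    · rw [zero_mul]
  | add p q hp hq => rw [map_add, coeff_add, hp, hq, coeff_add, add_mul]

/-- `x⁵` and `y⁵` have to be the roots of `T² - v T + u⁵`. Surjectivity of `(x, y) ↦ (u, v)` turns
the vanishing of a factor in `x, y` into a statement about `curveFun`. -/
lemma exists_mul_eq_add_pow_eq (u v : ℂ) : ∃ x y : ℂ, x * y = u ∧ x ^ 5 + y ^ 5 = v := by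
  obtain ⟨s, hs⟩ : ∃ s : ℂ, s ^ 2 = v ^ 2 - 4 * u ^ 5 :=
    IsAlgClosed.exists_pow_nat_eq _ (by norm_num)
  obtain ⟨x, hx⟩ : ∃ x : ℂ, x ^ 5 = (v + s) / 2 := IsAlgClosed.exists_pow_nat_eq _ (by norm_num)
  by_cases h0 : x = 0
  · have hu : u = 0 := by
      rw [h0] at hx
      have h5 : u ^ 5 = 0 := by linear_combination -(v - s) / 2 * hx + hs / 4
      exact pow_eq_zero_iff (by norm_num) |>.mp h5
    obtain ⟨y, hy⟩ : ∃ y : ℂ, y ^ 5 = v := IsAlgClosed.exists_pow_nat_eq _ (by norm_num)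
    exact ⟨0, y, by rw [hu, zero_mul], by rw [hy]; ring⟩
  · refine ⟨x, u / x, by field_simp, ?_⟩
    have h5 : x ^ 5 ≠ 0 := pow_ne_zero _ h0
    rw [div_pow]
    field_simp
    linear_combination (x ^ 5 - (v - s) / 2) * hx + hs / 4

/-! ### Dihedral symmetry and the components through `(1 : 0 : 0)` and `(0 : 1 : 0)` -/

/-- The diagonal matrix `diag(ζ, ζ⁴, 1)`. -/
def rotation (ζ : ℂ) : Matrix (Fin 3) (Fin 3) ℂ := Matrix.diagonal ![ζ, ζ ^ 4, 1]

/-- The transposition of the first two coordinates. -/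
def reflection : Matrix (Fin 3) (Fin 3) ℂ := !![0, 1, 0; 1, 0, 0; 0, 0, 1]

lemma rotation_mulVec (ζ : ℂ) (w : Fin 3 → ℂ) :
    (rotation ζ).mulVec w = ![ζ * w 0, ζ ^ 4 * w 1, w 2] := by
  funext i
  fin_cases i <;> simp [rotation, Matrix.mulVec_diagonal]

lemma reflection_mulVec (w : Fin 3 → ℂ) : reflection.mulVec w = ![w 1, w 0, w 2] := by
  funext i
  fin_cases i <;> simp [reflection, Matrix.mulVec, dotProduct, Fin.sum_univ_three]

lemma isUnit_det_rotation {ζ : ℂ} (hζ : ζ ^ 5 = 1) : IsUnit (rotation ζ).det := by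
  rw [rotation, Matrix.det_diagonal, Fin.prod_univ_three]
  simp [← pow_succ', hζ]

lemma isUnit_det_reflection : IsUnit reflection.det := by
  rw [reflection, Matrix.det_fin_three]
  simp

lemma reflection_mul_reflection : reflection * reflection = 1 := by
  ext i j
  fin_cases i <;> fin_cases j <;>
    simp [reflection, Matrix.mul_apply, Fin.sum_univ_three]

lemma substMatrix_rotation_curve {ζ : ℂ} (hζ : ζ ^ 5 = 1) (P : ℂ) :
    substMatrix (rotation ζ) (curve P) = curve P := by
  apply MvPolynomial.funext
  intro w
  rw [eval_substMatrix, eval_curve, eval_curve, rotation_mulVec]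
  congr 1
  · simp
    linear_combination w 0 * w 1 * hζ
  · simp
    linear_combination (w 0 ^ 5 + w 1 ^ 5 * (ζ ^ 15 + ζ ^ 10 + ζ ^ 5 + 1)) * hζ

lemma substMatrix_reflection_curve (P : ℂ) : substMatrix reflection (curve P) = curve P := by
  apply MvPolynomial.funext
  intro w
  rw [eval_substMatrix, eval_curve, eval_curve, reflection_mulVec]
  congr 1
  · simp [mul_comm]
  · simp [add_comm]

/-- Both points are smooth because of the term `-121500 xy (x⁵ + y⁵)²`, which does not depend on
`P`. -/
lemma eval_pderiv_curve_ne_zero (P : ℂ) : eval ![1, 0, 0] (pderiv 1 (curve P)) ≠ 0 ∧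
    eval ![0, 1, 0] (pderiv 0 (curve P)) ≠ 0 := by
  constructor
  · rw [← gradAt, gradAt_curve_one]
    simp [curveFunU]
  · rw [← gradAt, gradAt_curve_zero]
    simp [curveFunU]

lemma curve_ne_zero (P : ℂ) : curve P ≠ 0 := by
  intro h
  have := (eval_pderiv_curve_ne_zero P).1
  rw [h] at this
  simp at this

/-- A symmetry of the curve that fixes a smooth point maps the unique component through this point
to itself. -/
lemma substMatrix_eq_C_mul_of_smooth {G A : MvPolynomial (Fin 3) ℂ} (hA : Irreducible A)
    (hAG : A ∣ G) {a : ℕ} (ha : A.IsHomogeneous a) {v : Fin 3 → ℂ} {i : Fin 3}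
    (hv : eval v A = 0) (hG : eval v (pderiv i G) ≠ 0)
    {M : Matrix (Fin 3) (Fin 3) ℂ} (hM : IsUnit M.det) (hMG : substMatrix M G = G) {c : ℂ}
    (hMv : M.mulVec v = c • v) : ∃ k : ℂ, k ≠ 0 ∧ substMatrix M A = C k * A := by
  refine eq_C_mul_of_associated (associated_of_smooth hA (irreducible_substMatrix hM hA) hAG ?_ hv
    ?_ hG)
  · obtain ⟨B, rfl⟩ := hAG
    rw [← hMG, substMatrix_mul_poly]
    exact dvd_mul_right _ _
  · rw [eval_substMatrix, hMv, eval_smul_of_isHomogeneous ha, hv, mul_zero]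

lemma substMatrix_cofactor {A B : MvPolynomial (Fin 3) ℂ} (hA : A ≠ 0)
    {M : Matrix (Fin 3) (Fin 3) ℂ} (hM : substMatrix M (A * B) = A * B) {c : ℂ} (hc : c ≠ 0)
    (hMA : substMatrix M A = C c * A) : substMatrix M B = C c⁻¹ * B := by
  rw [substMatrix_mul_poly, hMA] at hM
  have h1 : A * (C c * substMatrix M B) = A * B := by rw [← hM]; ring
  nth_rw 2 [← mul_left_cancel₀ hA h1]
  rw [← mul_assoc, ← C_mul, inv_mul_cancel₀ hc, C_1, one_mul]

lemma exists_factorization (P : ℂ) {ζ : ℂ} (hζ : ζ ^ 5 = 1) : ∃ A A' B,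
    Irreducible A ∧ (A' = A ∨ A' = A * substMatrix reflection A) ∧ curve P = A' * B ∧
    (∃ c, c ≠ 0 ∧ substMatrix (rotation ζ) A' = C c * A') ∧
    (∃ c, c ≠ 0 ∧ substMatrix reflection A' = C c * A') ∧
    eval ![1, 0, 0] A' = 0 ∧ eval ![0, 1, 0] A' = 0 := by
  have hG0 := curve_ne_zero P
  obtain ⟨hs0, hs1⟩ := eval_pderiv_curve_ne_zero P
  obtain ⟨A, hA, hAG, hA0⟩ := exists_irreducible_factor hG0 (v := ![1, 0, 0])
    (by rw [eval_curve]; simp [curveFun])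
  have hT : ∀ A : MvPolynomial (Fin 3) ℂ,
      substMatrix reflection (substMatrix reflection A) = A := fun A => by
    rw [← substMatrix_mul, reflection_mul_reflection, substMatrix_one]
  have hom : ∀ A, A ∣ curve P → ∃ a, A.IsHomogeneous a := by
    rintro A ⟨B, hB⟩
    obtain ⟨a, _, ha, _⟩ := isHomogeneous_of_mul (hB ▸ homogeneity_curve P) (hB ▸ hG0)
    exact ⟨a, ha⟩
  have hrot0 : (rotation ζ).mulVec ![1, 0, 0] = ζ • ![1, 0, 0] := by
    rw [rotation_mulVec]; simp
  have hrot1 : (rotation ζ).mulVec ![0, 1, 0] = ζ ^ 4 • ![0, 1, 0] := by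
    rw [rotation_mulVec]; simp
  have hTe : reflection.mulVec ![0, 1, 0] = ![1, 0, 0] := by
    rw [reflection_mulVec]; simp
  have hTe' : reflection.mulVec ![1, 0, 0] = ![0, 1, 0] := by
    rw [reflection_mulVec]; simp
  obtain ⟨a, ha⟩ := hom A hAG
  obtain ⟨c, hc, hcA⟩ := substMatrix_eq_C_mul_of_smooth hA hAG ha hA0 hs0
    (isUnit_det_rotation hζ) (substMatrix_rotation_curve hζ P) hrot0
  set A₁ := substMatrix reflection A with hA₁def
  have hA₁ : Irreducible A₁ := irreducible_substMatrix isUnit_det_reflection hA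
  have hA₁0 : eval ![0, 1, 0] A₁ = 0 := by rw [hA₁def, eval_substMatrix, hTe, hA0]
  have hA₁G : A₁ ∣ curve P := by
    obtain ⟨B, hB⟩ := hAG
    rw [← substMatrix_reflection_curve, hB, substMatrix_mul_poly]
    exact dvd_mul_right _ _
  -- Either the component through `(1 : 0 : 0)` equals its mirror image and contains both points, or
  -- the two are distinct and their product divides the equation.
  by_cases hass : Associated A A₁
  · obtain ⟨k, hk, hkA⟩ := eq_C_mul_of_associated hass
    obtain ⟨B, hB⟩ := hAG
    refine ⟨A, A, B, hA, .inl rfl, hB, ⟨c, hc, hcA⟩, ⟨k, hk, hkA⟩, hA0, ?_⟩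
    rw [hkA, map_mul, eval_C] at hA₁0
    exact (mul_eq_zero.mp hA₁0).resolve_left hk
  · obtain ⟨a₁, ha₁⟩ := hom A₁ hA₁G
    obtain ⟨c₁, hc₁, hcA₁⟩ := substMatrix_eq_C_mul_of_smooth hA₁ hA₁G ha₁ hA₁0 hs1
      (isUnit_det_rotation hζ) (substMatrix_rotation_curve hζ P) hrot1
    obtain ⟨B, hB⟩ := hAG
    rw [hB] at hA₁G
    obtain ⟨D, rfl⟩ := (hA₁.prime.dvd_or_dvd hA₁G).resolve_left fun h =>
      hass (hA₁.associated_of_dvd hA h).symm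
    refine ⟨A, A * A₁, D, hA, .inr rfl, by rw [hB, mul_assoc], ⟨c * c₁, mul_ne_zero hc hc₁, ?_⟩,
      ⟨1, one_ne_zero, ?_⟩, by rw [map_mul, hA0, zero_mul], by rw [map_mul, hA₁0, mul_zero]⟩
    · rw [substMatrix_mul_poly, hcA, hcA₁, C_mul]
      ring
    · rw [substMatrix_mul_poly, hT, C_1, one_mul, mul_comm]

/-- The rotation multiplies a monomial by `ζ ^ (m 0 + 4 * m 1)`, so an invariant form contains only
monomials whose weight is divisible by 5. -/
lemma isHomogeneous_weight {B : MvPolynomial (Fin 3) ℂ} {b : ℕ} (hB : B.IsHomogeneous b) {ζ : ℂ}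
    (hζ : IsPrimitiveRoot ζ 5) (hS : substMatrix (rotation ζ) B = B) {m : Fin 3 →₀ ℕ}
    (hm : m ∈ B.support) : m 0 + m 1 + m 2 = b ∧ 5 ∣ m 0 + 4 * m 1 := by
  rw [mem_support_iff] at hm
  constructor
  · have := (DFunLike.congr_fun Finsupp.degree_eq_weight_one m).trans (hB hm)
    rw [← this, Finsupp.degree_eq_sum, Fin.sum_univ_three]
  · have := coeff_substMatrix_diagonal ![ζ, ζ ^ 4, 1] B m
    rw [← rotation, hS, Fin.prod_univ_three] at this
    apply hζ.dvd_of_pow_eq_one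
    have h1 : coeff m B * ζ ^ (m 0 + 4 * m 1) = coeff m B * 1 := by
      rw [mul_one]
      conv_rhs => rw [this]
      simp [pow_add, pow_mul]
    exact mul_left_cancel₀ hm h1

lemma eval_eq_of_quadratic {A : MvPolynomial (Fin 3) ℂ} (hA : A.IsHomogeneous 2) {ζ : ℂ}
    (hζ : IsPrimitiveRoot ζ 5) (hS : substMatrix (rotation ζ) A = A) :
    ∃ k n : ℂ, ∀ w, eval w A = k * (w 0 * w 1) + n * w 2 ^ 2 := by
  have key : A ∈ Submodule.span ℂ {X 0 * X 1, (X 2 : MvPolynomial (Fin 3) ℂ) ^ 2} := by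
    rw [A.as_sum]
    refine Submodule.sum_mem _ fun m hm => ?_
    obtain ⟨h1, h2⟩ := isHomogeneous_weight hA hζ hS hm
    rw [monomial_eq, Finsupp.prod_fintype _ _ (by simp), Fin.prod_univ_three, ← smul_eq_C_mul]
    refine Submodule.smul_mem _ _ (Submodule.subset_span ?_)
    obtain h | h : (m 0 = 1 ∧ m 1 = 1 ∧ m 2 = 0) ∨ (m 0 = 0 ∧ m 1 = 0 ∧ m 2 = 2) := by
      obtain h | h | h : m 1 = 0 ∨ m 1 = 1 ∨ m 1 = 2 := by omega
      all_goals omega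
    all_goals simp [h]
  obtain ⟨k, n, rfl⟩ := Submodule.mem_span_pair.mp key
  exact ⟨k, n, fun w => by simp [smul_eval]⟩

lemma eval_eq_of_quintic {B : MvPolynomial (Fin 3) ℂ} (hB : B.IsHomogeneous 5) {ζ : ℂ}
    (hζ : IsPrimitiveRoot ζ 5) (hS : substMatrix (rotation ζ) B = B) :
    ∃ c c' k₁ k₂ k₃ : ℂ, ∀ w, eval w B = c * w 0 ^ 5 + c' * w 1 ^ 5 + k₁ * (w 0 * w 1) * w 2 ^ 3 +
      k₂ * (w 0 * w 1) ^ 2 * w 2 + k₃ * w 2 ^ 5 := by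
  have key : B ∈ Submodule.span ℂ {X 0 ^ 5, X 1 ^ 5, X 0 * X 1 * X 2 ^ 3, X 0 ^ 2 * X 1 ^ 2 * X 2,
      (X 2 : MvPolynomial (Fin 3) ℂ) ^ 5} := by
    rw [B.as_sum]
    refine Submodule.sum_mem _ fun m hm => ?_
    obtain ⟨h1, h2⟩ := isHomogeneous_weight hB hζ hS hm
    rw [monomial_eq, Finsupp.prod_fintype _ _ (by simp), Fin.prod_univ_three, ← smul_eq_C_mul]
    refine Submodule.smul_mem _ _ (Submodule.subset_span ?_)
    obtain h | h | h | h | h : (m 0 = 5 ∧ m 1 = 0 ∧ m 2 = 0) ∨ (m 0 = 0 ∧ m 1 = 5 ∧ m 2 = 0) ∨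
        (m 0 = 1 ∧ m 1 = 1 ∧ m 2 = 3) ∨ (m 0 = 2 ∧ m 1 = 2 ∧ m 2 = 1) ∨
        (m 0 = 0 ∧ m 1 = 0 ∧ m 2 = 5) := by
      obtain h | h | h | h | h | h :
          m 1 = 0 ∨ m 1 = 1 ∨ m 1 = 2 ∨ m 1 = 3 ∨ m 1 = 4 ∨ m 1 = 5 := by omega
      all_goals omega
    all_goals simp [h]
  simp only [Submodule.mem_span_insert, Submodule.mem_span_singleton] at key
  obtain ⟨c, _, ⟨c', _, ⟨k₁, _, ⟨k₂, _, ⟨k₃, rfl⟩, rfl⟩, rfl⟩, rfl⟩, rfl⟩ := key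
  exact ⟨c, c', k₁, k₂, k₃, fun w => by simp [smul_eval]; ring⟩

end Valentiner

/-! ### The equation on the line `x = y` is not a square -/

namespace Valentiner

open Polynomial

/-- At a root of `R` the polynomial `q` vanishes, so `q²` has derivative 0 there, whereas `c K² R`
has derivative `c K² R' ≠ 0`. -/
lemma false_of_sq_mul_eq_sq {c : ℂ} (hc : c ≠ 0) {K R q : ℂ[X]}
    (h : ∀ t, c * K.eval t ^ 2 * R.eval t = q.eval t ^ 2) (hR : R.degree = 4)
    (hK : ∀ t, R.eval t = 0 → K.eval t ≠ 0)
    (hR' : ∀ t, R.eval t = 0 → R.derivative.eval t ≠ 0) : False := by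
  obtain ⟨t, ht⟩ := IsAlgClosed.exists_root R (by rw [hR]; decide)
  have hq : q.eval t = 0 := by
    have := h t
    rw [ht, mul_zero] at this
    exact pow_eq_zero_iff two_ne_zero |>.mp this.symm
  have hp : C c * K ^ 2 * R = q ^ 2 := Polynomial.funext fun t => by simpa using h t
  have hd := congrArg (fun p => (derivative p).eval t) hp
  simp [derivative_pow, hq, ht.eq_zero, hc] at hd
  exact hd.elim (hK t ht) (hR' t ht)

lemma not_square_curve36 (q : Polynomial ℂ) :
    ¬ ∀ t : ℂ, curveFun 20250 (t ^ 2) (2 * t ^ 5) 1 = q.eval t ^ 2 := by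
  intro h
  -- The restriction to `x = y = t`, `z = 1` is `121500 K² R`; the double roots are `t = 0` and the
  -- roots of the cubic in `diagonal_of_curve36`. The identities below are Bézout relations for `R,
  -- K` and for `R, R'`.
  obtain ⟨K, hK⟩ : ∃ K : ℂ[X], ∀ t, K.eval t = (-6) * t ^ 1 + (3) * t ^ 2 + (2) * t ^ 3 + (1) *
    t ^ 4 :=
    ⟨C (-6) * X ^ 1 + C (3) * X ^ 2 + C (2) * X ^ 3 + C (1) * X ^ 4, fun t => by simp⟩
  obtain ⟨R, hR⟩ : ∃ R : ℂ[X], R = C (-54) * X ^ 0 + C (-54) * X ^ 1 + C (-9) * X ^ 2 +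
    C (-54) * X ^ 3 + C (21) * X ^ 4 := ⟨_, rfl⟩
  have hRe : ∀ t, R.eval t = (-54) * t ^ 0 + (-54) * t ^ 1 + (-9) * t ^ 2 + (-54) * t ^ 3 +
    (21) * t ^ 4 := fun t => by rw [hR]; simp
  refine false_of_sq_mul_eq_sq (c := 121500) (K := K) (R := R) (q := q) (by norm_num) ?_ ?_ ?_ ?_
  · intro t
    rw [← h, hK, hRe, curveFun]
    ring
  · rw [hR]
    compute_degree!
  · intro t ht hKt
    rw [hRe] at ht
    rw [hK] at hKt
    have : (1 : ℂ) = 0 := by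
      linear_combination ((-1/54) * t ^ 0 + (2/375) * t ^ 1 + (14/3375) * t ^ 2 + (8/3375) *
        t ^ 3) * ht +
        ((89/750) * t ^ 0 + (2/1125) * t ^ 1 + (158/1125) * t ^ 2 + (-56/1125) * t ^ 3) * hKt
    exact one_ne_zero this
  · intro t ht hRt
    rw [hRe] at ht
    rw [hR] at hRt
    simp at hRt
    have : (1 : ℂ) = 0 := by
      linear_combination ((-19/1125) * t ^ 0 + (124/10125) * t ^ 1 + (-28/10125) * t ^ 2) * ht +
        ((-11/6750) * t ^ 0 + (7/1350) * t ^ 1 + (-71/20250) * t ^ 2 + (7/10125) * t ^ 3) * hRt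
    exact one_ne_zero this

lemma not_square_curve45 (q : Polynomial ℂ) :
    ¬ ∀ t : ℂ, curveFun (-10125) (t ^ 2) (2 * t ^ 5) 1 = q.eval t ^ 2 := by
  intro h
  -- The restriction is `30375 K² R`, with `K` four times the quartic of `diagonal_of_curve45`.
  obtain ⟨K, hK⟩ : ∃ K : ℂ[X], ∀ t, K.eval t = (9) * t ^ 0 + (9) * t ^ 1 + (9) * t ^ 2 + (-6) *
    t ^ 3 + (4) * t ^ 4 :=
    ⟨C (9) * X ^ 0 + C (9) * X ^ 1 + C (9) * X ^ 2 + C (-6) * X ^ 3 + C (4) * X ^ 4,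
      fun t => by simp⟩
  obtain ⟨R, hR⟩ : ∃ R : ℂ[X], R = C (-9) * X ^ 0 + C (18) * X ^ 1 + C (-15) * X ^ 2 + C (-18) *
    X ^ 3 + C (-1) * X ^ 4 := ⟨_, rfl⟩
  have hRe : ∀ t, R.eval t = (-9) * t ^ 0 + (18) * t ^ 1 + (-15) * t ^ 2 + (-18) * t ^ 3 +
    (-1) * t ^ 4 := fun t => by rw [hR]; simp
  refine false_of_sq_mul_eq_sq (c := 30375) (K := K) (R := R) (q := q) (by norm_num) ?_ ?_ ?_ ?_
  · intro t
    rw [← h, hK, hRe, curveFun]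
    ring
  · rw [hR]
    compute_degree!
  · intro t ht hKt
    rw [hRe] at ht
    rw [hK] at hKt
    have : (1 : ℂ) = 0 := by
      linear_combination ((-19/600) * t ^ 0 + (-4/225) * t ^ 1 + (11/675) * t ^ 2 + (-7/675) *
        t ^ 3) * ht +
        ((143/1800) * t ^ 0 + (-61/1800) * t ^ 1 + (-251/5400) * t ^ 2 + (-7/2700) * t ^ 3) * hKt
    exact one_ne_zero this
  · intro t ht hRt
    rw [hRe] at ht
    rw [hR] at hRt
    simp at hRt
    have : (1 : ℂ) = 0 := by
      linear_combination ((-29/200) * t ^ 0 + (-157/1350) * t ^ 1 + (-11/1350) * t ^ 2) * ht +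
        ((-61/3600) * t ^ 0 + (211/3600) * t ^ 1 + (413/10800) * t ^ 2 + (11/5400) * t ^ 3) * hRt
    exact one_ne_zero this

end Valentiner

/-! ### Exclusion of conic and quintic factors; irreducibility -/

namespace Valentiner

open MvPolynomial

lemma not_linear_factor_curve36 (r₀ r₁ r₂ : ℂ) :
    ¬ ∀ u : ℂ, curveFun 20250 u (r₀ + r₁ * u + r₂ * u ^ 2) 1 = 0 := by
  intro h
  unfold curveFun at h
  have : (1 : ℂ) = 0 := by
    -- The sixth difference isolates the coefficient of `u⁶`, which is `3037500` whatever the `r`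
    -- are.
    linear_combination (1 / 3037500 : ℂ) * ((1/720) * h (-3) + (-1/120) * h (-2) + (1/48) *
      h (-1) + (-1/36) * h (0) + (1/48) * h (1) + (-1/120) * h (2) + (1/720) * h (3))
  exact one_ne_zero this

lemma not_linear_factor_curve45 (r₀ r₁ r₂ : ℂ) :
    ¬ ∀ u : ℂ, curveFun (-10125) u (r₀ + r₁ * u + r₂ * u ^ 2) 1 = 0 := by
  intro h
  unfold curveFun at h
  -- For this `P` the coefficient of `u⁶` vanishes identically. Those of `u⁵`, `u⁴` and `u³`
  -- determine `r₂`, `r₁` and `r₀` in turn, in terms of `w = r₂ + 15` with `w² = 375`; the constant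
  -- term then contradicts them.
  have h5 : (r₂ + 15) ^ 2 = 375 := by
    linear_combination (-1 / 121500 : ℂ) * ((-1/240) * h (-3) + (1/60) * h (-2) + (-1/48) *
      h (-1) + (1/48) * h (1) + (-1/60) * h (2) + (1/240) * h (3))
  have h4 : -21 * r₂ ^ 2 - 8 * r₁ * r₂ - 450 * r₂ - 120 * r₁ - 2025 = 0 := by
    linear_combination (1 / 30375 : ℂ) * ((-1/144) * h (-3) + (1/12) * h (-2) + (-13/48) *
      h (-1) + (7/18) * h (0) + (-13/48) * h (1) + (1/12) * h (2) + (-1/144) * h (3))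
  have h3 : -42 * r₁ * r₂ - 4 * (2 * r₀ * r₂ + r₁ ^ 2) + 1026 * r₂ - 450 * r₁ - 120 * r₀ - 3510 =
      0 := by
    linear_combination (1 / 30375 : ℂ) * ((1/48) * h (-3) + (-1/6) * h (-2) + (13/48) * h (-1) +
      (-13/48) * h (1) + (1/6) * h (2) + (-1/48) * h (3))
  have h0 : 7 * r₀ ^ 2 + 702 * r₀ + 243 = 0 := by
    linear_combination (-1 / 91125 : ℂ) * h 0
  obtain ⟨w, hw⟩ : ∃ w, w = r₂ + 15 := ⟨_, rfl⟩
  rw [← hw] at h5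
  obtain rfl : r₂ = w - 15 := by rw [hw]; ring
  have hw0 : w ≠ 0 := by
    rintro rfl
    norm_num at h5
  obtain rfl : r₁ = 45 / 2 - 21 / 8 * w := by
    apply mul_left_cancel₀ hw0
    linear_combination (-1 / 8 : ℂ) * h4
  obtain rfl : r₀ = 81 / 8 + 603 / 128 * w := by
    apply mul_left_cancel₀ hw0
    linear_combination (-1 / 8 : ℂ) * h3 + (45/8) * h5
  have h1 : (1086665625/16384 : ℂ) + 2035125/512 * w = 0 := by
    linear_combination h0 - 2545263/16384 * h5
  have : (1 : ℂ) = 0 := by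
    linear_combination (-868352/19976641875 + (35127296/13484233265625) * w) * h1 -
      (4596736/443925375) * h5
  exact one_ne_zero this

lemma not_conic_factor_curve36 (u : ℂ) : ∃ v, curveFun 20250 u v 1 ≠ 0 := by
  by_contra! h
  unfold curveFun at h
  -- The second difference in `v` isolates the coefficient `121500 (15 - u)` of `v²`; at `u = 15`
  -- the coefficient of `v` is nonzero.
  have hu : u = 15 := by
    linear_combination (-1 / 243000 : ℂ) * (h 1 + h (-1) - 2 * h 0)
  have h1 : (1 : ℂ) = 0 := by
    rw [hu] at h
    linear_combination (-1/6298560000 : ℂ) * (h 1 - h (-1))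
  exact one_ne_zero h1

lemma not_conic_factor_curve45 (u : ℂ) : ∃ v, curveFun (-10125) u v 1 ≠ 0 := by
  by_contra! h
  unfold curveFun at h
  have hu : u = -21/4 := by
    linear_combination (-1 / 243000 : ℂ) * (h 1 + h (-1) - 2 * h 0)
  have h1 : (1 : ℂ) = 0 := by
    rw [hu] at h
    linear_combination (-2/307546875 : ℂ) * (h 1 - h (-1))
  exact one_ne_zero h1

lemma eval_aeval_diagonal (A : MvPolynomial (Fin 3) ℂ) (t : ℂ) :
    (aeval ![Polynomial.X, Polynomial.X, 1] A : Polynomial ℂ).eval t = eval ![t, t, 1] A := by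
  rw [← Polynomial.coe_aeval_eq_eval, comp_aeval_apply, ← coe_aeval_eq_eval, RingHom.coe_coe]
  congr 2
  funext i
  fin_cases i <;> simp

lemma irreducible_curve (P : ℂ) (h1 : curveFun P 1 2 0 ≠ 0)
    (hconic : ∀ u, ∃ v, curveFun P u v 1 ≠ 0)
    (hlin : ∀ r₀ r₁ r₂ : ℂ, ¬ ∀ u : ℂ, curveFun P u (r₀ + r₁ * u + r₂ * u ^ 2) 1 = 0)
    (hsq : ∀ q : Polynomial ℂ, ¬ ∀ t : ℂ, curveFun P (t ^ 2) (2 * t ^ 5) 1 = q.eval t ^ 2) :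
    Irreducible (curve P) := by
  obtain ⟨ζ, hζ⟩ : ∃ ζ : ℂ, IsPrimitiveRoot ζ 5 := ⟨_, Complex.isPrimitiveRoot_exp 5 (by norm_num)⟩
  have hζ5 := hζ.pow_eq_one
  obtain ⟨A, A', B, hA, hA', hG, ⟨c, hc, hcA⟩, ⟨e, he, heA⟩, hA0, hA1⟩ := exists_factorization P hζ5
  have hG0 : A' * B ≠ 0 := hG ▸ curve_ne_zero P
  have hA'0 : A' ≠ 0 := left_ne_zero_of_mul hG0
  obtain ⟨hs0, hs1⟩ := eval_pderiv_curve_ne_zero P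
  rw [hG] at hs0 hs1
  have hB0 : eval ![1, 0, 0] B ≠ 0 := fun h => hs0 (eval_pderiv_mul_eq_zero hA0 h 1)
  have hB1 : eval ![0, 1, 0] B ≠ 0 := fun h => hs1 (eval_pderiv_mul_eq_zero hA1 h 0)
  have hcB := substMatrix_cofactor hA'0 (hG ▸ substMatrix_rotation_curve hζ5 P) hc hcA
  have heB := substMatrix_cofactor hA'0 (hG ▸ substMatrix_reflection_curve P) he heA
  obtain ⟨a, b, ha, hb, hab⟩ := isHomogeneous_of_mul (hG ▸ homogeneity_curve P) hG0
  have hev : ∀ w, eval w A' * eval w B = curveFun P (w 0 * w 1) (w 0 ^ 5 + w 1 ^ 5) (w 2) := by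
    intro w
    rw [← eval_curve, hG, map_mul]
  have hw0 : ζ ^ b = c⁻¹ := by
    have := congrArg (eval ![1, 0, 0]) hcB
    rw [eval_substMatrix, rotation_mulVec, map_mul, eval_C,
      show ![ζ * (![1, 0, 0] : Fin 3 → ℂ) 0, ζ ^ 4 * (![1, 0, 0] : Fin 3 → ℂ) 1,
        (![1, 0, 0] : Fin 3 → ℂ) 2] = ζ • ![1, 0, 0] by simp, eval_smul_of_isHomogeneous hb] at this
    exact mul_right_cancel₀ hB0 this
  have hw1 : (ζ ^ 4) ^ b = c⁻¹ := by
    have := congrArg (eval ![0, 1, 0]) hcB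
    rw [eval_substMatrix, rotation_mulVec, map_mul, eval_C,
      show ![ζ * (![0, 1, 0] : Fin 3 → ℂ) 0, ζ ^ 4 * (![0, 1, 0] : Fin 3 → ℂ) 1,
        (![0, 1, 0] : Fin 3 → ℂ) 2] = ζ ^ 4 • ![0, 1, 0] by simp,
      eval_smul_of_isHomogeneous hb] at this
    exact mul_right_cancel₀ hB1 this
  -- The rotation multiplies `B` by one constant, which equals `ζ ^ b` at `(1, 0, 0)` and `ζ ^ (4
  -- b)` at `(0, 1, 0)`.
  have hdvd : 5 ∣ 3 * b := by
    apply hζ.dvd_of_pow_eq_one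
    have hne : ζ ^ b ≠ 0 := pow_ne_zero _ (hζ.ne_zero (by norm_num))
    apply mul_left_cancel₀ hne
    rw [mul_one, ← pow_add, show b + 3 * b = 4 * b by ring, pow_mul, hw1, hw0]
  have hc1 : c = 1 := by
    obtain ⟨k, hk⟩ : 5 ∣ b := by omega
    rw [hk, pow_mul, hζ5, one_pow] at hw0
    exact inv_eq_one.mp hw0.symm
  rw [hc1, C_1, one_mul] at hcA
  rw [hc1, inv_one, C_1, one_mul] at hcB
  have h11 := hev ![1, 1, 0]
  rw [show curveFun P _ _ _ = curveFun P 1 2 0 by congr 1 <;> norm_num] at h11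
  have hA11 : eval ![1, 1, 0] A' ≠ 0 := fun h => h1 (by rw [← h11, h, zero_mul])
  have hB11 : eval ![1, 1, 0] B ≠ 0 := fun h => h1 (by rw [← h11, h, mul_zero])
  obtain rfl | rfl | rfl : b = 0 ∨ b = 5 ∨ b = 10 := by omega
  · obtain ⟨k, rfl⟩ : ∃ k, B = C k := ⟨_, totalDegree_eq_zero_iff_eq_C.mp (by
      simpa using hb.totalDegree_le)⟩
    have hk : k ≠ 0 := by simpa using hB0
    rcases hA' with rfl | rfl
    · rw [hG]
      exact (associated_mul_unit_right _ _ (hk.isUnit.map C)).irreducible hA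
    -- On `x = y` a form and its mirror image coincide, so `k A (A ∘ reflection)` becomes the square
    -- of `s A`.
    · obtain ⟨s, hs⟩ : ∃ s : ℂ, s ^ 2 = k := IsAlgClosed.exists_pow_nat_eq _ (by norm_num)
      refine absurd ?_ (hsq (Polynomial.C s * aeval ![Polynomial.X, Polynomial.X, 1] A))
      intro t
      have := hev ![t, t, 1]
      rw [map_mul, eval_substMatrix, reflection_mulVec, eval_C] at this
      simp only [Matrix.cons_val] at this
      rw [Polynomial.eval_mul, Polynomial.eval_C, eval_aeval_diagonal, mul_pow, hs]
      rw [← two_mul, ← pow_two] at this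
      rw [pow_two t, ← this]
      ring
  · obtain ⟨d, d', k₁, k₂, k₃, hB⟩ := eval_eq_of_quintic hb hζ hcB
    -- The vector `(1, 1, 0)` is fixed by the reflection and `B` does not vanish there, so `B` is
    -- symmetric rather than antisymmetric.
    have he1 : e⁻¹ = 1 := by
      have := congrArg (eval ![1, 1, 0]) heB
      rw [eval_substMatrix, reflection_mulVec, map_mul, eval_C] at this
      simp only [Matrix.cons_val] at this
      exact mul_right_cancel₀ hB11 (by rw [one_mul, ← this])
    have hdd : d' = d := by
      have := congrArg (eval ![1, 0, 0]) heB
      rw [he1, C_1, one_mul, eval_substMatrix, reflection_mulVec, hB, hB] at this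
      simpa using this
    have hd : d ≠ 0 := by
      rw [hB] at hB0
      simpa using hB0
    subst hdd
    refine absurd ?_ (hlin (-k₃ / d') (-k₁ / d') (-k₂ / d'))
    intro u
    obtain ⟨x, y, hu, hv⟩ := exists_mul_eq_add_pow_eq u
      (-k₃ / d' + -k₁ / d' * u + -k₂ / d' * u ^ 2)
    have := hev ![x, y, 1]
    rw [hB] at this
    simp only [Matrix.cons_val, hu, hv] at this
    rw [← this, mul_eq_zero]
    right
    have : d' * (x ^ 5 + y ^ 5) = -k₃ - k₁ * u - k₂ * u ^ 2 := by
      rw [hv]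
      field_simp
      ring
    linear_combination this
  · obtain rfl : a = 2 := by omega
    obtain ⟨k, n, hA⟩ := eval_eq_of_quadratic ha hζ hcA
    have hk : k ≠ 0 := by
      rw [hA] at hA11
      simpa using hA11
    -- The conic `k xy + n z²` is the line `u = -n / k` in the `(u, v)`-plane, on which the equation
    -- would have to vanish for all `v`.
    obtain ⟨v, hv⟩ := hconic (-n / k)
    obtain ⟨x, y, hxy, hv'⟩ := exists_mul_eq_add_pow_eq (-n / k) v
    have := hev ![x, y, 1]
    rw [hA] at this
    simp only [Matrix.cons_val, hxy, hv'] at this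
    refine absurd ?_ hv
    rw [← this, mul_eq_zero]
    left
    field_simp
    ring

lemma irreducible_curve36 : Irreducible (curve 20250) :=
  irreducible_curve _ (by norm_num [curveFun]) not_conic_factor_curve36 not_linear_factor_curve36
    not_square_curve36

lemma irreducible_curve45 : Irreducible (curve (-10125)) :=
  irreducible_curve _ (by norm_num [curveFun]) not_conic_factor_curve45 not_linear_factor_curve45
    not_square_curve45

end Valentiner

/-- The curves `C_P` are given by their defining forms, so `Irreducible (curve P)` says that
`C_P` is an irreducible (and reduced) curve. -/
theorem mainTheorem5 :
    (∃ W : Subgroup PGL(3, ℂ), Valentiner.IsValentinerGroupOfF W) ∧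
    (∀ W : Subgroup PGL(3, ℂ), Valentiner.IsValentinerGroupOfF W →
      (∃ q : ℙ ℂ (Fin 3 → ℂ),
        Valentiner.singularLocus (Valentiner.curve 20250) = MulAction.orbit W q ∧
        (MulAction.orbit W q).ncard = 36) ∧
      (∃ q : ℙ ℂ (Fin 3 → ℂ),
        Valentiner.singularLocus (Valentiner.curve (-10125)) = MulAction.orbit W q ∧
        (MulAction.orbit W q).ncard = 45)) ∧
    Valentiner.IsNodal (Valentiner.curve 20250) ∧
    Valentiner.IsNodal (Valentiner.curve (-10125)) ∧
    Irreducible (Valentiner.curve 20250) ∧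
    Irreducible (Valentiner.curve (-10125)) := by
  -- Nodality does not mention `W`, but its proof moves one node around by the group, so some `W` is
  -- needed.
  obtain ⟨W, hW⟩ := Valentiner.exists_isValentinerGroupOfF
  exact ⟨⟨W, hW⟩, fun W hW => ⟨⟨_, Valentiner.singularLocus_curve36_eq hW⟩,
      ⟨_, Valentiner.singularLocus_curve45_eq hW⟩⟩,
    Valentiner.isNodal_of_orbit hW.2 _ (Valentiner.singularLocus_curve36_eq hW).1
      Valentiner.hasNondegenerateHessian_curve36,
    Valentiner.isNodal_of_orbit hW.2 _ (Valentiner.singularLocus_curve45_eq hW).1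
      Valentiner.hasNondegenerateHessian_curve45,
    Valentiner.irreducible_curve36, Valentiner.irreducible_curve45⟩
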